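/- Let $N\ge 1$ and $k\ge 2$ be integers, $\mathbb{Z}_N=\mathbb{Z}/N\mathbb{Z}$, $\mu_N=e^{2\pi i/N}$, and for $u=(m,n)$, $v=(c,d)$ put $(u|v)=md-nc$. For $v\in\mathbb{Z}_N^2$ and $\tau$ in the upper half-plane $\mathbb{H}$ define $$G_k^v(\tau)=\sum_{\substack{(m,n)\in\mathbb{Z}^2\setminus\{(0,0)\}\\ (m,n)\equiv v \bmod N}}\frac{1}{(m\tau+n)^k},\qquad H_k^v(\tau)=\sum_{u=(m,n)\in\mathbb{Z}^2\setminus\{(0,0)\}}\frac{\mu_N^{(u|v)}}{(m\tau+n)^k},$$ where for $k=2$ the sums are taken in Eisenstein's order (inner sum over $n$, outer sum over $m$; for $k\ge3$ they converge absolutely). For a fixed $v_0\in\mathbb{Z}_N^2$ put $g_2^v=G_2^v-G_2^{v_0}$. Let $E_k(\Gamma(N))$ be the Eisenstein subspace, i.e. the orthogonal complement, with respect to the Petersson inner product, of the space of cusp forms $S_k(\Gamma(N))$ in the space of modular forms $M_k(\Gamma(N))$. Then: 1. The set $\{H_k^v : v\in\mathbb{Z}_N^2\}$, where $v=(0,0)$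 is omitted if $k=2$, spans the complex vector space $E_k(\Gamma(N))$ (in particular its elements lie in $E_k(\Gamma(N))$). 2. For all $v\in\mathbb{Z}_N^2$ and $\tau\in\mathbb{H}$, $$H_k^v(\tau)=\sum_{u\in\mathbb{Z}_N^2}\mu_N^{(u|v)}\,G_k^u(\tau),$$ and, inversely, $$G_k^v(\tau)=\frac1{N^2}\sum_{u\in\mathbb{Z}_N^2}\mu_N^{-(v|u)}\,H_k^u(\tau)=\frac{(-1)^k}{N^2}\sum_{u\in\mathbb{Z}_N^2}\mu_N^{-(u|v)}\,H_k^u(\tau).$$ 3. For all $v_0,v\in\mathbb{Z}_N^2$ and $\tau\in\mathbb{H}$, $$g_2^v(\tau)=\frac1{N^2}\sum_{u\in\mathbb{Z}_N^2\setminus\{(0,0)\}}\Big(\mu_N^{-(u|v)}-\mu_N^{-(u|v_0)}\Big)H_2^u(\tau).$$ -/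

import Mathlib

open UpperHalfPlane CongruenceSubgroup Matrix.SpecialLinearGroup MeasureTheory
open scoped MatrixGroups ModularForm Modular

noncomputable section

namespace EisGamma

/-! ### The Eisenstein subspace -/

/-- The principal congruence subgroup `Γ(N)` of `SL(2, ℤ)`, viewed inside `GL(2, ℝ)`. -/
abbrev principal (N : ℕ) : Subgroup (GL (Fin 2) ℝ) := (Gamma N).map (mapGL ℝ)

/-- The Petersson product `⟨f, g⟩ = ∫ f(τ) conj(g(τ)) (Im τ)^k dμ(τ)`, `dμ = dx dy / y²`, over a
fundamental domain for `Γ(N)`: the standard fundamental domain `𝒟` of `SL(2, ℤ)` is translated by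
representatives of the finitely many cosets of `Γ(N)`. (No normalising factor is included; for
`N ≥ 3` every point of `Γ(N) \ ℍ` is counted twice, since `-1 ∉ Γ(N)` acts trivially on `ℍ`.) -/
def peterssonProduct (N : ℕ) (k : ℤ) (f g : ℍ → ℂ) : ℂ :=
  ∑ᶠ γ : SL(2, ℤ) ⧸ Gamma N, ∫ τ in 𝒟, petersson k g f (γ.out⁻¹ • τ)

/-- The hyperbolic area of the standard fundamental domain is finite. -/
lemma volume_fd_lt_top : volume (𝒟 : Set ℍ) < ⊤ := by
  rw [volume_eq_lintegral]
  have hsub : ((↑) '' (𝒟 : Set ℍ) : Set ℂ) ⊆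
      Complex.measurableEquivRealProd ⁻¹' (Set.Icc (-1 / 2) (1 / 2) ×ˢ Set.Ioi (1 / 2)) := by
    rintro _ ⟨τ, hτ, rfl⟩
    have h1 := ModularGroup.three_le_four_mul_im_sq_of_mem_fd hτ
    have h2 := abs_le.mp hτ.2
    have h3 := τ.im_pos
    simp only [Set.mem_preimage, Complex.measurableEquivRealProd_apply, Set.mem_prod, Set.mem_Icc,
      Set.mem_Ioi, coe_re, coe_im]
    exact ⟨⟨by linarith [h2.1], h2.2⟩, by nlinarith⟩
  refine (lintegral_mono_set hsub).trans_lt ?_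
  have hmeas : Measurable fun y : ℝ ↦ (((1 / ‖y‖₊) ^ 2 : NNReal) : ENNReal) := by fun_prop
  have key := Complex.volume_preserving_equiv_real_prod.setLIntegral_comp_preimage_emb
    Complex.measurableEquivRealProd.measurableEmbedding
    (fun p : ℝ × ℝ ↦ (((1 / ‖p.2‖₊) ^ 2 : NNReal) : ENNReal))
    (Set.Icc (-1 / 2) (1 / 2) ×ˢ Set.Ioi (1 / 2))
  simp only [Complex.measurableEquivRealProd_apply] at key
  rw [key, Measure.volume_eq_prod, ← Measure.prod_restrict]
  have h2 := lintegral_prod_mul (μ := volume.restrict (Set.Icc (-1 / 2 : ℝ) (1 / 2)))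
    (ν := volume.restrict (Set.Ioi (1 / 2 : ℝ))) (f := fun _ ↦ 1)
    (g := fun y : ℝ ↦ (((1 / ‖y‖₊) ^ 2 : NNReal) : ENNReal)) (by fun_prop) hmeas.aemeasurable
  simp only [one_mul] at h2
  rw [h2]
  refine ENNReal.mul_lt_top (by simp) ?_
  have hint := (integrableOn_Ioi_rpow_of_lt (a := -2) (c := 1 / 2) (by norm_num)
    (by norm_num)).hasFiniteIntegral
  refine lt_of_eq_of_lt (setLIntegral_congr_fun measurableSet_Ioi fun y hy ↦ ?_) hint
  have hy0 : (0 : ℝ) < y := lt_trans (by norm_num) hy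
  rw [enorm_eq_nnnorm]
  congr 1
  ext
  push_cast
  rw [Real.norm_of_nonneg (Real.rpow_nonneg hy0.le _), Real.norm_of_nonneg hy0.le,
    Real.rpow_neg hy0.le, Real.rpow_ofNat]
  simp

/-- The integrals in the Petersson product of a modular form and a cusp form converge. -/
lemma integrableOn_petersson (N : ℕ) [NeZero N] (k : ℤ) (f : ModularForm (principal N) k)
    (g : CuspForm (principal N) k) (γ : SL(2, ℤ)) :
    IntegrableOn (fun τ ↦ petersson k g f (γ • τ)) 𝒟 := by
  obtain ⟨C, hC⟩ := CuspFormClass.petersson_bounded_left k (principal N) g f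
  have hg : Continuous g := ModularFormClass.continuous g
  have hf : Continuous f := ModularFormClass.continuous f
  refine Measure.integrableOn_of_bounded (M := C) volume_fd_lt_top.ne ?_
    (Filter.Eventually.of_forall fun τ ↦ hC _)
  have hγ : Continuous fun τ : ℍ ↦ γ • τ := by
    simp only [ModularGroup.sl_moeb]
    fun_prop
  exact ((petersson_continuous k hg hf).comp hγ).aestronglyMeasurable

/-- The Eisenstein subspace `E_k(Γ(N))`: the orthogonal complement, in the space of modular forms
`M_k(Γ(N))`, of the cusp forms with respect to the Petersson product. -/
def eisensteinSubspace (N : ℕ) [NeZero N] (k : ℤ) : Submodule ℂ (ModularForm (principal N) k) where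
  carrier := {f | ∀ g : CuspForm (principal N) k, peterssonProduct N k f g = 0}
  zero_mem' g := by simp [peterssonProduct, petersson]
  add_mem' {f₁ f₂} h₁ h₂ g := by
    have e : peterssonProduct N k (f₁ + f₂ : ModularForm (principal N) k) g =
        peterssonProduct N k f₁ g + peterssonProduct N k f₂ g := by
      simp only [peterssonProduct]
      rw [← finsum_add_distrib (Set.toFinite _) (Set.toFinite _)]
      refine finsum_congr fun γ ↦ ?_
      rw [← integral_add (integrableOn_petersson N k f₁ g _) (integrableOn_petersson N k f₂ g _)]
      refine integral_congr_ae (Filter.Eventually.of_forall fun τ ↦ ?_)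
      simp only [petersson, FunLike.coe_add, Pi.add_apply]
      ring
    rw [e, h₁ g, h₂ g, add_zero]
  smul_mem' c f h g := by
    have e : peterssonProduct N k (c • f : ModularForm (principal N) k) g =
        c * peterssonProduct N k f g := by
      simp only [peterssonProduct]
      rw [← smul_eq_mul, smul_finsum]
      refine finsum_congr fun γ ↦ ?_
      rw [smul_eq_mul, ← integral_const_mul]
      refine integral_congr_ae (Filter.Eventually.of_forall fun τ ↦ ?_)
      simp only [petersson, FunLike.coe_smul, Pi.smul_apply, smul_eq_mul]
      ring
    rw [e, h g, mul_zero]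

/-- The inclusion of modular forms into functions on the upper half-plane. -/
def toFunₗ (N : ℕ) (k : ℤ) : ModularForm (principal N) k →ₗ[ℂ] (ℍ → ℂ) where
  toFun f := f
  map_add' _ _ := rfl
  map_smul' _ _ := rfl

/-! ### The series -/

/-- The sum `∑' c(m,n) / (mτ+n)^k` over all `(m,n) ∈ ℤ² ∖ {(0,0)}`, the inner sum being over `n` and
the outer one over `m`. For `k ≥ 3` and bounded `c` the double series converges absolutely (see
`latticeSum_eq_tsum`); for `k = 2` this is Eisenstein's order of summation. -/
def latticeSum (k : ℤ) (c : ℤ → ℤ → ℂ) (τ : ℍ) : ℂ :=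
  ∑' m : ℤ, ∑' n : ℤ, if m = 0 ∧ n = 0 then 0 else c m n / ((m : ℂ) * τ + n) ^ k

/-- For `k ≥ 3` the order of summation does not matter. -/
theorem latticeSum_eq_tsum {k : ℤ} (hk : 3 ≤ k) {c : ℤ → ℤ → ℂ} {C : ℝ}
    (hc : ∀ m n, ‖c m n‖ ≤ C) (τ : ℍ) :
    Summable (fun p : ℤ × ℤ ↦
      if p.1 = 0 ∧ p.2 = 0 then 0 else c p.1 p.2 / ((p.1 : ℂ) * τ + p.2) ^ k) ∧
    latticeSum k c τ = ∑' p : ℤ × ℤ,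
      if p.1 = 0 ∧ p.2 = 0 then 0 else c p.1 p.2 / ((p.1 : ℂ) * τ + p.2) ^ k := by
  have hs : Summable (fun p : ℤ × ℤ ↦
      if p.1 = 0 ∧ p.2 = 0 then 0 else c p.1 p.2 / ((p.1 : ℂ) * τ + p.2) ^ k) := by
    have h0 := (EisensteinSeries.summable_norm_eisSummand hk τ).mul_left C
    have h1 := (finTwoArrowEquiv ℤ).symm.summable_iff.mpr h0
    refine Summable.of_norm_bounded h1 fun p ↦ ?_
    have hC : 0 ≤ C := (norm_nonneg _).trans (hc 0 0)
    split_ifs with h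
    · simp only [norm_zero, Function.comp]
      positivity
    · simp only [Function.comp, EisensteinSeries.eisSummand, finTwoArrowEquiv_symm_apply,
        Matrix.cons_val_zero, Matrix.cons_val_one, zpow_neg, div_eq_mul_inv, norm_mul]
      gcongr
      exact hc _ _
  exact ⟨hs, hs.tsum_prod.symm⟩

/-- The pairing `(u|v) = md - nc` of `u = (m,n)` and `v = (c,d)`, modulo `N`. -/
def pairing {N : ℕ} (u v : Fin 2 → ZMod N) : ZMod N := u 0 * v 1 - u 1 * v 0

/-- `μ_N ^ j = exp (2πi j / N)` for `j ∈ ℤ / Nℤ`. -/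
def mu {N : ℕ} [NeZero N] (j : ZMod N) : ℂ := ZMod.stdAddChar j

/-- `G_k^v(τ)`: the sum of `1 / (mτ+n)^k` over nonzero `(m,n) ≡ v` modulo `N`. -/
def eisG (N : ℕ) (k : ℤ) (v : Fin 2 → ZMod N) (τ : ℍ) : ℂ :=
  latticeSum k (fun m n ↦ if (m : ZMod N) = v 0 ∧ (n : ZMod N) = v 1 then 1 else 0) τ

/-- `H_k^v(τ)`: the sum of `μ_N^((u|v)) / (mτ+n)^k` over nonzero `u = (m,n) ∈ ℤ²`. -/
def eisH (N : ℕ) [NeZero N] (k : ℤ) (v : Fin 2 → ZMod N) (τ : ℍ) : ℂ :=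
  latticeSum k (fun m n ↦ mu (pairing ![(m : ZMod N), (n : ZMod N)] v)) τ

/-- `g_2^v = G_2^v - G_2^{v₀}`, for a fixed `v₀`. -/
def eisg (N : ℕ) (v₀ v : Fin 2 → ZMod N) (τ : ℍ) : ℂ := eisG N 2 v τ - eisG N 2 v₀ τ

end EisGamma

end

/-! Every series here is an `eisSeries k c`, with coefficients `c` on (ℤ/N)²: `eisG` takes for `c` a
delta function, `eisH` a character u ↦ μ^(u|v). The relations between G, H and g are therefore
Fourier inversion on (ℤ/N)² (`sum_mu_pairing_left`). The spanning statement amounts to this: the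
Eisenstein subspace consists exactly of the series `eisSeries k c`, where ∑ c = 0 is required if k =
2. Indeed the characters with v ≠ 0 span the functions of sum zero.

Modularity. For k = 2 the lattice sum is not absolutely convergent, so the kernel a⁻ᵏ with a = mτ +
n is multiplied by χ(ε|a|²/y), where y = Im τ. The quantity |a|²/y is invariant under SL(2, ℤ)
acting on τ and (m, n) together, so the regularised series transforms exactly (`regSeries_smul`). As
ε → 0 it tends to (k - 1) `eisSeries` (`tendsto_regSeries`): the lattice is summed in blocks modulo
N, and for k = 2 the condition ∑ c = 0 gains one power of decay in every block
(`exists_norm_groupTerm_le`).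

Orthogonality. The cutoff χ is chosen so that y^(k-2) times the regularised kernel is, up to the
factor -i, the image under ∂/∂x - i ∂/∂y of an explicit decaying potential
(`hasWirtingerAt_regPotential`). The conjugate of a cusp form is annihilated by this operator, hence
the regularised Petersson integrand is exact. Stokes' theorem on the truncated fundamental domain
leaves the top side only (`stokes_tsum`), and this tends to 0 with the cusp form. The truncation is
removed at fixed ε, and then ε → 0 by dominated convergence (`integral_fd_pairedEis`).

Spanning. Given f in the Eisenstein subspace, Möbius inversion produces series whose constant terms
are concentrated at a single cusp (`eisConst_moebiusCoeff`), and averaging them over the cosets of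
Γ(N) matches all constant terms of f (`exists_eisConst_twist_eq`). The difference is a cusp form
orthogonal to all cusp forms, so it is 0 (`cuspForm_eq_zero`). For k = 2 the condition ∑ c = 0 holds
because the trace of f to level one lies in a zero space (`sum_constTerm_eq_zero`). -/

noncomputable section

/-! ### Eisenstein series with periodic coefficients: convergence, holomorphy, constant term. -/

namespace EisGamma

open Filter Topology
open scoped Manifold

/-! ### The series `∑ n, (z + n)^(-k)` -/

/-- The series `∑ n : ℤ, (z + n)^(-k)`. -/
def lipschitzSeries (k : ℕ) (z : ℂ) : ℂ := ∑' n : ℤ, 1 / (z + n) ^ k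

lemma lipschitzSeries_eq {k : ℕ} (hk : 2 ≤ k) (z : ℍ) :
    lipschitzSeries k z = ((-2 * Real.pi * Complex.I) ^ k / (k - 1).factorial) *
      ∑' n : ℕ, (n : ℂ) ^ (k - 1) * Complex.exp (2 * Real.pi * Complex.I * z) ^ n := by
  have h := EisensteinSeries.qExpansion_identity (k := k - 1) (by omega) z
  rwa [show k - 1 + 1 = k by omega] at h

lemma norm_exp_two_pi_I_mul (z : ℂ) :
    ‖Complex.exp (2 * Real.pi * Complex.I * z)‖ = Real.exp (-2 * Real.pi * z.im) := by
  rw [Complex.norm_exp]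
  congr 1
  simp [Complex.mul_re, Complex.mul_im]

/-- The q-expansion has no constant term, so one factor q can be pulled out; what remains is
dominated by its value at `x₀`, the largest modulus of q that is allowed. -/
lemma exists_norm_lipschitzSeries_le {k : ℕ} (hk : 2 ≤ k) {δ : ℝ} (hδ : 0 < δ) :
    ∃ C, 0 ≤ C ∧ ∀ z : ℍ, δ ≤ z.im →
      ‖lipschitzSeries k z‖ ≤ C * Real.exp (-2 * Real.pi * z.im) := by
  set x₀ := Real.exp (-2 * Real.pi * δ) with hx₀
  have hx₀1 : ‖x₀‖ < 1 := by
    rw [Real.norm_of_nonneg (Real.exp_nonneg _), Real.exp_lt_one_iff]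
    have := mul_pos Real.pi_pos hδ
    linarith
  have hs₀ : Summable fun n : ℕ ↦ (n : ℝ) ^ (k - 1) * x₀ ^ n :=
    summable_pow_mul_geometric_of_norm_lt_one (k - 1) hx₀1
  have hs₁ : Summable fun n : ℕ ↦ ((n + 1 : ℕ) : ℝ) ^ (k - 1) * x₀ ^ n := by
    have := ((summable_nat_add_iff 1).mpr hs₀).mul_left x₀⁻¹
    refine this.congr fun n ↦ ?_
    have : x₀ ≠ 0 := (Real.exp_pos _).ne'
    rw [pow_succ]
    field_simp
  refine ⟨‖((-2 * Real.pi * Complex.I) ^ k / (k - 1).factorial : ℂ)‖ *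
    ∑' n : ℕ, ((n + 1 : ℕ) : ℝ) ^ (k - 1) * x₀ ^ n, by positivity, fun z hz ↦ ?_⟩
  rw [lipschitzSeries_eq hk, norm_mul, mul_assoc (‖_‖)]
  refine mul_le_mul_of_nonneg_left ?_ (norm_nonneg _)
  set q := Complex.exp (2 * Real.pi * Complex.I * z) with hq
  have hqn : ‖q‖ = Real.exp (-2 * Real.pi * z.im) := norm_exp_two_pi_I_mul z
  have hqx : ‖q‖ ≤ x₀ := by
    rw [hqn, hx₀, Real.exp_le_exp]
    nlinarith [Real.pi_pos]
  have hsq : Summable fun n : ℕ ↦ (n : ℂ) ^ (k - 1) * q ^ n :=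
    summable_pow_mul_geometric_of_norm_lt_one (k - 1) (hqx.trans_lt (by
      rwa [Real.norm_of_nonneg (Real.exp_nonneg _)] at hx₀1))
  -- The term n = 0 vanishes because k - 1 ≠ 0.
  rw [hsq.tsum_eq_zero_add, ← hqn]
  simp only [Nat.cast_zero, zero_pow (show k - 1 ≠ 0 by omega), zero_mul, zero_add]
  rw [mul_comm, ← tsum_mul_left]
  refine tsum_of_norm_bounded (hs₁.mul_left _).hasSum fun n ↦ ?_
  rw [norm_mul, norm_pow, norm_pow, Complex.norm_natCast, pow_succ]
  have : ‖q‖ ^ n ≤ x₀ ^ n := pow_le_pow_left₀ (norm_nonneg _) hqx n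
  calc ((n + 1 : ℕ) : ℝ) ^ (k - 1) * (‖q‖ ^ n * ‖q‖)
      = ‖q‖ * (((n + 1 : ℕ) : ℝ) ^ (k - 1) * ‖q‖ ^ n) := by ring
    _ ≤ _ := by gcongr

lemma differentiableOn_lipschitzSeries {k : ℕ} (hk : 2 ≤ k) :
    DifferentiableOn ℂ (lipschitzSeries k) upperHalfPlaneSet := by
  have h0 : (fun n : ℕ ↦ ((n : ℂ) ^ (k - 1))) =O[atTop] fun n ↦ ((n ^ (k - 1) : ℕ) : ℝ) := by
    simpa [← Complex.isBigO_ofReal_right] using Asymptotics.isBigO_refl _ _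
  -- Order of derivation 0: this is locally uniform summability of the q-expansion itself.
  have h := summableLocallyUniformlyOn_iteratedDerivWithin_smul_cexp 0 (k - 1) (p := 1)
    one_pos (by simpa using h0)
  have hd := h.differentiableOn isOpen_upperHalfPlaneSet (fun n z hz ↦ by
    simp only [iteratedDerivWithin_zero]
    refine (DifferentiableAt.const_smul (by fun_prop) _))
  refine (hd.const_mul ((-2 * Real.pi * Complex.I) ^ k / (k - 1).factorial)).congr fun z hz ↦ ?_
  lift z to ℍ using hz
  rw [lipschitzSeries_eq hk]
  simp

/-! ### Splitting sums over `ℤ` into residue classes -/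

lemma tsum_int_eq_tsum_residues (N : ℕ) [NeZero N] {E : Type*} [NormedAddCommGroup E]
    [CompleteSpace E] {f : ℤ → E} (hf : Summable f) :
    (∀ b : Fin N, Summable fun j : ℤ ↦ f (j * N + b)) ∧
    ∑' n, f n = ∑' j : ℤ, ∑ b : Fin N, f (j * N + b) := by
  have h1 : Summable fun p : ℤ × Fin N ↦ f (p.1 * N + p.2) :=
    (Int.divModEquiv N).symm.summable_iff.mpr hf
  refine ⟨fun b ↦ h1.comp_injective (i := fun j : ℤ ↦ (j, b)) fun i j h ↦ by simpa using h, ?_⟩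
  rw [← (Int.divModEquiv N).symm.tsum_eq f]
  simp only [Int.divModEquiv_symm_apply]
  rw [h1.tsum_prod]
  simp

/-! ### Eisenstein series with periodic coefficients -/

variable {N : ℕ}

/-- The summand `c(m, n) / (mτ + n)^k`. -/
def eisTerm (k : ℕ) (c : (Fin 2 → ZMod N) → ℂ) (m n : ℤ) (τ : ℍ) : ℂ :=
  c ![(m : ZMod N), (n : ZMod N)] / ((m : ℂ) * τ + n) ^ k

/-- The inner sum over `n` of an Eisenstein series with coefficients `c`. -/
def eisRow (k : ℕ) (c : (Fin 2 → ZMod N) → ℂ) (m : ℤ) (τ : ℍ) : ℂ :=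
  ∑' n : ℤ, eisTerm k c m n τ

/-- The Eisenstein series with `N`-periodic coefficients `c`, summed in Eisenstein's order. -/
def eisSeries (k : ℕ) (c : (Fin 2 → ZMod N) → ℂ) (τ : ℍ) : ℂ :=
  ∑' m : ℤ, eisRow k c m τ

/-- The origin needs no exclusion in `eisTerm`: for k ≠ 0 its term is a division by 0 and so has the
value 0. -/
lemma latticeSum_eq_eisSeries {k : ℕ} (hk : k ≠ 0) (c : (Fin 2 → ZMod N) → ℂ) (τ : ℍ) :
    latticeSum k (fun m n ↦ c ![(m : ZMod N), (n : ZMod N)]) τ = eisSeries k c τ := by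
  unfold latticeSum eisSeries eisRow eisTerm
  refine tsum_congr fun m ↦ tsum_congr fun n ↦ ?_
  split_ifs with h
  · simp [h.1, h.2, hk]
  · rw [zpow_natCast]

lemma exists_norm_le_of_finite [NeZero N] (c : (Fin 2 → ZMod N) → ℂ) :
    ∃ C, 0 ≤ C ∧ ∀ v, ‖c v‖ ≤ C :=
  ⟨∑ v, ‖c v‖, by positivity, fun v ↦
    Finset.single_le_sum (f := fun v ↦ ‖c v‖) (fun _ _ ↦ norm_nonneg _) (Finset.mem_univ v)⟩

lemma summable_eisTerm [NeZero N] {k : ℕ} (hk : 2 ≤ k) (c : (Fin 2 → ZMod N) → ℂ) (m : ℤ) (τ : ℍ) :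
    Summable fun n : ℤ ↦ eisTerm k c m n τ := by
  obtain ⟨C, hC0, hC⟩ := exists_norm_le_of_finite c
  have h := (EisensteinSeries.linear_right_summable (τ : ℂ) m (k := k) (by exact_mod_cast hk)).norm
  refine Summable.of_norm_bounded (h.mul_left C) fun n ↦ ?_
  rw [eisTerm, div_eq_mul_inv, norm_mul, zpow_natCast]
  gcongr
  exact hC _

/-- Write n = jN + b, so that mτ + n = N((mτ + b)/N + j). -/
lemma eisRow_eq_sum_lipschitzSeries [NeZero N] {k : ℕ} (hk : 2 ≤ k) (c : (Fin 2 → ZMod N) → ℂ)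
    (m : ℤ) (τ : ℍ) :
    eisRow k c m τ = ∑ b : Fin N, c ![(m : ZMod N), (b : ZMod N)] / (N : ℂ) ^ k *
      lipschitzSeries k (((m : ℂ) * τ + (b : ℕ)) / N) := by
  have hN : (N : ℂ) ≠ 0 := Nat.cast_ne_zero.mpr (NeZero.ne N)
  obtain ⟨h1, h2⟩ := tsum_int_eq_tsum_residues N (summable_eisTerm hk c m τ)
  rw [eisRow, h2, Summable.tsum_finsetSum fun b _ ↦ h1 b]
  refine Finset.sum_congr rfl fun b _ ↦ ?_
  rw [lipschitzSeries, ← tsum_mul_left]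
  refine tsum_congr fun j ↦ ?_
  rw [eisTerm]
  have e : (m : ℂ) * τ + ((j * N + (b : ℕ) : ℤ) : ℂ) = N * (((m : ℂ) * τ + (b : ℕ)) / N + j) := by
    push_cast
    field_simp
    ring
  rw [e, mul_pow]
  have : ((j * N + (b : ℕ) : ℤ) : ZMod N) = ((b : ℕ) : ZMod N) := by simp
  rw [this]
  rw [div_mul_div_comm, mul_one]

/-- Reduces rows with m < 0, where (mτ + b)/N leaves the upper half-plane, to rows with m > 0. -/
lemma eisRow_neg {k : ℕ} (c : (Fin 2 → ZMod N) → ℂ) (m : ℤ) (τ : ℍ) :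
    eisRow k (fun v ↦ c (-v)) m τ = (-1) ^ k * eisRow k c (-m) τ := by
  rw [eisRow, eisRow, ← tsum_mul_left, ← (Equiv.neg ℤ).tsum_eq]
  refine tsum_congr fun n ↦ ?_
  have hv : (-![(m : ZMod N), ((-n : ℤ) : ZMod N)]) = ![((-m : ℤ) : ZMod N), (n : ZMod N)] := by
    ext i; fin_cases i <;> simp
  have e : ((-m : ℤ) : ℂ) * τ + n = (-1) * ((m : ℂ) * τ + ((-n : ℤ) : ℂ)) := by push_cast; ring
  simp only [eisTerm, Equiv.neg_apply]
  rw [hv, e, mul_pow]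
  rcases Nat.even_or_odd k with h | h <;> simp [h.neg_one_pow, div_neg]

lemma eisSeries_comp_neg {k : ℕ} (c : (Fin 2 → ZMod N) → ℂ) (τ : ℍ) :
    eisSeries k (fun v ↦ c (-v)) τ = (-1) ^ k * eisSeries k c τ := by
  rw [eisSeries, eisSeries, ← tsum_mul_left, ← (Equiv.neg ℤ).tsum_eq]
  refine tsum_congr fun m ↦ ?_
  rw [eisRow_neg]
  simp

/-- For m > 0 the points (mτ + b)/N have imaginary part m Im τ / N ≥ y₀/N, so the decay of the
Lipschitz series becomes geometric decay in |m|. This makes the outer sum converge absolutely even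
for k = 2. -/
lemma exists_norm_eisRow_le [NeZero N] {k : ℕ} (hk : 2 ≤ k) (c : (Fin 2 → ZMod N) → ℂ)
    {y₀ : ℝ} (hy₀ : 0 < y₀) :
    ∃ C, 0 ≤ C ∧ ∀ m : ℤ, m ≠ 0 → ∀ τ : ℍ, y₀ ≤ τ.im →
      ‖eisRow k c m τ‖ ≤ C * Real.exp (-2 * Real.pi * τ.im / N) ^ m.natAbs := by
  have hN : (0 : ℝ) < N := Nat.cast_pos.mpr (NeZero.pos N)
  obtain ⟨C, hC0, hC⟩ := exists_norm_lipschitzSeries_le hk (δ := y₀ / N) (by positivity)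
  have pos : ∀ c : (Fin 2 → ZMod N) → ℂ, ∀ M : ℝ, 0 ≤ M → (∀ v, ‖c v‖ ≤ M) → ∀ m : ℤ, 0 < m →
      ∀ τ : ℍ, y₀ ≤ τ.im →
      ‖eisRow k c m τ‖ ≤ N * (M * C) * Real.exp (-2 * Real.pi * τ.im / N) ^ m.natAbs := by
    intro c M hM0 hM m hm τ hτ
    rw [eisRow_eq_sum_lipschitzSeries hk]
    have hm1 : (1 : ℝ) ≤ m := by exact_mod_cast hm
    have key : ∀ b : Fin N, ‖c ![(m : ZMod N), (b : ZMod N)] / (N : ℂ) ^ k *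
        lipschitzSeries k (((m : ℂ) * τ + (b : ℕ)) / N)‖ ≤
        M * C * Real.exp (-2 * Real.pi * τ.im / N) ^ m.natAbs := by
      intro b
      have him : (((m : ℂ) * τ + (b : ℕ)) / N).im = m * τ.im / N := by
        rw [Complex.div_natCast_im]
        simp
      have hp : 0 < (((m : ℂ) * τ + (b : ℕ)) / N).im := by
        rw [him]
        have := τ.im_pos
        positivity
      have h1 := hC ⟨_, hp⟩ (by
        change y₀ / N ≤ (((m : ℂ) * τ + (b : ℕ)) / N).im
        rw [him]
        gcongr
        nlinarith)
      change ‖lipschitzSeries k (((m : ℂ) * τ + (b : ℕ)) / N)‖ ≤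
        C * Real.exp (-2 * Real.pi * (((m : ℂ) * τ + (b : ℕ)) / N).im) at h1
      rw [him] at h1
      have h2 : Real.exp (-2 * Real.pi * (m * τ.im / N)) =
          Real.exp (-2 * Real.pi * τ.im / N) ^ m.natAbs := by
        rw [← Real.exp_nat_mul]
        congr 1
        have : ((m.natAbs : ℕ) : ℝ) = m := by
          rw [Nat.cast_natAbs, abs_of_pos hm]
        rw [this]
        ring
      rw [h2] at h1
      rw [norm_mul, mul_assoc]
      refine mul_le_mul ?_ h1 (norm_nonneg _) hM0
      rw [norm_div, norm_pow, Complex.norm_natCast]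
      have : (1 : ℝ) ≤ (N : ℝ) ^ k := one_le_pow₀ (by exact_mod_cast NeZero.pos N)
      exact (div_le_self (norm_nonneg _) this).trans (hM _)
    refine (norm_sum_le_of_le _ fun b _ ↦ key b).trans (le_of_eq ?_)
    simp
    ring
  obtain ⟨M, hM0, hM⟩ := exists_norm_le_of_finite c
  refine ⟨N * (M * C), by positivity, fun m hm τ hτ ↦ ?_⟩
  rcases hm.lt_or_gt with h | h
  · have h1 := pos (fun v ↦ c (-v)) M hM0 (fun v ↦ hM _) (-m) (by omega) τ hτ
    rw [eisRow_neg, neg_neg, Int.natAbs_neg] at h1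
    simpa using h1
  · exact pos c M hM0 hM m h τ hτ

lemma exp_neg_im_div_lt_one [NeZero N] {y : ℝ} (hy : 0 < y) :
    Real.exp (-2 * Real.pi * y / N) < 1 := by
  have hN : (0 : ℝ) < N := Nat.cast_pos.mpr (NeZero.pos N)
  rw [Real.exp_lt_one_iff, neg_mul, neg_mul, neg_div, neg_lt_zero]
  positivity

lemma summable_pow_natAbs {x : ℝ} (hx0 : 0 ≤ x) (hx1 : x < 1) :
    Summable fun m : ℤ ↦ x ^ m.natAbs := by
  refine Summable.of_nat_of_neg ?_ ?_ <;>
  simpa using summable_geometric_of_lt_one hx0 hx1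

lemma exists_summable_bound_eisRow [NeZero N] {k : ℕ} (hk : 2 ≤ k) (c : (Fin 2 → ZMod N) → ℂ)
    {y₀ : ℝ} (hy₀ : 0 < y₀) :
    ∃ B : ℤ → ℝ, Summable B ∧ ∀ m : ℤ, m ≠ 0 → ∀ τ : ℍ, y₀ ≤ τ.im → ‖eisRow k c m τ‖ ≤ B m := by
  obtain ⟨C, hC0, hC⟩ := exists_norm_eisRow_le hk c hy₀
  refine ⟨_, (summable_pow_natAbs (Real.exp_nonneg _)
    (exp_neg_im_div_lt_one (N := N) hy₀)).mul_left C, fun m hm τ hτ ↦ (hC m hm τ hτ).trans ?_⟩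
  have : -2 * Real.pi * τ.im / N ≤ -2 * Real.pi * y₀ / N := by
    apply div_le_div_of_nonneg_right _ (Nat.cast_nonneg N)
    nlinarith [Real.pi_pos]
  gcongr

lemma summable_of_bound_ne_zero {f : ℤ → ℂ} {B : ℤ → ℝ} (hB : Summable B)
    (h : ∀ m, m ≠ 0 → ‖f m‖ ≤ B m) : Summable f := by
  refine Summable.of_norm_bounded_eventually hB ?_
  filter_upwards [(Set.finite_singleton (0 : ℤ)).compl_mem_cofinite] with m hm using h m hm

lemma summable_eisRow [NeZero N] {k : ℕ} (hk : 2 ≤ k) (c : (Fin 2 → ZMod N) → ℂ) (τ : ℍ) :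
    Summable fun m : ℤ ↦ eisRow k c m τ := by
  obtain ⟨B, hB, h⟩ := exists_summable_bound_eisRow hk c τ.im_pos
  exact summable_of_bound_ne_zero hB fun m hm ↦ h m hm τ le_rfl

/-! ### Linearity in the coefficients -/

lemma eisSeries_sum [NeZero N] {k : ℕ} (hk : 2 ≤ k) {ι : Type*} (s : Finset ι) (a : ι → ℂ)
    (c : ι → (Fin 2 → ZMod N) → ℂ) (τ : ℍ) :
    eisSeries k (fun v ↦ ∑ i ∈ s, a i * c i v) τ = ∑ i ∈ s, a i * eisSeries k (c i) τ := by
  have hrow : ∀ m : ℤ, eisRow k (fun v ↦ ∑ i ∈ s, a i * c i v) m τ =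
      ∑ i ∈ s, a i * eisRow k (c i) m τ := by
    intro m
    simp only [eisRow, ← tsum_mul_left]
    rw [← Summable.tsum_finsetSum fun i _ ↦ (summable_eisTerm hk (c i) m τ).mul_left (a i)]
    refine tsum_congr fun n ↦ ?_
    simp only [eisTerm, Finset.sum_div, mul_div_assoc]
  simp only [eisSeries, ← tsum_mul_left]
  rw [← Summable.tsum_finsetSum fun i _ ↦ (summable_eisRow hk (c i) τ).mul_left (a i)]
  exact tsum_congr hrow

/-! ### Holomorphy and the constant term -/

lemma differentiableOn_eisRow [NeZero N] {k : ℕ} (hk : 2 ≤ k) (c : (Fin 2 → ZMod N) → ℂ) (m : ℤ) :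
    DifferentiableOn ℂ (fun z ↦ eisRow k c m (ofComplex z)) upperHalfPlaneSet := by
  have hN : (0 : ℝ) < N := Nat.cast_pos.mpr (NeZero.pos N)
  have pos : ∀ c : (Fin 2 → ZMod N) → ℂ, ∀ m : ℤ, 0 < m →
      DifferentiableOn ℂ (fun z ↦ eisRow k c m (ofComplex z)) upperHalfPlaneSet := by
    intro c m hm
    have hd : DifferentiableOn ℂ (fun z : ℂ ↦ ∑ b : Fin N,
        c ![(m : ZMod N), (b : ZMod N)] / (N : ℂ) ^ k *
        lipschitzSeries k (((m : ℂ) * z + (b : ℕ)) / N)) upperHalfPlaneSet := by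
      refine DifferentiableOn.fun_sum fun b _ ↦ DifferentiableOn.const_mul ?_ _
      refine (differentiableOn_lipschitzSeries hk).comp (by fun_prop) fun z hz ↦ ?_
      change 0 < (((m : ℂ) * z + (b : ℕ)) / N).im
      rw [Complex.div_natCast_im]
      have : (0 : ℝ) < m := by exact_mod_cast hm
      have hz : 0 < z.im := hz
      simp
      positivity
    refine hd.congr fun z hz ↦ ?_
    rw [eisRow_eq_sum_lipschitzSeries hk, ofComplex_apply_of_im_pos hz]
  rcases lt_trichotomy m 0 with h | h | h
  · have h1 := (pos (fun v ↦ c (-v)) (-m) (by omega)).const_mul ((-1) ^ k)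
    refine h1.congr fun z hz ↦ ?_
    rw [eisRow_neg, neg_neg, ← mul_assoc, ← pow_add, Even.neg_one_pow ⟨k, rfl⟩, one_mul]
  · subst h
    refine (differentiableOn_const (∑' n : ℤ, c ![0, (n : ZMod N)] / (n : ℂ) ^ k)).congr
      fun z hz ↦ ?_
    simp [eisRow, eisTerm]
  · exact pos c m h

lemma mdifferentiable_eisSeries [NeZero N] {k : ℕ} (hk : 2 ≤ k) (c : (Fin 2 → ZMod N) → ℂ) :
    MDiff (eisSeries k c) := by
  rw [UpperHalfPlane.mdifferentiable_iff]
  intro z hz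
  have hz : 0 < z.im := hz
  have hopen : IsOpen {w : ℂ | z.im / 2 < w.im} := isOpen_lt continuous_const Complex.continuous_im
  obtain ⟨B, hB, h⟩ := exists_summable_bound_eisRow hk c (half_pos hz)
  have hsub : {w : ℂ | z.im / 2 < w.im} ⊆ upperHalfPlaneSet := fun w (hw : z.im / 2 < w.im) ↦
    show 0 < w.im by linarith
  -- The bound `B` says nothing about the row m = 0, which is split off and added back afterwards.
  have hd : DifferentiableOn ℂ (fun w ↦ ∑' m : ℤ, if m = 0 then 0 else eisRow k c m (ofComplex w))
      {w : ℂ | z.im / 2 < w.im} := by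
    refine Complex.differentiableOn_tsum_of_summable_norm hB.norm (fun m ↦ ?_) hopen fun m w hw ↦ ?_
    · split_ifs
      · exact differentiableOn_const 0
      · exact (differentiableOn_eisRow hk c m).mono hsub
    · split_ifs with hm
      · simp
      · refine (h m hm _ ?_).trans (le_abs_self _)
        rw [ofComplex_apply_of_im_pos (hsub hw)]
        exact le_of_lt hw
  have hd2 := hd.add ((differentiableOn_eisRow hk c 0).mono hsub)
  have hmem : {w : ℂ | z.im / 2 < w.im} ∈ 𝓝 z := hopen.mem_nhds (show z.im / 2 < z.im by linarith)
  refine (((hd2.differentiableAt hmem).congr_of_eventuallyEq ?_)).differentiableWithinAt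
  filter_upwards with w
  simp only [Function.comp, eisSeries, Pi.add_apply]
  rw [(summable_eisRow hk c (ofComplex w)).tsum_eq_add_tsum_ite 0, add_comm]

/-- The constant term at `i∞` of an Eisenstein series. -/
def eisConst (k : ℕ) (c : (Fin 2 → ZMod N) → ℂ) : ℂ := ∑' n : ℤ, c ![0, (n : ZMod N)] / (n : ℂ) ^ k

/-- The row m = 0 does not depend on τ, and all the others decay exponentially in Im τ. -/
lemma tendsto_eisSeries_atImInfty [NeZero N] {k : ℕ} (hk : 2 ≤ k) (c : (Fin 2 → ZMod N) → ℂ) :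
    Tendsto (eisSeries k c) atImInfty (𝓝 (eisConst k c)) := by
  have hN : (0 : ℝ) < N := Nat.cast_pos.mpr (NeZero.pos N)
  obtain ⟨C, hC0, hC⟩ := exists_norm_eisRow_le hk c one_pos
  have hq : Tendsto (fun τ : ℍ ↦ Real.exp (-2 * Real.pi * τ.im / N)) atImInfty (𝓝 0) := by
    refine Real.tendsto_exp_atBot.comp ?_
    have h1 : Tendsto (fun τ : ℍ ↦ τ.im) atImInfty atTop := tendsto_comap
    refine (h1.const_mul_atTop_of_neg (r := -2 * Real.pi / N) ?_).congr fun τ ↦ by ring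
    have := Real.pi_pos
    exact div_neg_of_neg_of_pos (by linarith) hN
  have h := tendsto_tsum_of_dominated_convergence (𝓕 := atImInfty)
    (f := fun τ m ↦ eisRow k c m τ) (g := fun m : ℤ ↦ if m = 0 then eisConst k c else 0)
    (bound := fun m : ℤ ↦ (if m = 0 then ‖eisConst k c‖ else 0) +
      C * Real.exp (-2 * Real.pi * 1 / N) ^ m.natAbs) ?_ ?_ ?_
  · rw [tsum_ite_eq] at h
    exact h
  · refine Summable.add ?_ ((summable_pow_natAbs (Real.exp_nonneg _)
      (exp_neg_im_div_lt_one (N := N) one_pos)).mul_left C)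
    exact summable_of_ne_finset_zero (s := {0}) fun b hb ↦ by simp_all
  · intro m
    split_ifs with hm
    · subst hm
      simp [eisRow, eisTerm, eisConst]
    · rw [tendsto_zero_iff_norm_tendsto_zero]
      have h0 : Tendsto (fun τ : ℍ ↦ C * Real.exp (-2 * Real.pi * τ.im / N) ^ m.natAbs) atImInfty
          (𝓝 0) := by
        have := (hq.pow m.natAbs).const_mul C
        simpa [hm] using this
      refine squeeze_zero' (Eventually.of_forall fun _ ↦ norm_nonneg _) ?_ h0
      filter_upwards [preimage_mem_comap (Ici_mem_atTop 1)] with τ hτ using hC m hm τ hτ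
  · filter_upwards [preimage_mem_comap (Ici_mem_atTop 1)] with τ hτ m
    split_ifs with hm
    · subst hm
      simp only [eisRow, eisTerm, eisConst, Int.cast_zero, zero_mul, zero_add]
      exact le_add_of_nonneg_right (by positivity)
    · refine (hC m hm τ hτ).trans ?_
      have : -2 * Real.pi * τ.im / N ≤ -2 * Real.pi * 1 / N := by
        apply div_le_div_of_nonneg_right _ hN.le
        have hτ : 1 ≤ τ.im := hτ
        nlinarith [Real.pi_pos]
      rw [zero_add]
      gcongr

end EisGamma

/-! ### Fourier inversion: the formulas relating `eisG`, `eisH` and `eisg`. -/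

namespace EisGamma

/-! ### The finite Fourier transform -/

lemma pairing_sub_left {N : ℕ} (u v w : Fin 2 → ZMod N) :
    pairing (u - v) w = pairing u w - pairing v w := by
  simp only [pairing, Pi.sub_apply]
  ring

lemma eisG_eq {N : ℕ} {k : ℕ} (hk : k ≠ 0) (v : Fin 2 → ZMod N) :
    eisG N k v = eisSeries k fun w ↦ if w = v then 1 else 0 := by
  ext τ
  rw [← latticeSum_eq_eisSeries hk, eisG]
  congr! 3 with m n
  simp [funext_iff, Fin.forall_fin_two]

variable {N : ℕ} [NeZero N]

lemma mu_add (i j : ZMod N) : mu (i + j) = mu i * mu j := AddChar.map_add_eq_mul _ _ _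

lemma mu_zero : mu (0 : ZMod N) = 1 := AddChar.map_zero_eq_one _

lemma sum_mu_mul (t : ZMod N) : ∑ j : ZMod N, mu (j * t) = if t = 0 then (N : ℂ) else 0 := by
  have h := AddChar.sum_mulShift t (ZMod.isPrimitive_stdAddChar N)
  rw [ZMod.card] at h
  simpa [mu] using h

/-- The sum factors into one character sum for each coordinate of u; both are nonzero only for v =
0. -/
lemma sum_mu_pairing_left (v : Fin 2 → ZMod N) :
    ∑ u, mu (pairing u v) = if v = 0 then (N : ℂ) ^ 2 else 0 := by
  have h1 : ∑ u, mu (pairing u v) = (∑ i : ZMod N, mu (i * v 1)) * ∑ j : ZMod N, mu (j * -v 0) := by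
    rw [Finset.sum_mul_sum, ← Fintype.sum_prod_type', ← (finTwoArrowEquiv (ZMod N)).symm.sum_comp]
    refine Fintype.sum_congr _ _ fun p ↦ ?_
    rw [← mu_add]
    congr 1
    simp [pairing]
    ring
  rw [h1, sum_mu_mul, sum_mu_mul]
  have h2 : v = 0 ↔ v 1 = 0 ∧ -v 0 = 0 := by
    rw [funext_iff, Fin.forall_fin_two]
    simp [and_comm]
  by_cases ha : v 1 = 0 <;> by_cases hb : -v 0 = 0 <;> simp [h2, ha, hb, sq]

lemma sum_mu_pairing_right (v : Fin 2 → ZMod N) :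
    ∑ u, mu (pairing v u) = if v = 0 then (N : ℂ) ^ 2 else 0 := by
  have h : ∀ u, pairing v u = pairing u (-v) := fun u ↦ by
    simp only [pairing, Pi.neg_apply]; ring
  simp only [h, sum_mu_pairing_left, neg_eq_zero]

lemma eisH_eq {k : ℕ} (hk : k ≠ 0) (v : Fin 2 → ZMod N) :
    eisH N k v = eisSeries k fun w ↦ mu (pairing w v) := by
  ext τ
  rw [← latticeSum_eq_eisSeries hk, eisH]

lemma eisSeries_eq_sum_eisG {k : ℕ} (hk : 2 ≤ k) (c : (Fin 2 → ZMod N) → ℂ) (τ : ℍ) :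
    eisSeries k c τ = ∑ v, c v * eisG N k v τ := by
  simp only [eisG_eq (show k ≠ 0 by omega)]
  rw [← eisSeries_sum hk]
  congr 1
  ext w
  simp

lemma sum_mul_eisH {k : ℕ} (hk : 2 ≤ k) (a : (Fin 2 → ZMod N) → ℂ) (τ : ℍ) :
    ∑ u, a u * eisH N k u τ = eisSeries k (fun w ↦ ∑ u, a u * mu (pairing w u)) τ := by
  simp only [eisH_eq (show k ≠ 0 by omega)]
  rw [← eisSeries_sum hk]

lemma eisH_eq_sum_eisG {k : ℕ} (hk : 2 ≤ k) (v : Fin 2 → ZMod N) (τ : ℍ) :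
    eisH N k v τ = ∑ u, mu (pairing u v) * eisG N k u τ := by
  rw [eisH_eq (show k ≠ 0 by omega), eisSeries_eq_sum_eisG hk]

lemma eisG_eq_sum_eisH {k : ℕ} (hk : 2 ≤ k) (v : Fin 2 → ZMod N) (τ : ℍ) :
    eisG N k v τ = 1 / (N : ℂ) ^ 2 * ∑ u, mu (-pairing v u) * eisH N k u τ := by
  have hN : (N : ℂ) ≠ 0 := Nat.cast_ne_zero.mpr (NeZero.ne N)
  rw [Finset.mul_sum]
  simp only [← mul_assoc]
  rw [sum_mul_eisH hk, eisG_eq (show k ≠ 0 by omega)]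
  congr 1
  ext w
  have : ∀ u, 1 / (N : ℂ) ^ 2 * mu (-pairing v u) * mu (pairing w u) =
      1 / (N : ℂ) ^ 2 * mu (pairing (w - v) u) := fun u ↦ by
    rw [mul_assoc, ← mu_add, pairing_sub_left, neg_add_eq_sub]
  simp only [this]
  rw [← Finset.mul_sum, sum_mu_pairing_right]
  simp only [sub_eq_zero]
  split_ifs <;> simp [hN]

/-- By antisymmetry (u|v) = (-v|u), so the sum computes the series G of -v; the substitution (m, n)
↦ (-m, -n) then costs the sign. -/
lemma eisG_eq_sum_eisH' {k : ℕ} (hk : 2 ≤ k) (v : Fin 2 → ZMod N) (τ : ℍ) :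
    eisG N k v τ =
      (-1) ^ k * (1 / (N : ℂ) ^ 2 * ∑ u, mu (-pairing u v) * eisH N k u τ) := by
  have h1 : ∀ u, -pairing u v = -pairing (-v) u := fun u ↦ by
    simp only [pairing, Pi.neg_apply]; ring
  simp only [h1]
  rw [← eisG_eq_sum_eisH hk, eisG_eq (show k ≠ 0 by omega), eisG_eq (show k ≠ 0 by omega),
    ← eisSeries_comp_neg]
  simp only [neg_inj]

/-- At u = 0 both characters equal 1, so the series H for u = 0 cancels in the difference. -/
lemma eisg_eq_sum_eisH (v₀ v : Fin 2 → ZMod N) (τ : ℍ) :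
    eisg N v₀ v τ = 1 / (N : ℂ) ^ 2 * ∑ u ∈ Finset.univ.erase (0 : Fin 2 → ZMod N),
      (mu (-pairing u v) - mu (-pairing u v₀)) * eisH N 2 u τ := by
  have h : ∀ v, eisG N 2 v τ = 1 / (N : ℂ) ^ 2 * ∑ u, mu (-pairing u v) * eisH N 2 u τ := by
    intro v
    have := eisG_eq_sum_eisH' (le_refl 2) v τ
    rw [neg_one_sq, one_mul] at this
    exact_mod_cast this
  rw [Finset.sum_erase _ (by simp [pairing]), eisg, h, h, ← mul_sub, ← Finset.sum_sub_distrib]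
  simp only [sub_mul]

end EisGamma

/-! ### Modularity by a regularisation compatible with the action of SL(2, ℤ). -/

namespace EisGamma

open Filter Topology

/-! ### The regularised kernel -/

/-- The kernel `a⁻ᵏ χ(ε |a|² / y)`, where `χ(t) = (k - 1 + k t) / (1 + t)²`. -/
def regKernel (k : ℕ) (ε : ℝ) (a : ℂ) (y : ℝ) : ℂ :=
  (y * ((k - 1) * (y + ε * ‖a‖ ^ 2) + ε * ‖a‖ ^ 2) / (y + ε * ‖a‖ ^ 2) ^ 2 : ℝ) / a ^ k

/-- This is χ(t) ≤ k/(1 + t). It yields a bound of order |a|⁻ᵏ uniform in ε, and for fixed ε > 0 an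
extra factor |a|⁻², which makes the lattice sum absolutely convergent. -/
lemma norm_regKernel_le {k : ℕ} (hk : 1 ≤ k) {ε y : ℝ} (hε : 0 ≤ ε) (hy : 0 < y) (a : ℂ) :
    ‖regKernel k ε a y‖ ≤ k * (y / (y + ε * ‖a‖ ^ 2)) * (‖a‖ ^ k)⁻¹ := by
  have hE : 0 ≤ ε * ‖a‖ ^ 2 := by positivity
  set E := ε * ‖a‖ ^ 2
  have hk' : (1 : ℝ) ≤ k := by exact_mod_cast hk
  rw [regKernel, norm_div, norm_pow, Complex.norm_real, div_eq_mul_inv _ (‖a‖ ^ k)]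
  refine mul_le_mul_of_nonneg_right ?_ (by positivity)
  have h1 : 0 ≤ (k - 1) * (y + E) + E := by
    have : 0 ≤ (k - 1 : ℝ) := by linarith
    positivity
  rw [Real.norm_of_nonneg (by positivity), div_le_iff₀ (by positivity)]
  have e : k * (y / (y + E)) * (y + E) ^ 2 = y * (k * (y + E)) := by
    field_simp
  rw [e]
  refine mul_le_mul_of_nonneg_left ?_ hy.le
  linarith

lemma norm_regKernel_le_inv_pow {k : ℕ} (hk : 1 ≤ k) {ε y : ℝ} (hε : 0 ≤ ε) (hy : 0 < y) (a : ℂ) :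
    ‖regKernel k ε a y‖ ≤ k * (‖a‖ ^ k)⁻¹ := by
  refine (norm_regKernel_le hk hε hy a).trans ?_
  have : y / (y + ε * ‖a‖ ^ 2) ≤ 1 := by
    rw [div_le_one (by positivity)]
    have : 0 ≤ ε * ‖a‖ ^ 2 := by positivity
    linarith
  have hk' : (0 : ℝ) ≤ k := Nat.cast_nonneg k
  refine mul_le_mul_of_nonneg_right ?_ (by positivity)
  nlinarith

lemma norm_regKernel_le_inv_pow_add_two {k : ℕ} (hk : 1 ≤ k) {ε y : ℝ} (hε : 0 < ε) (hy : 0 < y)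
    (a : ℂ) : ‖regKernel k ε a y‖ ≤ k * (y / ε) * (‖a‖ ^ (k + 2))⁻¹ := by
  rcases eq_or_ne a 0 with rfl | ha
  · simp [regKernel, show k ≠ 0 by omega]
  · refine (norm_regKernel_le hk hε.le hy a).trans ?_
    have ha' : 0 < ‖a‖ := norm_pos_iff.mpr ha
    have h1 : y / (y + ε * ‖a‖ ^ 2) ≤ y / (ε * ‖a‖ ^ 2) := by
      gcongr
      linarith
    have hk' : (0 : ℝ) ≤ k := Nat.cast_nonneg k
    calc _ ≤ k * (y / (ε * ‖a‖ ^ 2)) * (‖a‖ ^ k)⁻¹ := by gcongr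
      _ = _ := by
        rw [pow_add]
        field_simp

lemma regKernel_zero_left {k : ℕ} {y : ℝ} (hy : y ≠ 0) (a : ℂ) :
    regKernel k 0 a y = (k - 1) * (1 / a ^ k) := by
  have : y * ((k - 1) * (y + 0 * ‖a‖ ^ 2) + 0 * ‖a‖ ^ 2) / (y + 0 * ‖a‖ ^ 2) ^ 2 = (k - 1 : ℝ) := by
    rw [zero_mul, add_zero, add_zero]
    field_simp
  rw [regKernel, this]
  push_cast
  ring

lemma tendsto_regKernel {k : ℕ} {y : ℝ} (hy : y ≠ 0) (a : ℂ) :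
    Tendsto (fun ε ↦ regKernel k ε a y) (𝓝 0) (𝓝 (regKernel k 0 a y)) := by
  have : ContinuousAt (fun ε : ℝ ↦
      (y * ((k - 1) * (y + ε * ‖a‖ ^ 2) + ε * ‖a‖ ^ 2) / (y + ε * ‖a‖ ^ 2) ^ 2 : ℝ)) 0 := by
    refine ContinuousAt.div (by fun_prop) (by fun_prop) (by simpa using hy)
  exact ((Complex.continuous_ofReal.tendsto _).comp this).div_const (a ^ k)

/-- The argument of χ depends only on |a|²/y, which does not change; the factor comes from a⁻ᵏ
alone. -/
lemma regKernel_div {k : ℕ} (ε : ℝ) (a : ℂ) (y : ℝ) {j : ℂ} (hj : j ≠ 0) :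
    regKernel k ε (a / j) (y / Complex.normSq j) = j ^ k * regKernel k ε a y := by
  have hn : ‖j‖ ^ 2 ≠ 0 := by positivity
  have e : (y / ‖j‖ ^ 2 * ((k - 1) * (y / ‖j‖ ^ 2 + ε * ‖a / j‖ ^ 2) + ε * ‖a / j‖ ^ 2) /
      (y / ‖j‖ ^ 2 + ε * ‖a / j‖ ^ 2) ^ 2 : ℝ) =
      y * ((k - 1) * (y + ε * ‖a‖ ^ 2) + ε * ‖a‖ ^ 2) / (y + ε * ‖a‖ ^ 2) ^ 2 := by
    have h1 : y / ‖j‖ ^ 2 + ε * ‖a / j‖ ^ 2 = (y + ε * ‖a‖ ^ 2) / ‖j‖ ^ 2 := by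
      rw [norm_div, div_pow]
      ring
    have h2 : ε * ‖a / j‖ ^ 2 = ε * ‖a‖ ^ 2 / ‖j‖ ^ 2 := by
      rw [norm_div, div_pow]
      ring
    rw [h1, h2, ← mul_div_assoc, ← add_div, div_mul_div_comm, div_pow, ← sq, div_div_div_cancel_right₀
      (pow_ne_zero 2 hn)]
  rw [regKernel, Complex.normSq_eq_norm_sq, e, regKernel, div_pow, div_div_eq_mul_div]
  ring

/-- Moving a by δ changes the kernel by O(δρ⁻³), uniformly in ε: one power better than the kernel
itself, and enough for summation over a lattice. -/
lemma norm_regKernel_two_sub_le {ε y ρ δ : ℝ} (hε : 0 ≤ ε) (hy : 0 < y) (hρ : 0 < ρ) {a b : ℂ}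
    (ha : ρ ≤ ‖a‖) (hb : ρ ≤ ‖b‖) (hab : ‖a - b‖ ≤ δ) :
    ‖regKernel 2 ε a y - regKernel 2 ε b y‖ ≤ 6 * δ * (ρ ^ 3)⁻¹ := by
  have ha0 : 0 < ‖a‖ := hρ.trans_le ha
  have hb0 : 0 < ‖b‖ := hρ.trans_le hb
  have ha1 : a ≠ 0 := norm_pos_iff.mp ha0
  have hb1 : b ≠ 0 := norm_pos_iff.mp hb0
  have hδ : 0 ≤ δ := (norm_nonneg _).trans hab
  -- For k = 2, χ(t) = 1 - (t/(1 + t))², and `p` below is t/(1 + t), with values in [0, 1].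
  have key : ∀ a : ℂ, regKernel 2 ε a y =
      (1 - (ε * ‖a‖ ^ 2 / (y + ε * ‖a‖ ^ 2)) ^ 2 : ℝ) / a ^ 2 := by
    intro a
    rw [regKernel]
    congr 2
    have : y + ε * ‖a‖ ^ 2 ≠ 0 := by positivity
    field_simp
    push_cast
    ring
  set p : ℂ → ℝ := fun a ↦ ε * ‖a‖ ^ 2 / (y + ε * ‖a‖ ^ 2) with hp
  have hp0 : ∀ a, 0 ≤ p a := fun a ↦ by positivity
  have hp1 : ∀ a, p a ≤ 1 := fun a ↦ by
    rw [hp]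
    simp only
    rw [div_le_one (by positivity)]
    linarith
  have hpd : |p b - p a| ≤ 2 * δ / ρ := by
    have e : p b - p a = ε * y * ((‖b‖ - ‖a‖) * (‖a‖ + ‖b‖)) /
        ((y + ε * ‖b‖ ^ 2) * (y + ε * ‖a‖ ^ 2)) := by
      simp only [hp]
      rw [div_sub_div _ _ (by positivity) (by positivity)]
      ring
    rw [e, abs_div, abs_mul, abs_mul (‖b‖ - ‖a‖), abs_of_nonneg (by positivity : 0 ≤ ε * y),
      abs_of_nonneg (by positivity : 0 ≤ ‖a‖ + ‖b‖),
      abs_of_nonneg (by positivity : 0 ≤ (y + ε * ‖b‖ ^ 2) * (y + ε * ‖a‖ ^ 2)),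
      div_le_div_iff₀ (by positivity) hρ]
    have h1 : |‖b‖ - ‖a‖| ≤ δ := by
      rw [abs_sub_comm]
      exact (abs_norm_sub_norm_le a b).trans hab
    have h2 : ε * y * ‖a‖ * ρ ≤ (y + ε * ‖b‖ ^ 2) * (y + ε * ‖a‖ ^ 2) := by
      have : ‖a‖ * ρ ≤ ‖a‖ ^ 2 := by nlinarith
      calc ε * y * ‖a‖ * ρ = y * (ε * (‖a‖ * ρ)) := by ring
        _ ≤ (y + ε * ‖b‖ ^ 2) * (y + ε * ‖a‖ ^ 2) := by
          gcongr
          · exact le_add_of_nonneg_right (by positivity)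
          · have : ε * (‖a‖ * ρ) ≤ ε * ‖a‖ ^ 2 := by gcongr
            linarith
    have h3 : ε * y * ‖b‖ * ρ ≤ (y + ε * ‖b‖ ^ 2) * (y + ε * ‖a‖ ^ 2) := by
      have : ‖b‖ * ρ ≤ ‖b‖ ^ 2 := by nlinarith
      calc ε * y * ‖b‖ * ρ = (ε * (‖b‖ * ρ)) * y := by ring
        _ ≤ (y + ε * ‖b‖ ^ 2) * (y + ε * ‖a‖ ^ 2) := by
          gcongr
          · have : ε * (‖b‖ * ρ) ≤ ε * ‖b‖ ^ 2 := by gcongr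
            linarith
          · exact le_add_of_nonneg_right (by positivity)
    calc ε * y * (|‖b‖ - ‖a‖| * (‖a‖ + ‖b‖)) * ρ
        = |‖b‖ - ‖a‖| * (ε * y * ‖a‖ * ρ + ε * y * ‖b‖ * ρ) := by ring
      _ ≤ δ * ((y + ε * ‖b‖ ^ 2) * (y + ε * ‖a‖ ^ 2) +
          (y + ε * ‖b‖ ^ 2) * (y + ε * ‖a‖ ^ 2)) := by gcongr
      _ = _ := by ring
  -- The constant 6 is 2 from the variation of a⁻² plus 4 from the variation of p².
  have e : regKernel 2 ε a y - regKernel 2 ε b y = (1 - p a ^ 2 : ℝ) * ((a ^ 2)⁻¹ - (b ^ 2)⁻¹) +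
      (p b ^ 2 - p a ^ 2 : ℝ) * (b ^ 2)⁻¹ := by
    rw [key, key]
    change (((1 - p a ^ 2 : ℝ) : ℂ)) / a ^ 2 - ((1 - p b ^ 2 : ℝ) : ℂ) / b ^ 2 = _
    push_cast
    ring
  have h1 : ‖((1 - p a ^ 2 : ℝ) : ℂ) * ((a ^ 2)⁻¹ - (b ^ 2)⁻¹)‖ ≤ 2 * δ * (ρ ^ 3)⁻¹ := by
    have e1 : (a ^ 2)⁻¹ - (b ^ 2)⁻¹ = (b - a) * (b⁻¹ * (a⁻¹ * a⁻¹) + a⁻¹ * (b⁻¹ * b⁻¹)) := by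
      field_simp
      ring
    have e2 : ‖((1 - p a ^ 2 : ℝ) : ℂ)‖ ≤ 1 := by
      rw [Complex.norm_real, Real.norm_eq_abs, abs_le]
      constructor <;> nlinarith [hp0 a, hp1 a]
    have ia : ‖a⁻¹‖ ≤ ρ⁻¹ := by rw [norm_inv]; gcongr
    have ib : ‖b⁻¹‖ ≤ ρ⁻¹ := by rw [norm_inv]; gcongr
    rw [norm_mul, e1, norm_mul]
    have e3 : ‖b⁻¹ * (a⁻¹ * a⁻¹) + a⁻¹ * (b⁻¹ * b⁻¹)‖ ≤
        ρ⁻¹ * (ρ⁻¹ * ρ⁻¹) + ρ⁻¹ * (ρ⁻¹ * ρ⁻¹) := by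
      refine (norm_add_le _ _).trans ?_
      simp only [norm_mul]
      gcongr
    calc _ ≤ 1 * (δ * (ρ⁻¹ * (ρ⁻¹ * ρ⁻¹) + ρ⁻¹ * (ρ⁻¹ * ρ⁻¹))) := by
          gcongr
          rwa [norm_sub_rev]
      _ = _ := by
        field_simp
        ring
  have h2 : ‖((p b ^ 2 - p a ^ 2 : ℝ) : ℂ) * (b ^ 2)⁻¹‖ ≤ 4 * δ * (ρ ^ 3)⁻¹ := by
    rw [norm_mul, Complex.norm_real, norm_inv, norm_pow, Real.norm_eq_abs]
    have e1 : |p b ^ 2 - p a ^ 2| ≤ 2 * (2 * δ / ρ) := by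
      rw [sq_sub_sq, abs_mul, abs_of_nonneg (add_nonneg (hp0 b) (hp0 a))]
      gcongr
      linarith [hp1 a, hp1 b]
    calc _ ≤ 2 * (2 * δ / ρ) * (ρ ^ 2)⁻¹ := by gcongr
      _ = _ := by
        field_simp
        ring
  rw [e]
  refine (norm_add_le _ _).trans ?_
  linarith

/-! ### Linear forms on the lattice -/

/-- The linear form `mτ + n` for `u = (m, n)`. -/
def lin (u : Fin 2 → ℤ) (τ : ℍ) : ℂ := (u 0 : ℂ) * τ + u 1

lemma lin_smul (u : Fin 2 → ℤ) (γ : SL(2, ℤ)) (τ : ℍ) :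
    lin u (γ • τ) = lin (Matrix.vecMul u γ) τ / denom γ τ := by
  -- In weight -1 the summand is the linear form itself.
  have h := EisensteinSeries.eisSummand_SL2_apply (-1) u γ τ
  simp only [EisensteinSeries.eisSummand, neg_neg, zpow_one, zpow_neg_one] at h
  rw [lin, h, lin, div_eq_inv_mul]

lemma inv_norm_lin_pow_le {κ : ℝ} (hκ : 0 < κ) {τ : ℍ} (hτ : κ ≤ EisensteinSeries.r τ) {p : ℕ}
    {u : Fin 2 → ℤ} {s : ℝ} (hs : 0 < s) (hu : s ≤ ‖u‖) :
    (‖lin u τ‖ ^ p)⁻¹ ≤ (κ ^ p)⁻¹ * (s ^ p)⁻¹ := by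
  have hu0 : u ≠ 0 := norm_pos_iff.mp (hs.trans_le hu)
  rw [← mul_inv, ← mul_pow]
  have h := EisensteinSeries.r_mul_max_le τ hu0
  gcongr
  exact (mul_le_mul hτ hu hs.le (hκ.le.trans hτ)).trans h

lemma inv_norm_lin_pow_le' {κ : ℝ} (hκ : 0 < κ) {τ : ℍ} (hτ : κ ≤ EisensteinSeries.r τ) {p : ℕ}
    (hp : p ≠ 0) (u : Fin 2 → ℤ) :
    (‖lin u τ‖ ^ p)⁻¹ ≤ (κ ^ p)⁻¹ * (‖u‖ ^ p)⁻¹ := by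
  rcases eq_or_ne u 0 with rfl | hu
  · simp [lin, hp]
  · exact inv_norm_lin_pow_le hκ hτ (norm_pos_iff.mpr hu) le_rfl

lemma summable_inv_norm_pow {p : ℕ} (hp : 3 ≤ p) : Summable fun u : Fin 2 → ℤ ↦ (‖u‖ ^ p)⁻¹ := by
  have h := EisensteinSeries.summable_one_div_norm_rpow (k := p) (by
    have : (3 : ℝ) ≤ p := by exact_mod_cast hp
    linarith)
  refine h.congr fun u ↦ ?_
  rw [Real.rpow_neg (norm_nonneg _), Real.rpow_natCast]

lemma one_le_norm_of_ne_zero {u : Fin 2 → ℤ} (hu : u ≠ 0) : 1 ≤ ‖u‖ := by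
  obtain ⟨i, hi⟩ := Function.ne_iff.mp hu
  refine le_trans ?_ (norm_le_pi_norm u i)
  rw [Int.norm_eq_abs]
  exact_mod_cast Int.one_le_abs hi

/-! ### The regularised Eisenstein series -/

variable {N : ℕ}

/-- The regularised Eisenstein series. -/
def regSeries (k : ℕ) (ε : ℝ) (c : (Fin 2 → ZMod N) → ℂ) (τ : ℍ) : ℂ :=
  ∑' u : Fin 2 → ℤ, c (fun i ↦ (u i : ZMod N)) * regKernel k ε (lin u τ) τ.im

lemma summable_regSeries [NeZero N] {k : ℕ} (hk : 2 ≤ k) {ε : ℝ} (hε : 0 < ε)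
    (c : (Fin 2 → ZMod N) → ℂ) (τ : ℍ) :
    Summable fun u : Fin 2 → ℤ ↦ c (fun i ↦ (u i : ZMod N)) * regKernel k ε (lin u τ) τ.im := by
  obtain ⟨C, hC0, hC⟩ := exists_norm_le_of_finite c
  refine Summable.of_norm_bounded ((summable_inv_norm_pow (p := k + 2) (by omega)).mul_left
    (C * (k * (τ.im / ε) * (EisensteinSeries.r τ ^ (k + 2))⁻¹))) fun u ↦ ?_
  have := EisensteinSeries.r_pos τ
  have := τ.im_pos
  rw [norm_mul, mul_assoc C, mul_assoc (k * (τ.im / ε))]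
  refine mul_le_mul (hC _) ?_ (norm_nonneg _) hC0
  refine (norm_regKernel_le_inv_pow_add_two (by omega) hε τ.im_pos _).trans ?_
  gcongr
  exact inv_norm_lin_pow_le' (EisensteinSeries.r_pos τ) le_rfl (by omega) u

/-- The right action of `SL(2, ℤ)` on periodic coefficients. -/
def twist (c : (Fin 2 → ZMod N) → ℂ) (γ : SL(2, ℤ)) (w : Fin 2 → ZMod N) : ℂ :=
  c (Matrix.vecMul w (Matrix.SpecialLinearGroup.map (Int.castRingHom (ZMod N)) γ⁻¹).1)

lemma twist_mul (c : (Fin 2 → ZMod N) → ℂ) (γ δ : SL(2, ℤ)) :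
    twist c (γ * δ) = twist (twist c γ) δ := by
  ext w
  simp only [twist]
  rw [mul_inv_rev, map_mul, Matrix.vecMul_vecMul]
  rfl

lemma twist_of_mem_Gamma (c : (Fin 2 → ZMod N) → ℂ) {γ : SL(2, ℤ)} (hγ : γ ∈ Gamma N) :
    twist c γ = c := by
  ext w
  have : Matrix.SpecialLinearGroup.map (Int.castRingHom (ZMod N)) γ⁻¹ = 1 :=
    Gamma_mem'.mp (inv_mem hγ)
  rw [twist, this]
  simp

lemma cast_vecMul (u : Fin 2 → ℤ) (γ : SL(2, ℤ)) :
    (fun i ↦ ((Matrix.vecMul u γ) i : ZMod N)) = Matrix.vecMul (fun i ↦ (u i : ZMod N))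
      (Matrix.SpecialLinearGroup.map (Int.castRingHom (ZMod N)) γ).1 := by
  ext i
  have := RingHom.map_vecMul (Int.castRingHom (ZMod N)) (γ : Matrix (Fin 2) (Fin 2) ℤ) u i
  simpa [Function.comp_def] using this

/-- Right multiplication by an element of `SL(2, ℤ)` as a permutation of the lattice. -/
def vecMulEquiv (γ : SL(2, ℤ)) : (Fin 2 → ℤ) ≃ (Fin 2 → ℤ) where
  toFun u := Matrix.vecMul u γ
  invFun u := Matrix.vecMul u (γ⁻¹ : SL(2, ℤ))
  left_inv u := by
    beta_reduce
    rw [Matrix.vecMul_vecMul, ← Matrix.SpecialLinearGroup.coe_mul, mul_inv_cancel]; simp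
  right_inv u := by
    beta_reduce
    rw [Matrix.vecMul_vecMul, ← Matrix.SpecialLinearGroup.coe_mul, inv_mul_cancel]; simp

lemma twist_cast_vecMul (c : (Fin 2 → ZMod N) → ℂ) (u : Fin 2 → ℤ) (γ : SL(2, ℤ)) :
    twist c γ (fun i ↦ ((Matrix.vecMul u γ) i : ZMod N)) = c (fun i ↦ (u i : ZMod N)) := by
  rw [twist, cast_vecMul, Matrix.vecMul_vecMul]
  have : (Matrix.SpecialLinearGroup.map (Int.castRingHom (ZMod N)) γ).1 *
      (Matrix.SpecialLinearGroup.map (Int.castRingHom (ZMod N)) γ⁻¹).1 = 1 := by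
    rw [← Matrix.SpecialLinearGroup.coe_mul, ← map_mul, mul_inv_cancel, map_one]
    rfl
  rw [this, Matrix.vecMul_one]

lemma sum_twist [NeZero N] (c : (Fin 2 → ZMod N) → ℂ) (γ : SL(2, ℤ)) :
    ∑ w, twist c γ w = ∑ w, c w := by
  let M := Matrix.SpecialLinearGroup.map (Int.castRingHom (ZMod N)) γ⁻¹
  let e : (Fin 2 → ZMod N) ≃ (Fin 2 → ZMod N) :=
    { toFun := fun w ↦ Matrix.vecMul w M.1
      invFun := fun w ↦ Matrix.vecMul w (M⁻¹).1
      left_inv := fun u ↦ by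
        beta_reduce
        rw [Matrix.vecMul_vecMul, ← Matrix.SpecialLinearGroup.coe_mul, mul_inv_cancel]; simp
      right_inv := fun u ↦ by
        beta_reduce
        rw [Matrix.vecMul_vecMul, ← Matrix.SpecialLinearGroup.coe_mul, inv_mul_cancel]; simp }
  exact e.sum_comp c

/-- Homogeneity of the kernel and the permutation u ↦ uγ of the lattice. A permutation preserves
`tsum` unconditionally, so no summability enters. -/
lemma regSeries_smul {k : ℕ} (ε : ℝ) (c : (Fin 2 → ZMod N) → ℂ) (γ : SL(2, ℤ)) (τ : ℍ) :
    regSeries k ε c (γ • τ) = denom γ τ ^ k * regSeries k ε (twist c γ) τ := by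
  rw [regSeries, regSeries, ← tsum_mul_left]
  refine Eq.trans (tsum_congr fun u ↦ ?_) ((vecMulEquiv γ).tsum_eq _)
  rw [lin_smul, ModularGroup.im_smul_eq_div_normSq, regKernel_div _ _ _ (denom_ne_zero γ τ)]
  simp only [vecMulEquiv, Equiv.coe_fn_mk]
  rw [twist_cast_vecMul]
  ring

end EisGamma

namespace EisGamma

open Filter Topology

/-! ### Grouping the lattice modulo `N` -/

lemma abs_le_abs_mul_add {N : ℕ} (w : ℤ) (b : Fin N) : |w| ≤ |w * N + (b : ℕ)| := by
  have hb : ((b : ℕ) : ℤ) < N := by exact_mod_cast b.2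
  have hb0 : (0 : ℤ) ≤ (b : ℕ) := Int.natCast_nonneg _
  rcases le_or_gt 0 w with h | h
  · rw [abs_of_nonneg h, abs_of_nonneg (by positivity)]
    nlinarith
  · have : w * N + (b : ℕ) ≤ w := by nlinarith
    rw [abs_of_neg h, abs_of_neg (by omega)]
    omega

variable {N : ℕ}

/-- The lattice point `N w + v`. -/
def gridPoint (w : Fin 2 → ℤ) (v : Fin 2 → Fin N) : Fin 2 → ℤ := fun i ↦ w i * N + (v i : ℕ)

lemma norm_le_norm_gridPoint (w : Fin 2 → ℤ) (v : Fin 2 → Fin N) : ‖w‖ ≤ ‖gridPoint w v‖ := by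
  rw [pi_norm_le_iff_of_nonneg (norm_nonneg _)]
  intro i
  refine le_trans ?_ (norm_le_pi_norm _ i)
  rw [Int.norm_eq_abs, Int.norm_eq_abs]
  exact_mod_cast abs_le_abs_mul_add (w i) (v i)

lemma gridPoint_cast (w : Fin 2 → ℤ) (v : Fin 2 → Fin N) :
    (fun i ↦ (gridPoint w v i : ZMod N)) = fun i ↦ ((v i : ℕ) : ZMod N) := by
  ext i
  simp [gridPoint]

/-- Division with remainder on the lattice. -/
def gridEquiv (N : ℕ) [NeZero N] : (Fin 2 → ℤ) × (Fin 2 → Fin N) ≃ (Fin 2 → ℤ) :=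
  ((Equiv.arrowCongr (Equiv.refl (Fin 2)) (Int.divModEquiv N)).trans
    (Equiv.arrowProdEquivProdArrow (Fin 2) (fun _ ↦ ℤ) (fun _ ↦ Fin N))).symm

lemma gridEquiv_apply [NeZero N] (p : (Fin 2 → ℤ) × (Fin 2 → Fin N)) :
    gridEquiv N p = gridPoint p.1 p.2 := by
  ext i
  simp [gridEquiv, gridPoint, Equiv.arrowProdEquivProdArrow, Int.divModEquiv]

lemma sum_fin_eq_sum_zmod [NeZero N] (c : (Fin 2 → ZMod N) → ℂ) :
    ∑ v : Fin 2 → Fin N, c (fun i ↦ ((v i : ℕ) : ZMod N)) = ∑ w, c w := by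
  have hb : Function.Bijective fun b : Fin N ↦ ((b : ℕ) : ZMod N) := by
    rw [Fintype.bijective_iff_surjective_and_card]
    refine ⟨fun x ↦ ⟨⟨x.val, x.val_lt⟩, by simp⟩, by simp [ZMod.card]⟩
  exact (Equiv.arrowCongr (Equiv.refl (Fin 2)) (Equiv.ofBijective _ hb)).sum_comp c

/-- The sum of the summands of `regSeries` over the lattice points congruent to `N w`. -/
def groupTerm (k : ℕ) (ε : ℝ) (c : (Fin 2 → ZMod N) → ℂ) (w : Fin 2 → ℤ) (τ : ℍ) : ℂ :=
  ∑ v : Fin 2 → Fin N,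
    c (fun i ↦ ((v i : ℕ) : ZMod N)) * regKernel k ε (lin (gridPoint w v) τ) τ.im

lemma regSeries_eq_tsum_groupTerm [NeZero N] {k : ℕ} (hk : 2 ≤ k) {ε : ℝ} (hε : 0 < ε)
    (c : (Fin 2 → ZMod N) → ℂ) (τ : ℍ) :
    regSeries k ε c τ = ∑' w, groupTerm k ε c w τ := by
  have hs := (gridEquiv N).summable_iff.mpr (summable_regSeries hk hε c τ)
  rw [regSeries, ← (gridEquiv N).tsum_eq]
  refine hs.tsum_prod.trans (tsum_congr fun w ↦ ?_)
  rw [tsum_fintype, groupTerm]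
  refine Finset.sum_congr rfl fun v _ ↦ ?_
  simp only [Function.comp, gridEquiv_apply]
  rw [gridPoint_cast]

lemma norm_lin_gridPoint_sub_le (w : Fin 2 → ℤ) (v v' : Fin 2 → Fin N) (τ : ℍ) :
    ‖lin (gridPoint w v) τ - lin (gridPoint w v') τ‖ ≤ N * (1 + ‖(τ : ℂ)‖) := by
  have e : lin (gridPoint w v) τ - lin (gridPoint w v') τ =
      (((v 0 : ℕ) : ℝ) - ((v' 0 : ℕ) : ℝ) : ℝ) * (τ : ℂ) +
      (((v 1 : ℕ) : ℝ) - ((v' 1 : ℕ) : ℝ) : ℝ) := by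
    simp only [lin, gridPoint]
    push_cast
    ring
  have h : ∀ a b : Fin N, ‖((((a : ℕ) : ℝ) - ((b : ℕ) : ℝ) : ℝ) : ℂ)‖ ≤ N := by
    intro a b
    have ha : ((a : ℕ) : ℝ) < N := by exact_mod_cast a.2
    have hb : ((b : ℕ) : ℝ) < N := by exact_mod_cast b.2
    have ha0 : (0 : ℝ) ≤ (a : ℕ) := Nat.cast_nonneg _
    have hb0 : (0 : ℝ) ≤ (b : ℕ) := Nat.cast_nonneg _
    rw [Complex.norm_real, Real.norm_eq_abs, abs_le]
    constructor <;> linarith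
  rw [e, mul_add, mul_one, add_comm (N : ℝ)]
  refine (norm_add_le _ _).trans (add_le_add ?_ (h _ _))
  rw [norm_mul]
  exact mul_le_mul_of_nonneg_right (h _ _) (norm_nonneg _)

/-- For k ≥ 3 the bound |a|⁻ᵏ suffices. For k = 2, since ∑ c = 0, the kernel at one fixed point of
the block can be subtracted from all the others; the differences are O(‖w‖⁻³), and the diameter of a
block is the source of the factor 1 + ‖τ‖. Uniformity in ε serves the limits ε → 0. -/
lemma exists_norm_groupTerm_le [NeZero N] {k : ℕ} (hk : 2 ≤ k) (c : (Fin 2 → ZMod N) → ℂ)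
    (hc : k = 2 → ∑ v, c v = 0) {κ : ℝ} (hκ : 0 < κ) :
    ∃ B : (Fin 2 → ℤ) → ℝ, Summable B ∧ ∀ ε, 0 ≤ ε → ∀ τ : ℍ, κ ≤ EisensteinSeries.r τ →
      ∀ w, ‖groupTerm k ε c w τ‖ ≤ B w * (1 + ‖(τ : ℂ)‖) := by
  have hN : (0 : ℝ) < N := Nat.cast_pos.mpr (NeZero.pos N)
  set M := ∑ v : Fin 2 → Fin N, ‖c (fun i ↦ ((v i : ℕ) : ZMod N))‖ with hM
  have hM0 : 0 ≤ M := by positivity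
  -- a bound for the group at the origin
  have h0 : ∀ ε, 0 ≤ ε → ∀ τ : ℍ, κ ≤ EisensteinSeries.r τ →
      ‖groupTerm k ε c 0 τ‖ ≤ M * (k * (κ ^ k)⁻¹) := by
    intro ε hε τ hτ
    rw [hM, Finset.sum_mul]
    refine norm_sum_le_of_le _ fun v _ ↦ ?_
    rw [norm_mul]
    refine mul_le_mul_of_nonneg_left ?_ (norm_nonneg _)
    refine (norm_regKernel_le_inv_pow (by omega) hε τ.im_pos _).trans ?_
    refine mul_le_mul_of_nonneg_left ?_ (Nat.cast_nonneg k)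
    rcases eq_or_ne (gridPoint 0 v) 0 with h | h
    · rw [h]
      simp [lin, show k ≠ 0 by omega]
      positivity
    · have := inv_norm_lin_pow_le hκ hτ (p := k) one_pos (one_le_norm_of_ne_zero h)
      simpa using this
  -- a bound for the other groups
  obtain ⟨D, hD0, hD⟩ : ∃ D, 0 ≤ D ∧ ∀ ε, 0 ≤ ε → ∀ τ : ℍ, κ ≤ EisensteinSeries.r τ →
      ∀ w, w ≠ 0 → ‖groupTerm k ε c w τ‖ ≤ D * (‖w‖ ^ 3)⁻¹ * (1 + ‖(τ : ℂ)‖) := by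
    rcases hk.eq_or_lt with rfl | hk3
    · refine ⟨M * (6 * N * (κ ^ 3)⁻¹), by positivity, fun ε hε τ hτ w hw ↦ ?_⟩
      let v₀ : Fin 2 → Fin N := fun _ ↦ 0
      have e : groupTerm 2 ε c w τ = ∑ v : Fin 2 → Fin N, c (fun i ↦ ((v i : ℕ) : ZMod N)) *
          (regKernel 2 ε (lin (gridPoint w v) τ) τ.im -
            regKernel 2 ε (lin (gridPoint w v₀) τ) τ.im) := by
        simp only [mul_sub, Finset.sum_sub_distrib]
        rw [← Finset.sum_mul, sum_fin_eq_sum_zmod, hc rfl, zero_mul, sub_zero, groupTerm]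
      have hw0 : 0 < ‖w‖ := norm_pos_iff.mpr hw
      have hlow : ∀ v : Fin 2 → Fin N, κ * ‖w‖ ≤ ‖lin (gridPoint w v) τ‖ := by
        intro v
        have h1 := norm_le_norm_gridPoint w v
        have h2 := EisensteinSeries.r_mul_max_le τ (x := gridPoint w v)
          (norm_pos_iff.mp (hw0.trans_le h1))
        exact (mul_le_mul hτ h1 hw0.le (hκ.le.trans hτ)).trans h2
      rw [e, mul_assoc, mul_assoc, hM, Finset.sum_mul]
      refine norm_sum_le_of_le _ fun v _ ↦ ?_
      rw [norm_mul]
      refine mul_le_mul_of_nonneg_left ?_ (norm_nonneg _)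
      refine (norm_regKernel_two_sub_le hε τ.im_pos (mul_pos hκ hw0) (hlow v) (hlow v₀)
        (norm_lin_gridPoint_sub_le w v v₀ τ)).trans (le_of_eq ?_)
      rw [mul_pow, mul_inv]
      ring
    · refine ⟨M * (k * (κ ^ k)⁻¹), by positivity, fun ε hε τ hτ w hw ↦ ?_⟩
      have hw1 := one_le_norm_of_ne_zero hw
      have hw0 : 0 < ‖w‖ := norm_pos_iff.mpr hw
      have h1 : ‖groupTerm k ε c w τ‖ ≤ M * (k * (κ ^ k)⁻¹) * (‖w‖ ^ 3)⁻¹ := by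
        rw [mul_assoc, mul_assoc, hM, Finset.sum_mul]
        refine norm_sum_le_of_le _ fun v _ ↦ ?_
        rw [norm_mul]
        refine mul_le_mul_of_nonneg_left ?_ (norm_nonneg _)
        refine (norm_regKernel_le_inv_pow (by omega) hε τ.im_pos _).trans ?_
        refine mul_le_mul_of_nonneg_left ?_ (Nat.cast_nonneg k)
        refine (inv_norm_lin_pow_le hκ hτ (p := k) hw0 (norm_le_norm_gridPoint w v)).trans ?_
        have : ‖w‖ ^ 3 ≤ ‖w‖ ^ k := pow_le_pow_right₀ hw1 (by omega)
        gcongr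
      refine h1.trans (le_mul_of_one_le_right (by positivity) ?_)
      linarith [norm_nonneg (τ : ℂ)]
  refine ⟨fun w ↦ (if w = 0 then M * (k * (κ ^ k)⁻¹) else 0) + D * (‖w‖ ^ 3)⁻¹, ?_,
    fun ε hε τ hτ w ↦ ?_⟩
  · refine Summable.add ?_ ((summable_inv_norm_pow le_rfl).mul_left D)
    exact summable_of_ne_finset_zero (s := {0}) fun b hb ↦ by simp_all
  · beta_reduce
    by_cases hw : w = 0
    · subst hw
      refine (h0 ε hε τ hτ).trans ?_
      rw [if_pos rfl, norm_zero]
      simp only [ne_eq, OfNat.ofNat_ne_zero, not_false_eq_true, zero_pow, inv_zero, mul_zero,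
        add_zero]
      refine le_mul_of_one_le_right (by positivity) ?_
      linarith [norm_nonneg (τ : ℂ)]
    · rw [if_neg hw, zero_add]
      exact hD ε hε τ hτ w hw

/-- Connects Eisenstein's order with the absolutely convergent sum over blocks. Each row and the
series of rows converge absolutely, so both sums may be split into residue classes modulo N; the
factor k - 1 is χ(0). -/
lemma mul_eisSeries_eq_tsum_groupTerm [NeZero N] {k : ℕ} (hk : 2 ≤ k) (c : (Fin 2 → ZMod N) → ℂ)
    (hc : k = 2 → ∑ v, c v = 0) (τ : ℍ) :
    (k - 1) * eisSeries k c τ = ∑' w, groupTerm k 0 c w τ := by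
  obtain ⟨B, hB, hBw⟩ := exists_norm_groupTerm_le hk c hc (EisensteinSeries.r_pos τ)
  have hs : Summable fun w ↦ groupTerm k 0 c w τ :=
    Summable.of_norm_bounded (hB.mul_right (1 + ‖(τ : ℂ)‖)) fun w ↦ hBw 0 le_rfl τ le_rfl w
  have hs2 := (finTwoArrowEquiv ℤ).symm.summable_iff.mpr hs
  rw [← (finTwoArrowEquiv ℤ).symm.tsum_eq]
  refine Eq.trans ?_ hs2.tsum_prod.symm
  rw [eisSeries, (tsum_int_eq_tsum_residues N (summable_eisRow hk c τ)).2, ← tsum_mul_left]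
  refine tsum_congr fun j ↦ ?_
  have hrow : ∀ a : Fin N, eisRow k c (j * N + (a : ℕ)) τ =
      ∑' l : ℤ, ∑ b : Fin N, eisTerm k c (j * N + (a : ℕ)) (l * N + (b : ℕ)) τ := fun a ↦
    (tsum_int_eq_tsum_residues N (summable_eisTerm hk c _ τ)).2
  simp only [hrow]
  rw [← Summable.tsum_finsetSum fun a _ ↦ summable_sum fun b _ ↦
    (tsum_int_eq_tsum_residues N (summable_eisTerm hk c _ τ)).1 b, ← tsum_mul_left]
  refine tsum_congr fun l ↦ ?_
  simp only [Function.comp, groupTerm, regKernel_zero_left τ.im_ne_zero]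
  rw [← Fintype.sum_prod_type', ← (finTwoArrowEquiv (Fin N)).symm.sum_comp, Finset.mul_sum]
  refine Finset.sum_congr rfl fun p _ ↦ ?_
  have hv : (fun i ↦ (((finTwoArrowEquiv (Fin N)).symm p i : ℕ) : ZMod N)) =
      ![((j * N + (p.1 : ℕ) : ℤ) : ZMod N), ((l * N + (p.2 : ℕ) : ℤ) : ZMod N)] := by
    ext i
    fin_cases i <;> simp
  rw [hv, eisTerm, lin]
  simp only [gridPoint, finTwoArrowEquiv_symm_apply, Matrix.cons_val_zero, Matrix.cons_val_one]
  ring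

lemma tendsto_regSeries [NeZero N] {k : ℕ} (hk : 2 ≤ k) (c : (Fin 2 → ZMod N) → ℂ)
    (hc : k = 2 → ∑ v, c v = 0) (τ : ℍ) :
    Tendsto (fun ε ↦ regSeries k ε c τ) (𝓝[>] 0) (𝓝 ((k - 1) * eisSeries k c τ)) := by
  obtain ⟨B, hB, hBw⟩ := exists_norm_groupTerm_le hk c hc (EisensteinSeries.r_pos τ)
  rw [mul_eisSeries_eq_tsum_groupTerm hk c hc]
  have h : Tendsto (fun ε ↦ ∑' w, groupTerm k ε c w τ) (𝓝[>] 0)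
      (𝓝 (∑' w, groupTerm k 0 c w τ)) := by
    refine tendsto_tsum_of_dominated_convergence (hB.mul_right (1 + ‖(τ : ℂ)‖)) (fun w ↦ ?_) ?_
    · refine tendsto_finsetSum _ fun v _ ↦ Tendsto.const_mul _ ?_
      exact (tendsto_regKernel τ.im_ne_zero _).mono_left nhdsWithin_le_nhds
    · filter_upwards [self_mem_nhdsWithin] with ε hε w using hBw ε (le_of_lt hε) τ le_rfl w
  refine h.congr' ?_
  filter_upwards [self_mem_nhdsWithin] with ε hε
  rw [regSeries_eq_tsum_groupTerm hk hε]

lemma exists_norm_regSeries_le [NeZero N] {k : ℕ} (hk : 2 ≤ k) (c : (Fin 2 → ZMod N) → ℂ)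
    (hc : k = 2 → ∑ v, c v = 0) {κ : ℝ} (hκ : 0 < κ) :
    ∃ C, ∀ ε, 0 < ε → ∀ τ : ℍ, κ ≤ EisensteinSeries.r τ →
      ‖regSeries k ε c τ‖ ≤ C * (1 + ‖(τ : ℂ)‖) := by
  obtain ⟨B, hB, hBw⟩ := exists_norm_groupTerm_le hk c hc hκ
  refine ⟨∑' w, B w, fun ε hε τ hτ ↦ ?_⟩
  rw [regSeries_eq_tsum_groupTerm hk hε]
  exact tsum_of_norm_bounded (hB.hasSum.mul_right _) fun w ↦ hBw ε hε.le τ hτ w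

/-! ### Modularity -/

/-- The limit ε → 0 of `regSeries_smul`. Twisting permutes the values of c, so the condition ∑ c = 0
persists. -/
lemma eisSeries_smul [NeZero N] {k : ℕ} (hk : 2 ≤ k) (c : (Fin 2 → ZMod N) → ℂ)
    (hc : k = 2 → ∑ v, c v = 0) (γ : SL(2, ℤ)) (τ : ℍ) :
    eisSeries k c (γ • τ) = denom γ τ ^ k * eisSeries k (twist c γ) τ := by
  have h1 := tendsto_regSeries hk c hc (γ • τ)
  have h2 := (tendsto_regSeries hk (twist c γ) (fun h ↦ (sum_twist c γ).trans (hc h)) τ).const_mul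
    (denom γ τ ^ k)
  simp only [regSeries_smul] at h1
  have h3 := tendsto_nhds_unique h1 h2
  have hk1 : (k - 1 : ℂ) ≠ 0 := by
    rw [sub_ne_zero]
    exact_mod_cast (show k ≠ 1 by omega)
  refine mul_left_cancel₀ hk1 (h3.trans ?_)
  ring

lemma eisSeries_slash [NeZero N] {k : ℕ} (hk : 2 ≤ k) (c : (Fin 2 → ZMod N) → ℂ)
    (hc : k = 2 → ∑ v, c v = 0) (γ : SL(2, ℤ)) :
    eisSeries k c ∣[(k : ℤ)] γ = eisSeries k (twist c γ) := by
  ext τ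
  rw [ModularForm.SL_slash_apply, eisSeries_smul hk c hc, zpow_neg, zpow_natCast, mul_comm,
    inv_mul_cancel_left₀ (pow_ne_zero _ (denom_ne_zero _ _))]

/-- The Eisenstein series with periodic coefficients `c` as a modular form for `Γ(N)`. -/
def eisForm [NeZero N] {k : ℕ} (hk : 2 ≤ k) (c : (Fin 2 → ZMod N) → ℂ)
    (hc : k = 2 → ∑ v, c v = 0) : ModularForm (principal N) k where
  toFun := eisSeries k c
  slash_action_eq' A hA := by
    obtain ⟨A, hA, rfl⟩ := hA
    have := eisSeries_slash hk c hc A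
    rw [twist_of_mem_Gamma c hA] at this
    exact this
  holo' := mdifferentiable_eisSeries hk c
  bdd_at_cusps' {x} hx := by
    rw [Subgroup.IsArithmetic.isCusp_iff_isCusp_SL2Z] at hx
    rw [OnePoint.isBoundedAt_iff_forall_SL2Z hx]
    intro γ _
    rw [eisSeries_slash hk c hc]
    exact (tendsto_eisSeries_atImInfty hk (twist c γ)).isBigO_one ℝ

@[simp] lemma coe_eisForm [NeZero N] {k : ℕ} (hk : 2 ≤ k) (c : (Fin 2 → ZMod N) → ℂ)
    (hc : k = 2 → ∑ v, c v = 0) : ⇑(eisForm hk c hc) = eisSeries k c := rfl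

end EisGamma

/-! ### Stokes' theorem for ∂/∂x - i ∂/∂y on the truncated fundamental domain. -/

namespace EisGamma

open Filter Topology
open scoped ComplexConjugate

/-! ### The operator `∂/∂x - i ∂/∂y` -/

/-- `P` is real differentiable at `z` with `(∂/∂x - i ∂/∂y) P = d` there. -/
def HasWirtingerAt (P : ℂ → ℂ) (d z : ℂ) : Prop :=
  ∃ L : ℂ →L[ℝ] ℂ, HasFDerivAt P L z ∧ L 1 - Complex.I * L Complex.I = d

lemma HasWirtingerAt.mul {P Q : ℂ → ℂ} {d e z : ℂ} (hP : HasWirtingerAt P d z)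
    (hQ : HasWirtingerAt Q e z) : HasWirtingerAt (fun z ↦ P z * Q z) (P z * e + Q z * d) z := by
  obtain ⟨L, hL, rfl⟩ := hP
  obtain ⟨M, hM, rfl⟩ := hQ
  refine ⟨_, hL.mul hM, ?_⟩
  simp only [add_apply, smul_apply, smul_eq_mul]
  ring

lemma HasWirtingerAt.add {P Q : ℂ → ℂ} {d e z : ℂ} (hP : HasWirtingerAt P d z)
    (hQ : HasWirtingerAt Q e z) : HasWirtingerAt (fun z ↦ P z + Q z) (d + e) z := by
  obtain ⟨L, hL, rfl⟩ := hP
  obtain ⟨M, hM, rfl⟩ := hQ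
  refine ⟨_, hL.add hM, ?_⟩
  simp only [add_apply]
  ring

lemma hasWirtingerAt_const (a z : ℂ) : HasWirtingerAt (fun _ ↦ a) 0 z :=
  ⟨0, hasFDerivAt_const a z, by simp⟩

lemma HasWirtingerAt.comp_deriv {P : ℂ → ℂ} {d z : ℂ} (hP : HasWirtingerAt P d z) {f : ℂ → ℂ}
    {f' : ℂ} (hf : HasDerivAt f f' (P z)) : HasWirtingerAt (fun z ↦ f (P z)) (f' * d) z := by
  obtain ⟨L, hL, rfl⟩ := hP
  refine ⟨_, (hf.hasFDerivAt.restrictScalars ℝ).comp z hL, ?_⟩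
  simp
  ring

lemma HasWirtingerAt.inv {P : ℂ → ℂ} {d z : ℂ} (hP : HasWirtingerAt P d z) (h0 : P z ≠ 0) :
    HasWirtingerAt (fun z ↦ (P z)⁻¹) (-d / P z ^ 2) z := by
  have := hP.comp_deriv (hasDerivAt_inv h0)
  convert this using 1
  ring

lemma HasWirtingerAt.pow {P : ℂ → ℂ} {d z : ℂ} (hP : HasWirtingerAt P d z) (n : ℕ) :
    HasWirtingerAt (fun z ↦ P z ^ n) (n * P z ^ (n - 1) * d) z :=
  hP.comp_deriv (hasDerivAt_pow n _)

lemma hasWirtingerAt_of_hasDerivAt {f : ℂ → ℂ} {f' z : ℂ} (hf : HasDerivAt f f' z) :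
    HasWirtingerAt f (2 * f') z := by
  refine ⟨_, hf.hasFDerivAt.restrictScalars ℝ, ?_⟩
  simp
  linear_combination (-f') * Complex.I_mul_I

/-- By this, conjugates of cusp forms behave as constants for the operator. -/
lemma hasWirtingerAt_conj_of_hasDerivAt {f : ℂ → ℂ} {f' z : ℂ} (hf : HasDerivAt f f' z) :
    HasWirtingerAt (fun z ↦ conj (f z)) 0 z := by
  refine ⟨_, Complex.conjCLE.toContinuousLinearMap.hasFDerivAt.comp z
    (hf.hasFDerivAt.restrictScalars ℝ), ?_⟩
  simp
  linear_combination (conj f') * Complex.I_mul_I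

lemma hasWirtingerAt_im (z : ℂ) : HasWirtingerAt (fun z ↦ (z.im : ℂ)) (-Complex.I) z :=
  ⟨_, (Complex.ofRealCLM.comp Complex.imCLM).hasFDerivAt, by simp⟩

/-! ### Stokes' theorem on the truncated fundamental domain -/

/-- The unit circle `y = √(1 - x²)`. -/
def arc (x : ℝ) : ℝ := √(1 - x ^ 2)

/-- The derivative of `arc`. -/
def arcDeriv (x : ℝ) : ℝ := -x / √(1 - x ^ 2)

lemma one_sub_sq_ge {x : ℝ} (hx : x ∈ Set.Icc (-1 / 2 : ℝ) (1 / 2)) : 3 / 4 ≤ 1 - x ^ 2 := by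
  nlinarith [hx.1, hx.2]

lemma arc_sq {x : ℝ} (hx : x ∈ Set.Icc (-1 / 2 : ℝ) (1 / 2)) : arc x ^ 2 = 1 - x ^ 2 :=
  Real.sq_sqrt (by linarith [one_sub_sq_ge hx])

lemma half_lt_arc {x : ℝ} (hx : x ∈ Set.Icc (-1 / 2 : ℝ) (1 / 2)) : 1 / 2 < arc x :=
  Real.lt_sqrt_of_sq_lt (by linarith [one_sub_sq_ge hx])

lemma continuous_arc : Continuous arc := by
  unfold arc
  fun_prop

lemma hasDerivAt_arc {x : ℝ} (hx : x ∈ Set.Icc (-1 / 2 : ℝ) (1 / 2)) :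
    HasDerivAt arc (arcDeriv x) x := by
  have h0 : 1 - x ^ 2 ≠ 0 := by linarith [one_sub_sq_ge hx]
  have h := ((hasDerivAt_pow 2 x).const_sub 1).sqrt h0
  refine h.congr_deriv ?_
  simp only [arcDeriv]
  field_simp
  simp

lemma differentiableAt_arcDeriv {x : ℝ} (hx : x ∈ Set.Icc (-1 / 2 : ℝ) (1 / 2)) :
    DifferentiableAt ℝ arcDeriv x := by
  have h0 : 1 - x ^ 2 ≠ 0 := by linarith [one_sub_sq_ge hx]
  unfold arcDeriv
  refine DifferentiableAt.div (by fun_prop) (DifferentiableAt.sqrt (by fun_prop) h0) ?_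
  have := half_lt_arc hx
  rw [arc] at this
  linarith

lemma norm_arcDeriv_add_I_le {x : ℝ} (hx : x ∈ Set.Icc (-1 / 2 : ℝ) (1 / 2)) :
    ‖-((arcDeriv x : ℂ) + Complex.I)‖ ≤ 2 := by
  rw [norm_neg]
  refine (norm_add_le _ _).trans ?_
  have h : ‖(arcDeriv x : ℂ)‖ ≤ 1 := by
    have h1 := half_lt_arc hx
    rw [Complex.norm_real, arcDeriv, norm_div, norm_neg, Real.norm_eq_abs, Real.norm_eq_abs,
      ← arc, abs_of_pos (by linarith : 0 < arc x), div_le_one (by linarith)]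
    exact (abs_le.mpr ⟨by linarith [hx.1], by linarith [hx.2]⟩ : |x| ≤ 1 / 2).trans h1.le
  rw [Complex.norm_I]
  linarith

/-- The parametrisation `(x, t) ↦ x + i (√(1 - x²) + t)` of the fundamental domain. -/
def fdParam (p : ℝ × ℝ) : ℂ := ⟨p.1, arc p.1 + p.2⟩

lemma continuous_fdParam : Continuous fdParam :=
  Complex.equivRealProdCLM.symm.continuous.comp
    (continuous_fst.prodMk ((continuous_arc.comp continuous_fst).add continuous_snd))

lemma fdParam_im_pos {p : ℝ × ℝ} (h1 : p.1 ∈ Set.Icc (-1 / 2 : ℝ) (1 / 2)) (h2 : 0 ≤ p.2) :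
    0 < (fdParam p).im := by
  change 0 < arc p.1 + p.2
  linarith [half_lt_arc h1]

lemma hasFDerivAt_fdParam {p : ℝ × ℝ} (h1 : p.1 ∈ Set.Icc (-1 / 2 : ℝ) (1 / 2)) :
    HasFDerivAt fdParam ((Complex.equivRealProdCLM.symm : ℝ × ℝ →L[ℝ] ℂ).comp
      ((ContinuousLinearMap.fst ℝ ℝ ℝ).prod
        (arcDeriv p.1 • ContinuousLinearMap.fst ℝ ℝ ℝ + ContinuousLinearMap.snd ℝ ℝ ℝ))) p := by
  have hw : HasFDerivAt (fun p : ℝ × ℝ ↦ arc p.1 + p.2)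
      (arcDeriv p.1 • ContinuousLinearMap.fst ℝ ℝ ℝ + ContinuousLinearMap.snd ℝ ℝ ℝ) p := by
    refine HasFDerivAt.add ?_ hasFDerivAt_snd
    exact (hasDerivAt_arc h1).comp_hasFDerivAt p hasFDerivAt_fst
  exact (Complex.equivRealProdCLM.symm : ℝ × ℝ →L[ℝ] ℂ).hasFDerivAt.comp p
    (hasFDerivAt_fst.prodMk hw)

lemma mem_strip_of_mem_Icc {Y : ℝ} {p : ℝ × ℝ}
    (hp : p ∈ Set.Icc ((-1 / 2 : ℝ), (0 : ℝ)) ((1 / 2 : ℝ), Y)) :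
    p.1 ∈ Set.Icc (-1 / 2 : ℝ) (1 / 2) ∧ 0 ≤ p.2 :=
  ⟨⟨hp.1.1, hp.2.1⟩, hp.1.2⟩

/-- In the coordinates (x, t) the domain is a rectangle. With s the derivative of the arc, the field
(P, -(s + i)P) has divergence (P_x + s P_y) - (s + i) P_y = P_x - i P_y, so the divergence theorem
on a rectangle applies. -/
lemma stokes_truncated {P d : ℂ → ℂ} (hP : ∀ z : ℂ, 0 < z.im → HasWirtingerAt P (d z) z)
    (hd : ContinuousOn d {z | 0 < z.im}) {Y : ℝ} (hY : 0 ≤ Y) :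
    (∫ p in Set.Icc ((-1 / 2 : ℝ), (0 : ℝ)) ((1 / 2 : ℝ), Y), d (fdParam p)) =
      (((∫ x in (-1 / 2 : ℝ)..(1 / 2), -((arcDeriv x : ℂ) + Complex.I) * P (fdParam (x, Y))) -
        ∫ x in (-1 / 2 : ℝ)..(1 / 2), -((arcDeriv x : ℂ) + Complex.I) * P (fdParam (x, 0))) +
        ∫ t in (0 : ℝ)..Y, P (fdParam (1 / 2, t))) - ∫ t in (0 : ℝ)..Y, P (fdParam (-1 / 2, t)) := by
  choose! L hL hLd using hP
  let Z' : ℝ × ℝ → (ℝ × ℝ →L[ℝ] ℂ) := fun p ↦ (Complex.equivRealProdCLM.symm : ℝ × ℝ →L[ℝ] ℂ).comp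
      ((ContinuousLinearMap.fst ℝ ℝ ℝ).prod
        (arcDeriv p.1 • ContinuousLinearMap.fst ℝ ℝ ℝ + ContinuousLinearMap.snd ℝ ℝ ℝ))
  let F : ℝ → ℂ := fun x ↦ -((arcDeriv x : ℂ) + Complex.I)
  have hF : ∀ x ∈ Set.Icc (-1 / 2 : ℝ) (1 / 2), DifferentiableAt ℝ F x := fun x hx ↦
    ((Complex.ofRealCLM.differentiableAt.comp x (differentiableAt_arcDeriv hx)).add_const _).neg
  have hf : ∀ p ∈ Set.Icc ((-1 / 2 : ℝ), (0 : ℝ)) ((1 / 2 : ℝ), Y),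
      HasFDerivAt (fun p ↦ P (fdParam p)) ((L (fdParam p)).comp (Z' p)) p := by
    intro p hp
    obtain ⟨h1, h2⟩ := mem_strip_of_mem_Icc hp
    exact (hL _ (fdParam_im_pos h1 h2)).comp p (hasFDerivAt_fdParam h1)
  have hg : ∀ p ∈ Set.Icc ((-1 / 2 : ℝ), (0 : ℝ)) ((1 / 2 : ℝ), Y),
      HasFDerivAt (fun p ↦ F p.1 * P (fdParam p)) (F p.1 • (L (fdParam p)).comp (Z' p) +
        P (fdParam p) • (fderiv ℝ F p.1).comp (ContinuousLinearMap.fst ℝ ℝ ℝ)) p := by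
    intro p hp
    obtain ⟨h1, h2⟩ := mem_strip_of_mem_Icc hp
    have h3 : HasFDerivAt (fun p : ℝ × ℝ ↦ F p.1)
        ((fderiv ℝ F p.1).comp (ContinuousLinearMap.fst ℝ ℝ ℝ)) p :=
      (hF p.1 h1).hasFDerivAt.comp p hasFDerivAt_fst
    exact h3.mul (hf p hp)
  have hdiv : ∀ p ∈ Set.Icc ((-1 / 2 : ℝ), (0 : ℝ)) ((1 / 2 : ℝ), Y),
      ((L (fdParam p)).comp (Z' p)) (1, 0) + (F p.1 • (L (fdParam p)).comp (Z' p) +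
        P (fdParam p) • (fderiv ℝ F p.1).comp (ContinuousLinearMap.fst ℝ ℝ ℝ)) (0, 1) =
        d (fdParam p) := by
    intro p hp
    obtain ⟨h1, h2⟩ := mem_strip_of_mem_Icc hp
    have hs : ∀ a b : ℝ, Complex.equivRealProdCLM.symm (a, b) = ⟨a, b⟩ := fun _ _ ↦ rfl
    have e1 : Z' p (1, 0) = 1 + arcDeriv p.1 • Complex.I := by
      apply Complex.ext <;> simp [Z', hs]
    have e2 : Z' p (0, 1) = Complex.I := by
      apply Complex.ext <;> simp [Z', hs]
    rw [← hLd _ (fdParam_im_pos h1 h2)]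
    simp only [ContinuousLinearMap.comp_apply, add_apply,
      smul_apply, e1, e2, map_add, map_smul, F]
    simp
    ring
  have hint : IntegrableOn (fun p ↦ d (fdParam p))
      (Set.Icc ((-1 / 2 : ℝ), (0 : ℝ)) ((1 / 2 : ℝ), Y)) := by
    refine ContinuousOn.integrableOn_compact isCompact_Icc ?_
    refine hd.comp continuous_fdParam.continuousOn fun p hp ↦ ?_
    obtain ⟨h1, h2⟩ := mem_strip_of_mem_Icc hp
    exact fdParam_im_pos h1 h2
  have hsub : Set.Ioo (-1 / 2 : ℝ) (1 / 2) ×ˢ Set.Ioo (0 : ℝ) Y ⊆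
      Set.Icc ((-1 / 2 : ℝ), (0 : ℝ)) ((1 / 2 : ℝ), Y) := fun p hp ↦
    ⟨⟨hp.1.1.le, hp.2.1.le⟩, ⟨hp.1.2.le, hp.2.2.le⟩⟩
  have key := integral_divergence_prod_Icc_of_hasFDerivAt_off_countable_of_le
    (fun p ↦ P (fdParam p)) (fun p ↦ F p.1 * P (fdParam p)) _ _ (-1 / 2, 0) (1 / 2, Y)
    ⟨by norm_num, hY⟩ ∅ Set.countable_empty
    (fun p hp ↦ (hf p hp).continuousAt.continuousWithinAt)
    (fun p hp ↦ (hg p hp).continuousAt.continuousWithinAt)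
    (fun p hp ↦ hf p (hsub hp.1)) (fun p hp ↦ hg p (hsub hp.1))
    (hint.congr_fun (fun p hp ↦ (hdiv p hp).symm) measurableSet_Icc)
  rw [setIntegral_congr_fun measurableSet_Icc hdiv] at key
  exact key

lemma fdParam_half (t : ℝ) : fdParam (1 / 2, t) = fdParam (-1 / 2, t) + 1 := by
  apply Complex.ext
  · simp [fdParam]; norm_num
  · simp [fdParam, arc]; norm_num

lemma fdParam_neg {x : ℝ} (hx : x ∈ Set.Icc (-1 / 2 : ℝ) (1 / 2)) :
    fdParam (-x, 0) = -1 / fdParam (x, 0) := by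
  have h1 := arc_sq hx
  have h0 : fdParam (x, 0) ≠ 0 := fun h ↦ by
    have := fdParam_im_pos (p := (x, 0)) hx le_rfl
    rw [h] at this
    simp at this
  rw [eq_div_iff h0]
  apply Complex.ext
  · simp [fdParam, arc] at h1 ⊢
    nlinarith
  · simp [fdParam, arc]
    ring

/-- Along the arc, -(`arcDeriv` x + i) dx is -i times the differential of conj z. The identity
expresses that z ↦ -1/z divides this differential by conj z ^ 2 and reverses the arc. -/
lemma arcDeriv_mul_conj_sq {x : ℝ} (hx : x ∈ Set.Icc (-1 / 2 : ℝ) (1 / 2)) :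
    -((arcDeriv (-x) : ℂ) + Complex.I) * conj (fdParam (x, 0)) ^ 2 =
      (arcDeriv x : ℂ) + Complex.I := by
  have h1 := arc_sq hx
  have h2 := half_lt_arc hx
  have e : ∀ x, arcDeriv x = -x / arc x := fun x ↦ rfl
  have e' : arc (-x) = arc x := by simp [arc]
  have e'' : conj (fdParam (x, 0)) = (x : ℂ) - arc x * Complex.I := by
    apply Complex.ext <;> simp [fdParam]
  rw [e, e, e', e'']
  have h3 : (arc x : ℂ) ≠ 0 := by
    norm_cast
    linarith
  have h4 : (arc x : ℂ) ^ 2 = 1 - (x : ℂ) ^ 2 := by exact_mod_cast h1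
  have h5 : Complex.I ^ 2 = -1 := Complex.I_sq
  push_cast
  field_simp
  generalize (arc x : ℂ) = s at *
  linear_combination (x * s ^ 2 - s ^ 3 * Complex.I) * h5 + (-(x : ℂ) + s * Complex.I) * h4

/-- Stokes' theorem for a sum of real differentiable functions which transforms with the factor
`conj z ^ 2` under `SL(2, ℤ)`: only the top side of the truncated fundamental domain contributes. -/
lemma stokes_tsum {ι : Type*} [Countable ι] {P d : ι → ℂ → ℂ}
    (hP : ∀ i, ∀ z : ℂ, 0 < z.im → HasWirtingerAt (P i) (d i z) z)
    (hd : ∀ i, ContinuousOn (d i) {z | 0 < z.im}) {Y : ℝ} (hY : 0 ≤ Y) {B : ι → ℝ}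
    (hB : Summable B)
    (hPB : ∀ i, ∀ p ∈ Set.Icc ((-1 / 2 : ℝ), (0 : ℝ)) ((1 / 2 : ℝ), Y), ‖P i (fdParam p)‖ ≤ B i)
    (hdB : ∀ i, ∀ p ∈ Set.Icc ((-1 / 2 : ℝ), (0 : ℝ)) ((1 / 2 : ℝ), Y), ‖d i (fdParam p)‖ ≤ B i)
    (hT : ∀ z : ℂ, 0 < z.im → ∑' i, P i (z + 1) = ∑' i, P i z)
    (hS : ∀ z : ℂ, 0 < z.im → ∑' i, P i (-1 / z) = conj z ^ 2 * ∑' i, P i z) :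
    (∫ p in Set.Icc ((-1 / 2 : ℝ), (0 : ℝ)) ((1 / 2 : ℝ), Y), ∑' i, d i (fdParam p)) =
      ∫ x in (-1 / 2 : ℝ)..(1 / 2), -((arcDeriv x : ℂ) + Complex.I) * ∑' i, P i (fdParam (x, Y)) := by
  have hPc : ∀ i, ContinuousOn (P i) {z | 0 < z.im} := fun i z hz ↦ by
    obtain ⟨L, hL, -⟩ := hP i z hz
    exact hL.continuousAt.continuousWithinAt
  have hB0 : ∀ i, 0 ≤ B i := fun i ↦
    (norm_nonneg _).trans (hPB i (0, 0) ⟨⟨by norm_num, le_rfl⟩, ⟨by norm_num, hY⟩⟩)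
  have hI : Set.uIcc (-1 / 2 : ℝ) (1 / 2) = Set.Icc (-1 / 2) (1 / 2) :=
    Set.uIcc_of_le (by norm_num)
  have hIo : Set.uIoc (-1 / 2 : ℝ) (1 / 2) ⊆ Set.Icc (-1 / 2) (1 / 2) := by
    rw [Set.uIoc_of_le (by norm_num)]
    exact Set.Ioc_subset_Icc_self
  have hYo : Set.uIoc (0 : ℝ) Y ⊆ Set.Icc 0 Y := by
    rw [Set.uIoc_of_le hY]
    exact Set.Ioc_subset_Icc_self
  have hFc : ContinuousOn (fun x ↦ -((arcDeriv x : ℂ) + Complex.I)) (Set.Icc (-1 / 2 : ℝ) (1 / 2)) :=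
    fun x hx ↦ (((Complex.continuous_ofReal.continuousAt.comp
      (differentiableAt_arcDeriv hx).continuousAt).add continuousAt_const).neg).continuousWithinAt
  -- the area integral
  have area : HasSum (fun i ↦ ∫ p in Set.Icc ((-1 / 2 : ℝ), (0 : ℝ)) ((1 / 2 : ℝ), Y), d i (fdParam p))
      (∫ p in Set.Icc ((-1 / 2 : ℝ), (0 : ℝ)) ((1 / 2 : ℝ), Y), ∑' i, d i (fdParam p)) := by
    refine hasSum_integral_of_dominated_convergence (fun i _ ↦ B i) (fun i ↦ ?_) (fun i ↦ ?_)
      (Eventually.of_forall fun _ ↦ hB) ?_ ?_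
    · refine ContinuousOn.aestronglyMeasurable ?_ measurableSet_Icc
      refine (hd i).comp continuous_fdParam.continuousOn fun p hp ↦ ?_
      exact fdParam_im_pos (mem_strip_of_mem_Icc hp).1 (mem_strip_of_mem_Icc hp).2
    · filter_upwards [ae_restrict_mem measurableSet_Icc] with p hp using hdB i p hp
    · exact continuousOn_const.integrableOn_compact isCompact_Icc
    · filter_upwards [ae_restrict_mem measurableSet_Icc] with p hp
      exact (Summable.of_norm_bounded hB fun i ↦ hdB i p hp).hasSum
  have horiz : ∀ t ∈ Set.Icc 0 Y,
      HasSum (fun i ↦ ∫ x in (-1 / 2 : ℝ)..(1 / 2),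
          -((arcDeriv x : ℂ) + Complex.I) * P i (fdParam (x, t)))
        (∫ x in (-1 / 2 : ℝ)..(1 / 2),
          -((arcDeriv x : ℂ) + Complex.I) * ∑' i, P i (fdParam (x, t))) := by
    intro t ht
    have hmem : ∀ x ∈ Set.Icc (-1 / 2 : ℝ) (1 / 2),
        (x, t) ∈ Set.Icc ((-1 / 2 : ℝ), (0 : ℝ)) ((1 / 2 : ℝ), Y) := fun x hx ↦
      ⟨⟨hx.1, ht.1⟩, ⟨hx.2, ht.2⟩⟩
    refine intervalIntegral.hasSum_integral_of_dominated_convergence (fun i _ ↦ 2 * B i)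
      (fun i ↦ ?_) (fun i ↦ ?_) (Eventually.of_forall fun _ _ ↦ hB.mul_left 2) ?_ ?_
    · refine (ContinuousOn.aestronglyMeasurable ?_ measurableSet_Icc).mono_set hIo
      refine hFc.mul ((hPc i).comp ?_ fun x hx ↦ fdParam_im_pos (p := (x, t)) hx ht.1)
      exact (continuous_fdParam.comp (by fun_prop)).continuousOn
    · refine Eventually.of_forall fun x hx ↦ ?_
      rw [norm_mul]
      gcongr
      · exact norm_arcDeriv_add_I_le (hIo hx)
      · exact hPB i _ (hmem x (hIo hx))
    · exact intervalIntegrable_const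
    · refine Eventually.of_forall fun x hx ↦ ?_
      exact (Summable.of_norm_bounded hB fun i ↦ hPB i _ (hmem x (hIo hx))).hasSum.mul_left _
  have vert : ∀ x ∈ Set.Icc (-1 / 2 : ℝ) (1 / 2),
      HasSum (fun i ↦ ∫ t in (0 : ℝ)..Y, P i (fdParam (x, t)))
        (∫ t in (0 : ℝ)..Y, ∑' i, P i (fdParam (x, t))) := by
    intro x hx
    have hmem : ∀ t ∈ Set.Icc 0 Y,
        (x, t) ∈ Set.Icc ((-1 / 2 : ℝ), (0 : ℝ)) ((1 / 2 : ℝ), Y) := fun t ht ↦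
      ⟨⟨hx.1, ht.1⟩, ⟨hx.2, ht.2⟩⟩
    refine intervalIntegral.hasSum_integral_of_dominated_convergence (fun i _ ↦ B i)
      (fun i ↦ ?_) (fun i ↦ ?_) (Eventually.of_forall fun _ _ ↦ hB) ?_ ?_
    · refine (ContinuousOn.aestronglyMeasurable ?_ measurableSet_Icc).mono_set hYo
      refine (hPc i).comp ?_ fun t ht ↦ fdParam_im_pos (p := (x, t)) hx ht.1
      exact (continuous_fdParam.comp (by fun_prop)).continuousOn
    · exact Eventually.of_forall fun t ht ↦ hPB i _ (hmem t (hYo ht))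
    · exact intervalIntegrable_const
    · refine Eventually.of_forall fun t ht ↦ ?_
      exact (Summable.of_norm_bounded hB fun i ↦ hPB i _ (hmem t (hYo ht))).hasSum
  have total := ((horiz Y ⟨hY, le_rfl⟩).sub (horiz 0 ⟨le_rfl, hY⟩)).add
    (vert (1 / 2) ⟨by norm_num, le_rfl⟩) |>.sub (vert (-1 / 2) ⟨le_rfl, by norm_num⟩)
  -- Stokes is applied to each term, since only the terms are known to be differentiable; the
  -- invariance used below holds only for the sum.
  rw [area.unique (total.congr_fun fun i ↦ stokes_truncated (hP i) (hd i) hY)]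
  have hvert : (∫ t in (0 : ℝ)..Y, ∑' i, P i (fdParam (1 / 2, t))) =
      ∫ t in (0 : ℝ)..Y, ∑' i, P i (fdParam (-1 / 2, t)) := by
    refine intervalIntegral.integral_congr fun t ht ↦ ?_
    rw [Set.uIcc_of_le hY] at ht
    simp_rw [fdParam_half]
    exact hT _ (fdParam_im_pos (p := (-1 / 2, t)) ⟨le_rfl, by norm_num⟩ ht.1)
  -- The substitution x ↦ -x is z ↦ -1/z on the arc and turns this integral into its negative.
  have harc : (∫ x in (-1 / 2 : ℝ)..(1 / 2),
      -((arcDeriv x : ℂ) + Complex.I) * ∑' i, P i (fdParam (x, 0))) = 0 := by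
    have h1 := intervalIntegral.integral_comp_neg (a := -1 / 2) (b := 1 / 2)
      (fun x : ℝ ↦ -((arcDeriv x : ℂ) + Complex.I) * ∑' i, P i (fdParam (x, 0)))
    rw [show -(-1 / 2 : ℝ) = 1 / 2 by norm_num, show -(1 / 2 : ℝ) = -1 / 2 by norm_num] at h1
    have h2 : (∫ x in (-1 / 2 : ℝ)..(1 / 2),
        -((arcDeriv (-x) : ℂ) + Complex.I) * ∑' i, P i (fdParam (-x, 0))) =
        ∫ x in (-1 / 2 : ℝ)..(1 / 2),
          -(-((arcDeriv x : ℂ) + Complex.I) * ∑' i, P i (fdParam (x, 0))) := by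
      refine intervalIntegral.integral_congr fun x hx ↦ ?_
      rw [hI] at hx
      simp_rw [fdParam_neg hx]
      rw [hS _ (fdParam_im_pos (p := (x, 0)) hx le_rfl), ← mul_assoc, arcDeriv_mul_conj_sq hx]
      ring
    rw [intervalIntegral.integral_neg, h1] at h2
    linear_combination (1 / 2) * h2
  rw [hvert, harc]
  ring

end EisGamma

/-! ### Hyperbolic integrals in the coordinates (x, t), and the potential of the kernel. -/

namespace EisGamma

open Filter Topology
open scoped ComplexConjugate

/-! ### Integration over the truncated fundamental domain -/

lemma fdParam_sub_arc (z : ℂ) : fdParam (z.re, z.im - arc z.re) = z := by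
  apply Complex.ext <;> simp [fdParam]

lemma injective_fdParam : Function.Injective fdParam := by
  rintro ⟨x, t⟩ ⟨x', t'⟩ h
  have h1 : x = x' := congrArg Complex.re h
  have h2 : arc x + t = arc x' + t' := congrArg Complex.im h
  subst h1
  simpa using h2

lemma measurePreserving_fdParam : MeasurePreserving fdParam := by
  have h : MeasurePreserving (fun p : ℝ × ℝ ↦ (p.1, arc p.1 + p.2)) :=
    (MeasurePreserving.id volume).skew_product (g := fun x t ↦ arc x + t)
      ((continuous_arc.comp continuous_fst).add continuous_snd).measurable
      (Eventually.of_forall fun x ↦ map_add_left_eq_self volume (arc x))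
  exact Complex.volume_preserving_equiv_real_prod.symm.comp h

/-- The part of the fundamental domain of height at most `Y` above the unit circle. -/
def fdTrunc (Y : ℝ) : Set ℍ := {τ | τ ∈ 𝒟 ∧ τ.im ≤ arc τ.re + Y}

lemma arc_le_im_of_mem_fd {τ : ℍ} (hτ : τ ∈ 𝒟) : arc τ.re ≤ τ.im := by
  refine Real.sqrt_le_iff.mpr ⟨τ.im_pos.le, ?_⟩
  have h := hτ.1
  rw [Complex.normSq_apply] at h
  simp only [coe_re, coe_im] at h
  nlinarith

lemma ofComplex_fdParam_mem_fd {p : ℝ × ℝ} (h1 : p.1 ∈ Set.Icc (-1 / 2 : ℝ) (1 / 2))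
    (h2 : 0 ≤ p.2) : ofComplex (fdParam p) ∈ 𝒟 := by
  have h := fdParam_im_pos h1 h2
  rw [ofComplex_apply_of_im_pos h]
  have h3 := arc_sq h1
  have h4 := half_lt_arc h1
  refine ⟨?_, abs_le.mpr ⟨?_, h1.2⟩⟩
  · rw [Complex.normSq_apply]
    change 1 ≤ p.1 * p.1 + (arc p.1 + p.2) * (arc p.1 + p.2)
    nlinarith
  · have := h1.1
    change -(1 / 2) ≤ p.1
    linarith

lemma image_coe_fdTrunc (Y : ℝ) : ((↑) '' fdTrunc Y : Set ℂ) =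
    fdParam '' Set.Icc ((-1 / 2 : ℝ), (0 : ℝ)) ((1 / 2 : ℝ), Y) := by
  ext z
  constructor
  · rintro ⟨τ, ⟨h1, h2⟩, rfl⟩
    refine ⟨(τ.re, τ.im - arc τ.re), ⟨⟨?_, ?_⟩, ⟨?_, ?_⟩⟩, fdParam_sub_arc τ⟩
    · have := (abs_le.mp h1.2).1
      change -1 / 2 ≤ τ.re
      linarith
    · exact sub_nonneg.mpr (arc_le_im_of_mem_fd h1)
    · exact (abs_le.mp h1.2).2
    · change τ.im - arc τ.re ≤ Y
      linarith
  · rintro ⟨p, hp, rfl⟩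
    obtain ⟨h1, h2⟩ := mem_strip_of_mem_Icc hp
    have h := fdParam_im_pos h1 h2
    refine ⟨ofComplex (fdParam p), ⟨ofComplex_fdParam_mem_fd h1 h2, ?_⟩, ?_⟩
    · rw [ofComplex_apply_of_im_pos h]
      change arc p.1 + p.2 ≤ arc p.1 + Y
      have : p.2 ≤ Y := hp.2.2
      linarith
    · rw [ofComplex_apply_of_im_pos h]

lemma measurableSet_fdTrunc (Y : ℝ) : MeasurableSet (fdTrunc Y) := by
  have h : MeasurableSet ((↑) '' fdTrunc Y : Set ℂ) := by
    rw [image_coe_fdTrunc]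
    exact (continuous_fdParam.measurableEmbedding injective_fdParam).measurableSet_image.mpr
      measurableSet_Icc
  exact measurableEmbedding_coe.measurableSet_image.mp h

lemma integral_fdTrunc (h : ℍ → ℂ) (Y : ℝ) :
    ∫ τ in fdTrunc Y, h τ = ∫ p in Set.Icc ((-1 / 2 : ℝ), (0 : ℝ)) ((1 / 2 : ℝ), Y),
      (((fdParam p).im ^ 2 : ℝ) : ℂ)⁻¹ * h (ofComplex (fdParam p)) := by
  have hm : AEMeasurable (fun z : ℍ ↦ (1 / NNReal.mk z.im z.im_pos.le) ^ 2)
      ((volume.comap UpperHalfPlane.coe).restrict (fdTrunc Y)) := by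
    have : Measurable fun z : ℍ ↦ NNReal.mk z.im z.im_pos.le :=
      continuous_im.measurable.subtype_mk
    exact ((measurable_const.div this).pow_const 2).aemeasurable
  have hp : MeasurePreserving UpperHalfPlane.coe (volume.comap UpperHalfPlane.coe)
      (volume.restrict (.range UpperHalfPlane.coe)) :=
    ⟨measurable_coe, by rw [measurableEmbedding_coe.map_comap]⟩
  rw [volume_def, setIntegral_withDensity_eq_setIntegral_smul₀ hm _ (measurableSet_fdTrunc Y)]
  have e1 := hp.setIntegral_image_emb measurableEmbedding_coe
    (fun z ↦ ((z.im ^ 2 : ℝ) : ℂ)⁻¹ * h (ofComplex z)) (fdTrunc Y)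
  rw [Measure.restrict_restrict' measurableEmbedding_coe.measurableSet_range,
    Set.inter_eq_self_of_subset_left (Set.image_subset_range _ _), image_coe_fdTrunc,
    measurePreserving_fdParam.setIntegral_image_emb
      (continuous_fdParam.measurableEmbedding injective_fdParam)] at e1
  rw [e1]
  refine integral_congr_ae (Eventually.of_forall fun τ ↦ ?_)
  simp only [ofComplex_apply, NNReal.smul_def, coe_im]
  rw [Complex.real_smul]
  push_cast
  simp

lemma tendsto_integral_fdTrunc {h : ℍ → ℂ} (hh : IntegrableOn h 𝒟) :
    Tendsto (fun Y ↦ ∫ τ in fdTrunc Y, h τ) atTop (𝓝 (∫ τ in 𝒟, h τ)) := by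
  have e : ⋃ Y, fdTrunc Y = 𝒟 := by
    ext τ
    simp only [Set.mem_iUnion]
    exact ⟨fun ⟨Y, hY⟩ ↦ hY.1, fun hτ ↦ ⟨τ.im - arc τ.re, hτ, by linarith⟩⟩
  rw [← e] at hh ⊢
  exact tendsto_setIntegral_of_monotone measurableSet_fdTrunc
    (fun Y Y' hY τ hτ ↦ ⟨hτ.1, hτ.2.trans (by linarith)⟩) hh

/-! ### A potential for the regularised kernel -/

variable {N : ℕ}

/-- A function whose image under `∂/∂x - i ∂/∂y` is a multiple of the regularised kernel. -/
def regPotential (k : ℕ) (ε : ℝ) (a : ℂ) (y : ℝ) : ℂ :=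
  (y : ℂ) ^ k * ((a ^ (k - 1))⁻¹ * ((conj a)⁻¹ * (y + ε * (a * conj a))⁻¹))

lemma ofReal_add_mul_conj (ε y : ℝ) (a : ℂ) :
    (y : ℂ) + ε * (a * conj a) = ((y + ε * ‖a‖ ^ 2 : ℝ) : ℂ) := by
  rw [Complex.mul_conj, Complex.normSq_eq_norm_sq]
  push_cast
  rfl

lemma norm_regPotential_le {k : ℕ} (hk : 2 ≤ k) {ε y : ℝ} (hε : 0 < ε) (hy : 0 < y) (a : ℂ) :
    ‖regPotential k ε a y‖ ≤ y ^ k / ε * (‖a‖ ^ (k + 2))⁻¹ := by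
  rcases eq_or_ne a 0 with rfl | ha
  · simp [regPotential]
  · have ha' : 0 < ‖a‖ := norm_pos_iff.mpr ha
    rw [regPotential, ofReal_add_mul_conj]
    simp only [norm_mul, norm_inv, norm_pow, Complex.norm_real, Complex.norm_conj]
    rw [Real.norm_of_nonneg hy.le, Real.norm_of_nonneg (by positivity)]
    obtain ⟨m, rfl⟩ : ∃ m, k = m + 1 := ⟨k - 1, by omega⟩
    calc _ ≤ y ^ (m + 1) * ((‖a‖ ^ m)⁻¹ * (‖a‖⁻¹ * (ε * ‖a‖ ^ 2)⁻¹)) := by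
          simp only [add_tsub_cancel_right]
          gcongr
          linarith
      _ = _ := by
        field_simp
        ring

/-- The factor conj j ^ k on the left is supplied by the conjugate of a form of weight k; the
product then has the factor conj j ^ 2 that Stokes' theorem requires. -/
lemma regPotential_div {k : ℕ} (hk : 2 ≤ k) (ε : ℝ) (a : ℂ) (y : ℝ) {j : ℂ} (hj : j ≠ 0) :
    conj j ^ k * regPotential k ε (a / j) (y / Complex.normSq j) =
      conj j ^ 2 * regPotential k ε a y := by
  obtain ⟨m, rfl⟩ : ∃ m, k = m + 1 := ⟨k - 1, by omega⟩
  have hj' : conj j ≠ 0 := by simpa using hj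
  have e : ((y / Complex.normSq j : ℝ) : ℂ) = y / (j * conj j) := by
    rw [Complex.mul_conj]
    push_cast
    rfl
  have e2 : (y : ℂ) / (j * conj j) + ε * (a / j * (conj a / conj j)) =
      (y + ε * (a * conj a)) / (j * conj j) := by
    field_simp
  rw [regPotential, regPotential, e, map_div₀, e2]
  simp only [add_tsub_cancel_right, inv_div, div_pow]
  field_simp
  rw [mul_pow]
  ring

/-- The linear form `mz + n` for `u = (m, n)`. -/
def linC (u : Fin 2 → ℤ) (z : ℂ) : ℂ := (u 0 : ℂ) * z + u 1

lemma linC_ne_zero {u : Fin 2 → ℤ} (hu : u ≠ 0) {z : ℂ} (hz : 0 < z.im) : linC u z ≠ 0 := by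
  intro h
  have h1 := congrArg Complex.im h
  have h0 := congrArg Complex.re h
  simp [linC, hz.ne'] at h1
  simp [linC, h1] at h0
  apply hu
  ext i
  fin_cases i <;> simpa

lemma HasWirtingerAt.congr_deriv {P : ℂ → ℂ} {d d' z : ℂ} (h : HasWirtingerAt P d z)
    (hd : d' = d) : HasWirtingerAt P d' z := hd ▸ h

/-- The shape of χ is dictated by this identity. For ε = 0 it would say that y^(k-1) / (a^(k-1) conj
a) is a primitive of -i(k - 1) y^(k-2) a⁻ᵏ; the factor with ε makes the primitive summable over the
lattice. -/
lemma hasWirtingerAt_regPotential {k : ℕ} (hk : 2 ≤ k) {ε : ℝ} (hε : 0 < ε) (u : Fin 2 → ℤ) {z : ℂ}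
    (hz : 0 < z.im) : HasWirtingerAt (fun z ↦ regPotential k ε (linC u z) z.im)
      (-Complex.I * (z.im : ℂ) ^ (k - 2) * regKernel k ε (linC u z) z.im) z := by
  rcases eq_or_ne u 0 with rfl | hu
  · have : k ≠ 0 := by omega
    have := hasWirtingerAt_const 0 z
    simpa [linC, regPotential, regKernel, show k ≠ 0 by omega]
  have ha := linC_ne_zero hu hz
  have ha' : conj (linC u z) ≠ 0 := by simpa using ha
  have hder : HasDerivAt (linC u) (u 0) z := by
    have := ((hasDerivAt_id z).const_mul (u 0 : ℂ)).add_const (u 1 : ℂ)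
    rwa [mul_one] at this
  have hW : (z.im : ℂ) + ε * (linC u z * conj (linC u z)) ≠ 0 := by
    rw [ofReal_add_mul_conj]
    norm_cast
    positivity
  have d1 := (hasWirtingerAt_im z).pow k
  have d2 := ((hasWirtingerAt_of_hasDerivAt hder).pow (k - 1)).inv (pow_ne_zero _ ha)
  have d3 := hasWirtingerAt_conj_of_hasDerivAt hder
  have d4 := (hasWirtingerAt_im z).add ((hasWirtingerAt_const (ε : ℂ) z).mul
    ((hasWirtingerAt_of_hasDerivAt hder).mul d3))
  have key := d1.mul (d2.mul ((d3.inv ha').mul (d4.inv hW)))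
  refine HasWirtingerAt.congr_deriv (P := fun z ↦ regPotential k ε (linC u z) z.im) key ?_
  have hcast : ((z.im * ((k - 1) * (z.im + ε * ‖linC u z‖ ^ 2) + ε * ‖linC u z‖ ^ 2) /
      (z.im + ε * ‖linC u z‖ ^ 2) ^ 2 : ℝ) : ℂ) = z.im * ((k - 1) *
      (z.im + ε * (linC u z * conj (linC u z))) + ε * (linC u z * conj (linC u z))) /
      (z.im + ε * (linC u z * conj (linC u z))) ^ 2 := by
    rw [Complex.mul_conj, Complex.normSq_eq_norm_sq]
    push_cast
    rfl
  simp only [regKernel]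
  rw [hcast]
  have hy : (z.im : ℂ) ≠ 0 := by exact_mod_cast hz.ne'
  -- Differentiating a = mz + n produces m, which is eliminated in favour of a, conj a and y.
  have him : 2 * (u 0 : ℂ) * z.im = -Complex.I * (linC u z - conj (linC u z)) := by
    have : (linC u z - conj (linC u z)) = 2 * (u 0 : ℂ) * z.im * Complex.I := by
      apply Complex.ext <;> simp [linC]
      ring
    rw [this]
    linear_combination (2 * (u 0 : ℂ) * z.im) * Complex.I_mul_I
  obtain ⟨m, rfl⟩ : ∃ m, k = m + 2 := ⟨k - 2, by omega⟩
  simp only [show m + 2 - 2 = m by omega, show m + 2 - 1 = m + 1 by omega,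
    show m + 1 - 1 = m by omega]
  generalize conj (linC u z) = b at *
  generalize linC u z = a at *
  generalize (z.im : ℂ) = y at *
  generalize (u 0 : ℂ) = q at *
  have hq : q = -Complex.I * (a - b) / (2 * y) := by
    field_simp
    linear_combination him
  subst hq
  push_cast
  field_simp
  ring

end EisGamma

/-! ### Translates of forms, and sums over the cosets of Γ(N). -/

namespace EisGamma

open Filter Topology
open scoped ComplexConjugate Manifold

variable {N : ℕ}

/-! ### Translates of forms for `Γ(N)` -/

lemma slash_of_mem_Gamma {F : Type*} [FunLike F ℍ ℂ] {k : ℤ}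
    [SlashInvariantFormClass F (principal N) k] (f : F) {γ : SL(2, ℤ)} (hγ : γ ∈ Gamma N) :
    ⇑f ∣[k] γ = f :=
  SlashInvariantFormClass.slash_action_eq f _ ⟨γ, hγ, rfl⟩

lemma slash_Gamma_mul {F : Type*} [FunLike F ℍ ℂ] {k : ℤ}
    [SlashInvariantFormClass F (principal N) k] (f : F) {γ : SL(2, ℤ)} (hγ : γ ∈ Gamma N)
    (δ : SL(2, ℤ)) : ⇑f ∣[k] (γ * δ) = ⇑f ∣[k] δ := by
  rw [SlashAction.slash_mul, slash_of_mem_Gamma f hγ]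

lemma slash_mul_Gamma {F : Type*} [FunLike F ℍ ℂ] {k : ℤ}
    [SlashInvariantFormClass F (principal N) k] (f : F) {γ : SL(2, ℤ)} (hγ : γ ∈ Gamma N)
    (δ : SL(2, ℤ)) : ⇑f ∣[k] (δ * γ) = ⇑f ∣[k] δ := by
  rw [show δ * γ = (δ * γ * δ⁻¹) * δ by group]
  exact slash_Gamma_mul f ((Gamma_normal N).conj_mem _ hγ _) _

lemma T_pow_mem_Gamma (N : ℕ) : ModularGroup.T ^ (N : ℤ) ∈ Gamma N :=
  ModularGroup_T_pow_mem_Gamma N N dvd_rfl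

lemma slash_T_zpow_apply (f : ℍ → ℂ) (k n : ℤ) (τ : ℍ) :
    (f ∣[k] (ModularGroup.T ^ n)) τ = f (ModularGroup.T ^ n • τ) := by
  rw [ModularForm.SL_slash_apply]
  have : denom ((ModularGroup.T ^ n : SL(2, ℤ)) : GL (Fin 2) ℝ) τ = 1 := by
    rw [ModularGroup.denom_apply, ModularGroup.coe_T_zpow]
    simp
  rw [this, one_zpow, mul_one]

lemma periodic_slash {F : Type*} [FunLike F ℍ ℂ] {k : ℤ}
    [SlashInvariantFormClass F (principal N) k] (f : F) (δ : SL(2, ℤ)) :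
    Function.Periodic ((⇑f ∣[k] δ) ∘ ofComplex) (N : ℝ) := by
  intro w
  by_cases! hw : 0 < w.im
  · have h1 : 0 < (w + (N : ℝ)).im := by simp [hw]
    simp only [Function.comp_apply, ofComplex_apply_of_im_pos h1, ofComplex_apply_of_im_pos hw]
    have h2 := slash_mul_Gamma f (T_pow_mem_Gamma N) δ
    rw [SlashAction.slash_mul] at h2
    have h3 := congrFun h2 ⟨w, hw⟩
    rw [slash_T_zpow_apply] at h3
    rw [← h3]
    refine congrArg (⇑f ∣[k] δ) (UpperHalfPlane.ext ?_)
    rw [ModularGroup.coe_T_zpow_smul_eq]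
    simp
  · have h1 : (w + (N : ℝ)).im ≤ 0 := by simpa using hw
    rw [Function.comp_apply, Function.comp_apply, ofComplex_apply_of_im_nonpos h1,
      ofComplex_apply_of_im_nonpos hw]

lemma mdifferentiable_slash {F : Type*} [FunLike F ℍ ℂ] {k : ℤ}
    [ModularFormClass F (principal N) k] (f : F) (δ : SL(2, ℤ)) : MDiff (⇑f ∣[k] δ) :=
  (ModularFormClass.holo f).slash k _

lemma isCusp_principal [NeZero N] (δ : SL(2, ℤ)) :
    IsCusp (mapGL ℝ δ • OnePoint.infty) (principal N) := by
  rw [Subgroup.IsArithmetic.isCusp_iff_isCusp_SL2Z, isCusp_SL2Z_iff']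
  exact ⟨δ, rfl⟩

lemma isZeroAtImInfty_slash [NeZero N] {k : ℤ} (g : CuspForm (principal N) k) (δ : SL(2, ℤ)) :
    IsZeroAtImInfty (⇑g ∣[k] δ) := by
  have h := CuspFormClass.zero_at_cusps g (isCusp_principal (N := N) δ)
  rw [OnePoint.isZeroAt_iff_forall_SL2Z] at h
  · exact h δ rfl
  · exact isCusp_SL2Z_iff'.mpr ⟨δ, rfl⟩

lemma isBoundedAtImInfty_slash [NeZero N] {k : ℤ} (f : ModularForm (principal N) k)
    (δ : SL(2, ℤ)) : IsBoundedAtImInfty (⇑f ∣[k] δ) := by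
  have h := ModularFormClass.bdd_at_cusps f (isCusp_principal (N := N) δ)
  rw [OnePoint.isBoundedAt_iff_forall_SL2Z] at h
  · exact h δ rfl
  · exact isCusp_SL2Z_iff'.mpr ⟨δ, rfl⟩

lemma half_le_im_of_mem_fd {τ : ℍ} (hτ : τ ∈ 𝒟) : 1 / 2 ≤ τ.im := by
  nlinarith [ModularGroup.three_le_four_mul_im_sq_of_mem_fd hτ, τ.im_pos]

/-- Translates of cusp forms decay rapidly in the fundamental domain. -/
lemma exists_norm_slash_le [NeZero N] {k : ℤ} (g : CuspForm (principal N) k) (δ : SL(2, ℤ)) (M : ℕ) :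
    ∃ C, ∀ τ ∈ 𝒟, ‖(⇑g ∣[k] δ) τ‖ ≤ C * (τ.im ^ M)⁻¹ := by
  have hN : (0 : ℝ) < N := by exact_mod_cast NeZero.pos N
  have h0 := isZeroAtImInfty_slash g δ
  have h1 := h0.exp_decay_atImInfty hN (periodic_slash g δ) (mdifferentiable_slash g δ)
    (h0.isBoundedAtImInfty)
  have h2 : (fun τ : ℍ ↦ Real.exp (-2 * Real.pi * τ.im / N)) =O[atImInfty]
      fun τ ↦ τ.im ^ (-(M : ℝ)) := by
    have hb : 0 < 2 * Real.pi / N := by positivity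
    have := (isLittleO_exp_neg_mul_rpow_atTop hb (-(M : ℝ))).isBigO.comp_tendsto
      (tendsto_comap : Tendsto UpperHalfPlane.im atImInfty atTop)
    refine this.congr_left fun τ ↦ ?_
    simp only [Function.comp]
    congr 1
    ring
  obtain ⟨C, hC⟩ := ModularGroup.exists_bound_fundamental_domain_of_isBigO
    (mdifferentiable_slash g δ).continuous (h1.trans h2)
  refine ⟨C, fun τ hτ ↦ (hC τ hτ).trans_eq ?_⟩
  rw [Real.rpow_neg τ.im_pos.le, Real.rpow_natCast]

/-! ### Sums over cosets -/

instance [NeZero N] : Fintype (SL(2, ℤ) ⧸ Gamma N) := Fintype.ofFinite _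

/-- The elements `q.out⁻¹` represent the cosets Γ(N)δ, which right multiplication by γ permutes. -/
lemma sum_coset_mul [NeZero N] {M : Type*} [AddCommMonoid M] (F : SL(2, ℤ) → M)
    (hF : ∀ γ ∈ Gamma N, ∀ δ, F (γ * δ) = F δ) (γ : SL(2, ℤ)) :
    ∑ q : SL(2, ℤ) ⧸ Gamma N, F (q.out⁻¹ * γ) = ∑ q : SL(2, ℤ) ⧸ Gamma N, F q.out⁻¹ := by
  refine Eq.trans (Finset.sum_congr rfl fun q _ ↦ ?_)
    (Equiv.sum_comp (MulAction.toPerm γ⁻¹) fun q : SL(2, ℤ) ⧸ Gamma N ↦ F q.out⁻¹)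
  have h : ((γ⁻¹ • q : SL(2, ℤ) ⧸ Gamma N).out : SL(2, ℤ) ⧸ Gamma N) =
      ((γ⁻¹ * q.out : SL(2, ℤ)) : SL(2, ℤ) ⧸ Gamma N) := by
    rw [QuotientGroup.out_eq', ← MulAction.Quotient.coe_smul_out]
    rfl
  rw [QuotientGroup.eq] at h
  rw [MulAction.toPerm_apply, ← hF _ h]
  congr 1
  group

/-! ### The summed potential -/

/-- The potential of the regularised Eisenstein series. -/
def potSeries (k : ℕ) (ε : ℝ) (c : (Fin 2 → ZMod N) → ℂ) (τ : ℍ) : ℂ :=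
  ∑' u : Fin 2 → ℤ, c (fun i ↦ (u i : ZMod N)) * regPotential k ε (lin u τ) τ.im

lemma norm_potSeries_term_le {k : ℕ} (hk : 2 ≤ k) {ε : ℝ} (hε : 0 < ε)
    {c : (Fin 2 → ZMod N) → ℂ} {C : ℝ} (hC0 : 0 ≤ C) (hC : ∀ v, ‖c v‖ ≤ C) {κ : ℝ} (hκ : 0 < κ)
    {τ : ℍ} (hτ : κ ≤ EisensteinSeries.r τ) (u : Fin 2 → ℤ) :
    ‖c (fun i ↦ (u i : ZMod N)) * regPotential k ε (lin u τ) τ.im‖ ≤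
      C / ε * (κ ^ (k + 2))⁻¹ * τ.im ^ k * (‖u‖ ^ (k + 2))⁻¹ := by
  have := τ.im_pos
  calc _ ≤ C * (τ.im ^ k / ε * ((κ ^ (k + 2))⁻¹ * (‖u‖ ^ (k + 2))⁻¹)) := by
        rw [norm_mul]
        refine mul_le_mul (hC _) ?_ (norm_nonneg _) hC0
        refine (norm_regPotential_le hk hε τ.im_pos _).trans ?_
        gcongr
        exact inv_norm_lin_pow_le' hκ hτ (by omega) u
    _ = _ := by ring

lemma summable_potSeries [NeZero N] {k : ℕ} (hk : 2 ≤ k) {ε : ℝ} (hε : 0 < ε)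
    (c : (Fin 2 → ZMod N) → ℂ) (τ : ℍ) :
    Summable fun u : Fin 2 → ℤ ↦ c (fun i ↦ (u i : ZMod N)) * regPotential k ε (lin u τ) τ.im := by
  obtain ⟨C, hC0, hC⟩ := exists_norm_le_of_finite c
  exact Summable.of_norm_bounded ((summable_inv_norm_pow (p := k + 2) (by omega)).mul_left _)
    (norm_potSeries_term_le hk hε hC0 hC (EisensteinSeries.r_pos τ) le_rfl)

lemma exists_norm_potSeries_le [NeZero N] {k : ℕ} (hk : 2 ≤ k) {ε : ℝ} (hε : 0 < ε)
    (c : (Fin 2 → ZMod N) → ℂ) {κ : ℝ} (hκ : 0 < κ) :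
    ∃ C, 0 ≤ C ∧ ∀ τ : ℍ, κ ≤ EisensteinSeries.r τ → ‖potSeries k ε c τ‖ ≤ C * τ.im ^ k := by
  obtain ⟨C, hC0, hC⟩ := exists_norm_le_of_finite c
  refine ⟨C / ε * (κ ^ (k + 2))⁻¹ * ∑' u : Fin 2 → ℤ, (‖u‖ ^ (k + 2))⁻¹, ?_, fun τ hτ ↦ ?_⟩
  · have : 0 ≤ ∑' u : Fin 2 → ℤ, (‖u‖ ^ (k + 2))⁻¹ := tsum_nonneg fun u ↦ by positivity
    positivity
  · refine (tsum_of_norm_bounded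
      ((summable_inv_norm_pow (p := k + 2) (by omega)).hasSum.mul_left _)
      (norm_potSeries_term_le hk hε hC0 hC hκ hτ)).trans_eq ?_
    ring

lemma potSeries_smul {k : ℕ} (hk : 2 ≤ k) (ε : ℝ) (c : (Fin 2 → ZMod N) → ℂ) (γ : SL(2, ℤ))
    (τ : ℍ) : conj (denom γ τ) ^ k * potSeries k ε c (γ • τ) =
      conj (denom γ τ) ^ 2 * potSeries k ε (twist c γ) τ := by
  rw [potSeries, potSeries, ← tsum_mul_left, ← tsum_mul_left]
  refine Eq.trans (tsum_congr fun u ↦ ?_) ((vecMulEquiv γ).tsum_eq _)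
  rw [lin_smul, ModularGroup.im_smul_eq_div_normSq, mul_left_comm,
    regPotential_div hk _ _ _ (denom_ne_zero γ τ)]
  simp only [vecMulEquiv, Equiv.coe_fn_mk]
  rw [twist_cast_vecMul]
  ring

/-- A lower bound for `EisensteinSeries.r` on the fundamental domain. -/
def fdBound : ℝ := EisensteinSeries.r ⟨⟨1 / 2, 1 / 2⟩, by norm_num⟩

lemma fdBound_pos : 0 < fdBound := EisensteinSeries.r_pos _

lemma fdBound_le {τ : ℍ} (hτ : τ ∈ 𝒟) : fdBound ≤ EisensteinSeries.r τ :=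
  EisensteinSeries.r_lower_bound_on_verticalStrip τ (by norm_num) ⟨hτ.2, half_le_im_of_mem_fd hτ⟩

variable {k : ℕ}

/-- The invariant combination of the potentials with a cusp form. -/
def pairedPotential [NeZero N] (g : CuspForm (principal N) k) (ε : ℝ)
    (c : (Fin 2 → ZMod N) → ℂ) (τ : ℍ) : ℂ :=
  ∑ q : SL(2, ℤ) ⧸ Gamma N,
    conj ((⇑g ∣[(k : ℤ)] q.out⁻¹) τ) * potSeries k ε (twist c q.out⁻¹) τ

/-- An element of SL(2, ℤ) permutes the summands, up to the automorphy factor. Summation over cosets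
thus gives the full modular group, and with it the side pairings of the standard fundamental domain.
-/
lemma pairedPotential_smul [NeZero N] (hk : 2 ≤ k) (g : CuspForm (principal N) k) (ε : ℝ)
    (c : (Fin 2 → ZMod N) → ℂ) (γ : SL(2, ℤ)) (τ : ℍ) :
    pairedPotential g ε c (γ • τ) = conj (denom γ τ) ^ 2 * pairedPotential g ε c τ := by
  let F : SL(2, ℤ) → ℂ := fun δ ↦ conj ((⇑g ∣[(k : ℤ)] δ) τ) * potSeries k ε (twist c δ) τ
  have hF : ∀ γ ∈ Gamma N, ∀ δ, F (γ * δ) = F δ := fun γ hγ δ ↦ by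
    simp only [F]
    rw [slash_Gamma_mul g hγ, twist_mul, twist_of_mem_Gamma c hγ]
  have h := sum_coset_mul F hF γ
  rw [pairedPotential, pairedPotential]
  change _ = _ * ∑ q : SL(2, ℤ) ⧸ Gamma N, F q.out⁻¹
  rw [← h, Finset.mul_sum]
  refine Finset.sum_congr rfl fun q _ ↦ ?_
  simp only [F]
  have h0 : denom γ τ ≠ 0 := denom_ne_zero γ τ
  have e : (⇑g ∣[(k : ℤ)] q.out⁻¹) (γ • τ) =
      denom γ τ ^ k * (⇑g ∣[(k : ℤ)] (q.out⁻¹ * γ)) τ := by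
    rw [SlashAction.slash_mul, ModularForm.SL_slash_apply (τ := τ), zpow_neg, zpow_natCast]
    field_simp
  rw [e, map_mul, map_pow, mul_right_comm, potSeries_smul hk, twist_mul]
  ring

end EisGamma

/-! ### The regularised Petersson integrand as an exact expression. -/

namespace EisGamma

open Filter Topology
open scoped ComplexConjugate Manifold

variable {N : ℕ} {k : ℕ}

/-! ### Unfolding against a cusp form -/

/-- The combination of the regularised Eisenstein series with a cusp form. -/
def pairedReg [NeZero N] (g : CuspForm (principal N) k) (ε : ℝ)
    (c : (Fin 2 → ZMod N) → ℂ) (τ : ℍ) : ℂ :=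
  ∑ q : SL(2, ℤ) ⧸ Gamma N,
    conj ((⇑g ∣[(k : ℤ)] q.out⁻¹) τ) * regSeries k ε (twist c q.out⁻¹) τ

/-- The antiholomorphic coefficient of a lattice vector in `pairedPotential`. -/
def pairedCoeff [NeZero N] (g : CuspForm (principal N) k) (c : (Fin 2 → ZMod N) → ℂ)
    (u : Fin 2 → ℤ) (z : ℂ) : ℂ :=
  conj (∑ q : SL(2, ℤ) ⧸ Gamma N, conj (twist c q.out⁻¹ fun i ↦ (u i : ZMod N)) *
    (⇑g ∣[(k : ℤ)] q.out⁻¹) (ofComplex z))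

lemma differentiableAt_sum_slash [NeZero N] (g : CuspForm (principal N) k)
    (a : SL(2, ℤ) ⧸ Gamma N → ℂ) {z : ℂ} (hz : 0 < z.im) :
    DifferentiableAt ℂ (fun z ↦ ∑ q : SL(2, ℤ) ⧸ Gamma N, a q *
      (⇑g ∣[(k : ℤ)] q.out⁻¹) (ofComplex z)) z := by
  refine DifferentiableAt.fun_sum fun q _ ↦ DifferentiableAt.const_mul ?_ _
  exact (UpperHalfPlane.mdifferentiable_iff.mp (mdifferentiable_slash g q.out⁻¹)).differentiableAt
    (isOpen_upperHalfPlaneSet.mem_nhds hz)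

lemma hasWirtingerAt_pairedCoeff [NeZero N] (g : CuspForm (principal N) k)
    (c : (Fin 2 → ZMod N) → ℂ) (u : Fin 2 → ℤ) {z : ℂ} (hz : 0 < z.im) :
    HasWirtingerAt (pairedCoeff g c u) 0 z :=
  hasWirtingerAt_conj_of_hasDerivAt (differentiableAt_sum_slash g _ hz).hasDerivAt

lemma HasWirtingerAt.continuousAt {P : ℂ → ℂ} {d z : ℂ} (h : HasWirtingerAt P d z) :
    ContinuousAt P z := by
  obtain ⟨L, hL, -⟩ := h
  exact hL.continuousAt

lemma pairedCoeff_eq [NeZero N] (g : CuspForm (principal N) k)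
    (c : (Fin 2 → ZMod N) → ℂ) (u : Fin 2 → ℤ) (τ : ℍ) :
    pairedCoeff g c u τ = ∑ q : SL(2, ℤ) ⧸ Gamma N, conj ((⇑g ∣[(k : ℤ)] q.out⁻¹) τ) *
      twist c q.out⁻¹ fun i ↦ (u i : ZMod N) := by
  simp [pairedCoeff, mul_comm]

lemma exists_norm_pairedCoeff_le [NeZero N] (g : CuspForm (principal N) k)
    (c : (Fin 2 → ZMod N) → ℂ) :
    ∃ K, 0 ≤ K ∧ ∀ u, ∀ τ ∈ 𝒟, ‖pairedCoeff g c u (τ : ℍ)‖ ≤ K := by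
  choose C hC using fun q : SL(2, ℤ) ⧸ Gamma N ↦ exists_norm_slash_le g q.out⁻¹ 0
  choose D hD0 hD using fun q : SL(2, ℤ) ⧸ Gamma N ↦ exists_norm_le_of_finite (twist c q.out⁻¹)
  have hC0 : ∀ q, 0 ≤ C q := fun q ↦ by
    have := (norm_nonneg _).trans (hC q _ ModularGroup.I_mem_fd)
    simpa using this
  refine ⟨∑ q, C q * D q, Finset.sum_nonneg fun q _ ↦ mul_nonneg (hC0 q) (hD0 q),
    fun u τ hτ ↦ ?_⟩
  rw [pairedCoeff_eq]
  refine (norm_sum_le _ _).trans (Finset.sum_le_sum fun q _ ↦ ?_)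
  rw [norm_mul, RCLike.norm_conj]
  exact mul_le_mul (by simpa using hC q τ hτ) (hD q _) (norm_nonneg _) (hC0 q)

lemma continuousAt_regKernel_linC {ε : ℝ} (hk : 2 ≤ k) (hε : 0 < ε) (u : Fin 2 → ℤ) {z : ℂ}
    (hz : 0 < z.im) : ContinuousAt (fun z ↦ regKernel k ε (linC u z) z.im) z := by
  rcases eq_or_ne u 0 with rfl | hu
  · simpa [regKernel, linC, show k ≠ 0 by omega] using continuousAt_const
  have hl : Continuous (linC u) := by
    unfold linC
    fun_prop
  unfold regKernel
  refine ContinuousAt.div ?_ (by fun_prop) (pow_ne_zero _ (linC_ne_zero hu hz))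
  refine Complex.continuous_ofReal.continuousAt.comp' ?_
  refine ContinuousAt.div (by fun_prop) (by fun_prop) ?_
  positivity

lemma tsum_pairedPotential [NeZero N] (hk : 2 ≤ k) {ε : ℝ} (hε : 0 < ε)
    (g : CuspForm (principal N) k) (c : (Fin 2 → ZMod N) → ℂ) (τ : ℍ) :
    ∑' u, regPotential k ε (linC u τ) τ.im * pairedCoeff g c u τ = pairedPotential g ε c τ := by
  have h := hasSum_sum (s := Finset.univ) (fun (q : SL(2, ℤ) ⧸ Gamma N) _ ↦
    ((summable_potSeries hk hε (twist c q.out⁻¹) τ).hasSum.mul_left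
      (conj ((⇑g ∣[(k : ℤ)] q.out⁻¹) τ))))
  refine Eq.trans (tsum_congr fun u ↦ ?_) h.tsum_eq
  rw [pairedCoeff_eq, Finset.mul_sum]
  refine Finset.sum_congr rfl fun q _ ↦ ?_
  simp only [lin, linC]
  ring

lemma tsum_pairedReg [NeZero N] (hk : 2 ≤ k) {ε : ℝ} (hε : 0 < ε)
    (g : CuspForm (principal N) k) (c : (Fin 2 → ZMod N) → ℂ) (τ : ℍ) :
    ∑' u, regKernel k ε (linC u τ) τ.im * pairedCoeff g c u τ = pairedReg g ε c τ := by
  have h := hasSum_sum (s := Finset.univ) (fun (q : SL(2, ℤ) ⧸ Gamma N) _ ↦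
    ((summable_regSeries hk hε (twist c q.out⁻¹) τ).hasSum.mul_left
      (conj ((⇑g ∣[(k : ℤ)] q.out⁻¹) τ))))
  refine Eq.trans (tsum_congr fun u ↦ ?_) h.tsum_eq
  rw [pairedCoeff_eq, Finset.mul_sum]
  refine Finset.sum_congr rfl fun q _ ↦ ?_
  simp only [lin, linC]
  ring

lemma arc_le_one (x : ℝ) : arc x ≤ 1 := by
  rw [arc, Real.sqrt_le_one]
  nlinarith

lemma exists_coe_eq_fdParam {Y : ℝ} {p : ℝ × ℝ}
    (hp : p ∈ Set.Icc ((-1 / 2 : ℝ), (0 : ℝ)) ((1 / 2 : ℝ), Y)) :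
    ∃ τ : ℍ, (τ : ℂ) = fdParam p ∧ 0 < (τ : ℂ).im ∧ (τ : ℂ).im ≤ 1 + Y ∧ τ ∈ 𝒟 := by
  obtain ⟨h1, h2⟩ := mem_strip_of_mem_Icc hp
  have h3 := fdParam_im_pos h1 h2
  have h4 := ofComplex_fdParam_mem_fd h1 h2
  rw [ofComplex_apply_of_im_pos h3] at h4
  refine ⟨⟨fdParam p, h3⟩, rfl, h3, ?_, h4⟩
  change arc p.1 + p.2 ≤ 1 + Y
  have : p.2 ≤ Y := hp.2.2
  linarith [arc_le_one p.1]

lemma inv_norm_linC_pow_le {τ : ℍ} (hτ : τ ∈ 𝒟) {p : ℕ} (hp : p ≠ 0) (u : Fin 2 → ℤ) :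
    (‖linC u τ‖ ^ p)⁻¹ ≤ (fdBound ^ p)⁻¹ * (‖u‖ ^ p)⁻¹ :=
  inv_norm_lin_pow_le' fdBound_pos (fdBound_le hτ) hp u

/-- The density y⁻² of the hyperbolic measure turns y^k into y^(k-2), and the integrand becomes i
times the derivative of `pairedPotential`; only the top side of the domain survives. -/
lemma integral_fdTrunc_pairedReg [NeZero N] (hk : 2 ≤ k) {ε : ℝ} (hε : 0 < ε)
    (g : CuspForm (principal N) k) (c : (Fin 2 → ZMod N) → ℂ) {Y : ℝ} (hY : 0 ≤ Y) :
    ∫ τ in fdTrunc Y, pairedReg g ε c τ * τ.im ^ k =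
      Complex.I * ∫ x in (-1 / 2 : ℝ)..(1 / 2), -((arcDeriv x : ℂ) + Complex.I) *
        pairedPotential g ε c (ofComplex (fdParam (x, Y))) := by
  obtain ⟨K, hK0, hK⟩ := exists_norm_pairedCoeff_le g c
  let P : (Fin 2 → ℤ) → ℂ → ℂ := fun u z ↦ regPotential k ε (linC u z) z.im * pairedCoeff g c u z
  let d : (Fin 2 → ℤ) → ℂ → ℂ := fun u z ↦
    -Complex.I * (z.im : ℂ) ^ (k - 2) * regKernel k ε (linC u z) z.im * pairedCoeff g c u z
  have hP : ∀ u, ∀ z : ℂ, 0 < z.im → HasWirtingerAt (P u) (d u z) z := fun u z hz ↦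
    ((hasWirtingerAt_regPotential hk hε u hz).mul
      (hasWirtingerAt_pairedCoeff g c u hz)).congr_deriv (by simp only [d]; ring)
  have hd : ∀ u, ContinuousOn (d u) {z | 0 < z.im} := fun u z hz ↦ by
    refine ContinuousAt.continuousWithinAt ?_
    refine ContinuousAt.mul (ContinuousAt.mul (by fun_prop) ?_)
      (hasWirtingerAt_pairedCoeff g c u hz).continuousAt
    exact continuousAt_regKernel_linC hk hε u hz
  have hPs : ∀ τ : ℍ, ∑' u, P u τ = pairedPotential g ε c τ := tsum_pairedPotential hk hε g c
  have hPs' : ∀ z : ℂ, 0 < z.im → ∑' u, P u z = pairedPotential g ε c (ofComplex z) :=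
    fun z hz ↦ by rw [ofComplex_apply_of_im_pos hz, ← hPs]
  have hds : ∀ z : ℂ, 0 < z.im →
      ∑' u, d u z = -Complex.I * (z.im : ℂ) ^ (k - 2) * pairedReg g ε c (ofComplex z) :=
    fun z hz ↦ by
      rw [ofComplex_apply_of_im_pos hz, ← tsum_pairedReg hk hε, ← tsum_mul_left]
      refine tsum_congr fun u ↦ ?_
      simp only [d]
      rw [mul_assoc (-Complex.I * (z.im : ℂ) ^ (k - 2))]
      rfl
  have hlin : ∀ p ∈ Set.Icc ((-1 / 2 : ℝ), (0 : ℝ)) ((1 / 2 : ℝ), Y),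
      0 < (fdParam p).im ∧ (fdParam p).im ≤ 1 + Y ∧ ∀ u,
        ‖pairedCoeff g c u (fdParam p)‖ ≤ K ∧
        (‖linC u (fdParam p)‖ ^ (k + 2))⁻¹ ≤ (fdBound ^ (k + 2))⁻¹ * (‖u‖ ^ (k + 2))⁻¹ := by
    intro p hp
    obtain ⟨τ, h1, h2, h3, h4⟩ := exists_coe_eq_fdParam hp
    rw [← h1]
    exact ⟨h2, h3, fun u ↦ ⟨hK u _ h4, inv_norm_linC_pow_le h4 (by omega) u⟩⟩
  have hY1 : 0 < 1 + Y := by linarith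
  have hb := fdBound_pos
  -- `B₁` bounds the potentials and `B₂` their derivatives; 1 + Y bounds the height of the truncated
  -- domain.
  let B₁ : (Fin 2 → ℤ) → ℝ := fun u ↦
    ((1 + Y) ^ k / ε * ((fdBound ^ (k + 2))⁻¹ * (‖u‖ ^ (k + 2))⁻¹)) * K
  let B₂ : (Fin 2 → ℤ) → ℝ := fun u ↦
    ((1 + Y) ^ (k - 2) * (k * ((1 + Y) / ε) * ((fdBound ^ (k + 2))⁻¹ * (‖u‖ ^ (k + 2))⁻¹))) * K
  have hB₁ : ∀ u, 0 ≤ B₁ u := fun u ↦ by positivity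
  have hB₂ : ∀ u, 0 ≤ B₂ u := fun u ↦ by positivity
  have hu := (summable_inv_norm_pow (p := k + 2) (by omega)).mul_left ((fdBound ^ (k + 2))⁻¹)
  have hB : Summable fun u ↦ B₁ u + B₂ u :=
    ((hu.mul_left _).mul_right _).add (((hu.mul_left _).mul_left _).mul_right _)
  have hPB : ∀ u, ∀ p ∈ Set.Icc ((-1 / 2 : ℝ), (0 : ℝ)) ((1 / 2 : ℝ), Y),
      ‖P u (fdParam p)‖ ≤ B₁ u + B₂ u := fun u p hp ↦ by
    obtain ⟨h1, h2, h3⟩ := hlin p hp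
    refine le_trans ?_ (le_add_of_nonneg_right (hB₂ u))
    simp only [P, B₁]
    rw [norm_mul]
    refine mul_le_mul ?_ (h3 u).1 (norm_nonneg _) (by positivity)
    refine (norm_regPotential_le hk hε h1 _).trans ?_
    refine mul_le_mul ?_ (h3 u).2 (by positivity) (by positivity)
    gcongr
  have hdB : ∀ u, ∀ p ∈ Set.Icc ((-1 / 2 : ℝ), (0 : ℝ)) ((1 / 2 : ℝ), Y),
      ‖d u (fdParam p)‖ ≤ B₁ u + B₂ u := fun u p hp ↦ by
    obtain ⟨h1, h2, h3⟩ := hlin p hp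
    refine le_trans ?_ (le_add_of_nonneg_left (hB₁ u))
    simp only [d, B₂]
    rw [norm_mul, norm_mul, norm_mul, norm_neg, Complex.norm_I, one_mul, norm_pow,
      Complex.norm_real, Real.norm_of_nonneg h1.le]
    refine mul_le_mul ?_ (h3 u).1 (norm_nonneg _) (by positivity)
    refine mul_le_mul (by gcongr) ?_ (norm_nonneg _) (by positivity)
    refine (norm_regKernel_le_inv_pow_add_two (by omega) hε h1 _).trans ?_
    refine mul_le_mul ?_ (h3 u).2 (by positivity) (by positivity)
    gcongr
  have hT : ∀ z : ℂ, 0 < z.im → ∑' u, P u (z + 1) = ∑' u, P u z := fun z hz ↦ by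
    have hz1 : 0 < (z + 1).im := by simpa using hz
    rw [hPs' _ hz, hPs' _ hz1]
    have h := pairedPotential_smul hk g ε c ModularGroup.T (ofComplex z)
    have e : ofComplex (z + 1) = ModularGroup.T • ofComplex z := by
      refine UpperHalfPlane.ext ?_
      have := ModularGroup.coe_T_zpow_smul_eq (z := ofComplex z) (n := 1)
      rw [zpow_one] at this
      rw [this, ofComplex_apply_of_im_pos hz, ofComplex_apply_of_im_pos hz1]
      simp
    rw [e, h, ModularGroup.denom_apply, ModularGroup.coe_T]
    simp
  have hS : ∀ z : ℂ, 0 < z.im → ∑' u, P u (-1 / z) = conj z ^ 2 * ∑' u, P u z := fun z hz ↦ by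
    have h := pairedPotential_smul hk g ε c ModularGroup.S (ofComplex z)
    have e : ((ModularGroup.S • ofComplex z : ℍ) : ℂ) = -1 / z := by
      rw [modular_S_smul, ofComplex_apply_of_im_pos hz]
      simp [neg_div, inv_neg]
    rw [hPs' _ hz, ← e, hPs, h, ModularGroup.denom_S, ofComplex_apply_of_im_pos hz]
  have key := stokes_tsum hP hd hY hB hPB hdB hT hS
  have e1 : (∫ x in (-1 / 2 : ℝ)..(1 / 2), -((arcDeriv x : ℂ) + Complex.I) *
        pairedPotential g ε c (ofComplex (fdParam (x, Y)))) =
      ∫ x in (-1 / 2 : ℝ)..(1 / 2), -((arcDeriv x : ℂ) + Complex.I) *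
        ∑' u, P u (fdParam (x, Y)) := by
    refine intervalIntegral.integral_congr fun x hx ↦ ?_
    rw [Set.uIcc_of_le (by norm_num)] at hx
    rw [hPs' _ (fdParam_im_pos (p := (x, Y)) hx hY)]
  rw [e1, ← key, integral_fdTrunc, ← integral_const_mul]
  refine setIntegral_congr_fun measurableSet_Icc fun p hp ↦ ?_
  obtain ⟨h1, h2, h3⟩ := hlin p hp
  rw [hds _ h1, ofComplex_apply_of_im_pos h1]
  obtain ⟨m, rfl⟩ : ∃ m, k = m + 2 := ⟨k - 2, by omega⟩
  have h0 : ((fdParam p).im : ℂ) ≠ 0 := by exact_mod_cast h1.ne'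
  have e2 : ((UpperHalfPlane.mk (fdParam p) h1).im : ℂ) = ((fdParam p).im : ℂ) := rfl
  rw [e2, add_tsub_cancel_right]
  push_cast
  field_simp
  linear_combination (pairedReg g ε c ⟨fdParam p, h1⟩ * (fdParam p).im ^ (m + 2)) * Complex.I_sq

end EisGamma

/-! ### The limits Y → ∞ and ε → 0, and orthogonality. -/

namespace EisGamma

open Filter Topology
open scoped ComplexConjugate Manifold

variable {N : ℕ} {k : ℕ}

/-! ### Orthogonality of Eisenstein series and cusp forms -/

lemma measurable_regSeries_term (ε : ℝ) (c : (Fin 2 → ZMod N) → ℂ) (u : Fin 2 → ℤ) :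
    Measurable fun τ : ℍ ↦ c (fun i ↦ (u i : ZMod N)) * regKernel k ε (lin u τ) τ.im := by
  have h1 : Measurable fun τ : ℍ ↦ lin u τ := by
    unfold lin
    fun_prop
  have h2 : Measurable fun τ : ℍ ↦ τ.im := continuous_im.measurable
  unfold regKernel
  fun_prop

lemma aestronglyMeasurable_regSeries [NeZero N] (hk : 2 ≤ k) {ε : ℝ} (hε : 0 < ε)
    (c : (Fin 2 → ZMod N) → ℂ) (μ : Measure ℍ) : AEStronglyMeasurable (regSeries k ε c) μ := by
  refine aestronglyMeasurable_of_tendsto_ae (atTop : Filter (Finset (Fin 2 → ℤ)))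
    (f := fun s τ ↦ ∑ u ∈ s, c (fun i ↦ (u i : ZMod N)) * regKernel k ε (lin u τ) τ.im)
    (fun s ↦ ?_) (Eventually.of_forall fun τ ↦ (summable_regSeries hk hε c τ).hasSum)
  exact (Finset.measurable_fun_sum s fun u _ ↦
    measurable_regSeries_term ε c u).aestronglyMeasurable

lemma aestronglyMeasurable_pairedReg [NeZero N] (hk : 2 ≤ k) {ε : ℝ} (hε : 0 < ε)
    (g : CuspForm (principal N) k) (c : (Fin 2 → ZMod N) → ℂ) (μ : Measure ℍ) :
    AEStronglyMeasurable (fun τ : ℍ ↦ pairedReg g ε c τ * τ.im ^ k) μ := by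
  unfold pairedReg
  refine AEStronglyMeasurable.mul (Finset.aestronglyMeasurable_fun_sum _ fun q _ ↦ ?_) ?_
  · refine AEStronglyMeasurable.mul ?_ (aestronglyMeasurable_regSeries hk hε _ μ)
    have := (mdifferentiable_slash g q.out⁻¹).continuous
    exact (Complex.continuous_conj.comp this).aestronglyMeasurable
  · exact ((Complex.continuous_ofReal.comp continuous_im).pow k).aestronglyMeasurable

lemma one_add_norm_le_of_mem_fd {τ : ℍ} (hτ : τ ∈ 𝒟) : 1 + ‖(τ : ℂ)‖ ≤ 4 * τ.im := by
  have h1 := half_le_im_of_mem_fd hτ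
  have h2 := Complex.norm_le_abs_re_add_abs_im (τ : ℂ)
  have h3 : |(τ : ℂ).re| ≤ 1 / 2 := hτ.2
  have h4 : |(τ : ℂ).im| = τ.im := abs_of_pos τ.im_pos
  linarith

lemma exists_norm_pairedReg_le [NeZero N] (hk : 2 ≤ k) (g : CuspForm (principal N) k)
    (c : (Fin 2 → ZMod N) → ℂ) (hc : k = 2 → ∑ v, c v = 0) :
    ∃ C, ∀ ε, 0 < ε → ∀ τ ∈ 𝒟, ‖pairedReg g ε c τ * τ.im ^ k‖ ≤ C := by
  -- Decay of order k + 1: k powers cancel y^k, and one absorbs the growth 1 + ‖τ‖ ≤ 4 Im τ of the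
  -- Eisenstein series.
  choose C hC using fun q : SL(2, ℤ) ⧸ Gamma N ↦ exists_norm_slash_le g q.out⁻¹ (k + 1)
  choose D hD using fun q : SL(2, ℤ) ⧸ Gamma N ↦
    exists_norm_regSeries_le hk (twist c q.out⁻¹) (fun h ↦ (sum_twist c _).trans (hc h)) fdBound_pos
  refine ⟨∑ q, C q * |D q| * 4, fun ε hε τ hτ ↦ ?_⟩
  have hy := τ.im_pos
  rw [pairedReg, Finset.sum_mul]
  refine (norm_sum_le _ _).trans (Finset.sum_le_sum fun q _ ↦ ?_)
  rw [norm_mul, norm_mul, RCLike.norm_conj, norm_pow, Complex.norm_real, Real.norm_of_nonneg hy.le]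
  have h1 : ‖regSeries k ε (twist c q.out⁻¹) τ‖ ≤ |D q| * (4 * τ.im) := by
    refine (hD q ε hε τ (fdBound_le hτ)).trans ?_
    refine mul_le_mul (le_abs_self _) (one_add_norm_le_of_mem_fd hτ) (by positivity) (abs_nonneg _)
  have h2 := hC q τ hτ
  calc _ ≤ C q * (τ.im ^ (k + 1))⁻¹ * (|D q| * (4 * τ.im)) * τ.im ^ k := by
        refine mul_le_mul_of_nonneg_right ?_ (by positivity)
        exact mul_le_mul h2 h1 (norm_nonneg _) ((norm_nonneg _).trans h2)
    _ = _ := by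
      field_simp
      ring

lemma exists_norm_pairedPotential_le [NeZero N] (hk : 2 ≤ k) {ε : ℝ} (hε : 0 < ε)
    (g : CuspForm (principal N) k) (c : (Fin 2 → ZMod N) → ℂ) :
    ∃ C, ∀ τ ∈ 𝒟, ‖pairedPotential g ε c τ‖ ≤ C * τ.im⁻¹ := by
  choose C hC using fun q : SL(2, ℤ) ⧸ Gamma N ↦ exists_norm_slash_le g q.out⁻¹ (k + 1)
  choose D hD0 hD using fun q : SL(2, ℤ) ⧸ Gamma N ↦
    exists_norm_potSeries_le hk hε (twist c q.out⁻¹) fdBound_pos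
  refine ⟨∑ q, C q * D q, fun τ hτ ↦ ?_⟩
  have hy := τ.im_pos
  rw [pairedPotential, Finset.sum_mul]
  refine (norm_sum_le _ _).trans (Finset.sum_le_sum fun q _ ↦ ?_)
  rw [norm_mul, RCLike.norm_conj]
  have h2 := hC q τ hτ
  calc _ ≤ C q * (τ.im ^ (k + 1))⁻¹ * (D q * τ.im ^ k) :=
        mul_le_mul h2 (hD q τ (fdBound_le hτ)) (norm_nonneg _) ((norm_nonneg _).trans h2)
    _ = _ := by
      field_simp
      ring

/-- At fixed ε the top side of the truncated domain contributes O(1/Y). -/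
lemma integral_fd_pairedReg [NeZero N] (hk : 2 ≤ k) (g : CuspForm (principal N) k)
    (c : (Fin 2 → ZMod N) → ℂ) (hc : k = 2 → ∑ v, c v = 0) {ε : ℝ} (hε : 0 < ε) :
    ∫ τ in 𝒟, pairedReg g ε c τ * τ.im ^ k = 0 := by
  have hfd : MeasurableSet (𝒟 : Set ℍ) := ModularGroup.isClosed_fd.measurableSet
  have hint : IntegrableOn (fun τ ↦ pairedReg g ε c τ * τ.im ^ k) 𝒟 := by
    obtain ⟨C, hC⟩ := exists_norm_pairedReg_le hk g c hc
    refine Measure.integrableOn_of_bounded (M := C) volume_fd_lt_top.ne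
      (aestronglyMeasurable_pairedReg hk hε g c _) ?_
    filter_upwards [ae_restrict_mem hfd] with τ hτ using hC ε hε τ hτ
  refine tendsto_nhds_unique (tendsto_integral_fdTrunc hint) ?_
  obtain ⟨C, hC⟩ := exists_norm_pairedPotential_le hk hε g c
  have hC0 : 0 ≤ C := by
    have := (norm_nonneg _).trans (hC _ ModularGroup.I_mem_fd)
    simpa using this
  have hlim : Tendsto (fun Y : ℝ ↦ 2 * (C * Y⁻¹)) atTop (𝓝 0) := by
    simpa using (tendsto_inv_atTop_zero.const_mul C).const_mul 2
  refine squeeze_zero_norm' ?_ hlim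
  filter_upwards [eventually_gt_atTop 0] with Y hY
  rw [integral_fdTrunc_pairedReg hk hε g c hY.le, norm_mul, Complex.norm_I, one_mul]
  refine (intervalIntegral.norm_integral_le_of_norm_le_const (C := 2 * (C * Y⁻¹)) ?_).trans_eq ?_
  · intro x hx
    rw [Set.uIoc_of_le (by norm_num)] at hx
    have hx' := Set.Ioc_subset_Icc_self hx
    have h1 := fdParam_im_pos (p := (x, Y)) hx' hY.le
    have h2 := ofComplex_fdParam_mem_fd (p := (x, Y)) hx' hY.le
    rw [norm_mul]
    refine mul_le_mul (norm_arcDeriv_add_I_le hx') ?_ (norm_nonneg _) (by norm_num)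
    refine (hC _ h2).trans ?_
    gcongr
    rw [ofComplex_apply_of_im_pos h1]
    change Y ≤ arc x + Y
    linarith [half_lt_arc hx']
  · norm_num

/-- The limit ε → 0: the integrands are bounded by a constant independent of ε on a domain of finite
area. -/
lemma integral_fd_pairedEis [NeZero N] (hk : 2 ≤ k) (g : CuspForm (principal N) k)
    (c : (Fin 2 → ZMod N) → ℂ) (hc : k = 2 → ∑ v, c v = 0) :
    ∫ τ in 𝒟, (∑ q : SL(2, ℤ) ⧸ Gamma N, conj ((⇑g ∣[(k : ℤ)] q.out⁻¹) τ) *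
      ((k - 1) * eisSeries k (twist c q.out⁻¹) τ)) * (τ.im : ℂ) ^ k = 0 := by
  have hfd : MeasurableSet (𝒟 : Set ℍ) := ModularGroup.isClosed_fd.measurableSet
  obtain ⟨C, hC⟩ := exists_norm_pairedReg_le hk g c hc
  have h : Tendsto (fun ε ↦ ∫ τ in 𝒟, pairedReg g ε c τ * τ.im ^ k) (𝓝[>] 0)
      (𝓝 (∫ τ in 𝒟, (∑ q : SL(2, ℤ) ⧸ Gamma N, conj ((⇑g ∣[(k : ℤ)] q.out⁻¹) τ) *
        ((k - 1) * eisSeries k (twist c q.out⁻¹) τ)) * (τ.im : ℂ) ^ k)) := by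
    refine tendsto_integral_filter_of_dominated_convergence (fun _ ↦ C) ?_ ?_ ?_ ?_
    · filter_upwards [self_mem_nhdsWithin] with ε hε
      exact aestronglyMeasurable_pairedReg hk hε g c _
    · filter_upwards [self_mem_nhdsWithin] with ε hε
      filter_upwards [ae_restrict_mem hfd] with τ hτ using hC ε hε τ hτ
    · exact integrableOn_const volume_fd_lt_top.ne
    · refine Eventually.of_forall fun τ ↦ Tendsto.mul_const _ ?_
      exact tendsto_finsetSum _ fun q _ ↦ (tendsto_regSeries hk _
        (fun h ↦ (sum_twist c _).trans (hc h)) τ).const_mul _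
  refine tendsto_nhds_unique h (tendsto_const_nhds.congr' ?_)
  filter_upwards [self_mem_nhdsWithin] with ε hε
  exact (integral_fd_pairedReg hk g c hc hε).symm

lemma petersson_smul_eq (f g : ℍ → ℂ) (k : ℤ) (γ : SL(2, ℤ)) (τ : ℍ) :
    petersson k g f (γ • τ) = conj ((g ∣[k] γ) τ) * (f ∣[k] γ) τ * τ.im ^ k := by
  rw [← petersson_slash_SL, petersson]

lemma peterssonProduct_eq_sum [NeZero N] (k : ℤ) (f g : ℍ → ℂ) : peterssonProduct N k f g =
    ∑ q : SL(2, ℤ) ⧸ Gamma N, ∫ τ in 𝒟, petersson k g f (q.out⁻¹ • τ) :=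
  finsum_eq_sum_of_fintype _

/-- Eisenstein series are orthogonal to cusp forms. -/
theorem eisForm_mem_eisensteinSubspace [NeZero N] (hk : 2 ≤ k) (c : (Fin 2 → ZMod N) → ℂ)
    (hc : k = 2 → ∑ v, c v = 0) : eisForm hk c hc ∈ eisensteinSubspace N k := by
  intro g
  have hk1 : (k - 1 : ℂ) ≠ 0 := by
    rw [sub_ne_zero]
    exact_mod_cast (show k ≠ 1 by omega)
  have h := integral_fd_pairedEis hk g c hc
  suffices h0 : (k - 1 : ℂ) * peterssonProduct N k (eisForm hk c hc) g = 0 from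
    (mul_eq_zero.mp h0).resolve_left hk1
  have hsum := integral_finsetSum (μ := volume.restrict 𝒟) Finset.univ
    fun (q : SL(2, ℤ) ⧸ Gamma N) _ ↦ integrableOn_petersson N k (eisForm hk c hc) g q.out⁻¹
  rw [← h, peterssonProduct_eq_sum, ← hsum, ← integral_const_mul]
  refine integral_congr_ae (Eventually.of_forall fun τ ↦ ?_)
  beta_reduce
  rw [Finset.mul_sum, Finset.sum_mul]
  refine Finset.sum_congr rfl fun q _ ↦ ?_
  rw [petersson_smul_eq, coe_eisForm, eisSeries_slash hk c hc, zpow_natCast]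
  ring

end EisGamma

/-! ### Definiteness of the Petersson product on cusp forms; existence of constant terms. -/

namespace EisGamma

open Filter Topology
open scoped ComplexConjugate Manifold

variable {N : ℕ}

/-! ### Positivity of the Petersson product -/

lemma volume_ne_zero_of_isOpen {U : Set ℍ} (hU : IsOpen U) (hne : U.Nonempty) :
    volume U ≠ 0 := by
  intro h0
  have hm : AEMeasurable (fun z : ℍ ↦ (((1 / NNReal.mk z.im z.im_pos.le) ^ 2 : NNReal) : ENNReal))
      (volume.comap UpperHalfPlane.coe) := by
    have : Measurable fun z : ℍ ↦ NNReal.mk z.im z.im_pos.le :=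
      continuous_im.measurable.subtype_mk
    exact ((measurable_const.div this).pow_const 2).coe_nnreal_ennreal.aemeasurable
  have hac := withDensity_absolutelyContinuous' hm (Eventually.of_forall fun z ↦ by
    have : NNReal.mk z.im z.im_pos.le ≠ 0 := fun h ↦ z.im_ne_zero (congrArg NNReal.toReal h)
    exact ENNReal.coe_ne_zero.mpr (pow_ne_zero 2 (div_ne_zero one_ne_zero this)))
  have h1 : volume.comap UpperHalfPlane.coe U = 0 := hac h0
  rw [measurableEmbedding_coe.comap_apply] at h1
  exact ((isOpenEmbedding_coe.isOpenMap U hU).measure_ne_zero volume (hne.image _)) h1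

instance : (volume : Measure ℍ).IsOpenPosMeasure := ⟨fun _ hU hne ↦ volume_ne_zero_of_isOpen hU hne⟩

/-- The identity theorem on the half-plane, started at the interior point 2i. -/
lemma eq_zero_of_eqOn_fdo {F : ℍ → ℂ} (hF : MDiff F) (h : ∀ τ ∈ 𝒟ᵒ, F τ = 0) : F = 0 := by
  have h1 := UpperHalfPlane.mdifferentiable_iff.mp hF
  have h2 : AnalyticOnNhd ℂ (F ∘ ofComplex) {z | 0 < z.im} :=
    h1.analyticOnNhd isOpen_upperHalfPlaneSet
  let τ₀ : ℍ := ⟨2 * Complex.I, by simp⟩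
  have hτ₀ : τ₀ ∈ 𝒟ᵒ := by
    refine ⟨?_, ?_⟩
    · simp [τ₀, Complex.normSq_apply]
      norm_num
    · simp [τ₀, UpperHalfPlane.re]
  have h3 : (F ∘ ofComplex) =ᶠ[𝓝 (τ₀ : ℂ)] 0 := by
    have ho : IsOpen ((↑) '' (𝒟ᵒ : Set ℍ) : Set ℂ) :=
      isOpenEmbedding_coe.isOpenMap _ (ModularGroup.fdo_eq_interior_fd ▸ isOpen_interior)
    filter_upwards [ho.mem_nhds ⟨τ₀, hτ₀, rfl⟩]
    rintro _ ⟨τ, hτ, rfl⟩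
    simpa using h τ hτ
  have h4 := h2.eqOn_zero_of_preconnected_of_eventuallyEq_zero
    (convex_halfSpace_im_gt 0).isPreconnected τ₀.im_pos h3
  ext τ
  simpa using h4 τ.im_pos

lemma petersson_self (k : ℤ) (g : ℍ → ℂ) (τ : ℍ) :
    petersson k g g τ = ((‖g τ‖ ^ 2 * τ.im ^ k : ℝ) : ℂ) := by
  rw [petersson, Complex.conj_mul']
  push_cast
  rfl

/-- The Petersson product is definite on cusp forms. -/
theorem cuspForm_eq_zero [NeZero N] {k : ℤ} (g : CuspForm (principal N) k)
    (h : peterssonProduct N k g g = 0) : ⇑g = 0 := by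
  have hfd : MeasurableSet (𝒟 : Set ℍ) := ModularGroup.isClosed_fd.measurableSet
  let G : SL(2, ℤ) → ℍ → ℝ := fun δ τ ↦ ‖(⇑g ∣[k] δ) τ‖ ^ 2 * τ.im ^ k
  have hG : ∀ δ τ, petersson k g g (δ • τ) = (G δ τ : ℂ) := fun δ τ ↦ by
    rw [← petersson_slash_SL, petersson_self]
  have hG0 : ∀ δ τ, 0 ≤ G δ τ := fun δ τ ↦ by
    have := τ.im_pos
    positivity
  have hGi : ∀ δ, IntegrableOn (G δ) 𝒟 := fun δ ↦ by
    have h1 := (integrableOn_petersson N k (g : ModularForm (principal N) k) g δ).re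
    refine h1.congr (Eventually.of_forall fun τ ↦ ?_)
    beta_reduce
    change RCLike.re (petersson k g g (δ • τ)) = _
    rw [hG]
    exact Complex.ofReal_re _
  have hsum : ∑ q : SL(2, ℤ) ⧸ Gamma N, ∫ τ in 𝒟, G q.out⁻¹ τ = 0 := by
    rw [peterssonProduct_eq_sum] at h
    simp only [hG] at h
    exact_mod_cast h
  have hz := (Finset.sum_eq_zero_iff_of_nonneg fun q _ ↦
    integral_nonneg fun τ ↦ hG0 q.out⁻¹ τ).mp hsum
  -- One vanishing summand suffices. Its representative need not be 1, so `g` is recovered at the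
  -- end by slashing back.
  let q : SL(2, ℤ) ⧸ Gamma N := ((1 : SL(2, ℤ)) : SL(2, ℤ) ⧸ Gamma N)
  have hq := (setIntegral_eq_zero_iff_of_nonneg_ae (Eventually.of_forall (hG0 q.out⁻¹))
    (hGi q.out⁻¹)).mp (hz q (Finset.mem_univ q))
  have hcont : Continuous (G q.out⁻¹) := by
    have h1 := (mdifferentiable_slash g q.out⁻¹).continuous
    have h2 : Continuous fun τ : ℍ ↦ τ.im ^ k := continuous_im.zpow₀ k fun τ ↦ Or.inl τ.im_ne_zero
    exact (h1.norm.pow 2).mul h2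
  have hfdo : IsOpen (𝒟ᵒ : Set ℍ) := ModularGroup.fdo_eq_interior_fd ▸ isOpen_interior
  have hon := Measure.eqOn_open_of_ae_eq
    (ae_restrict_of_ae_restrict_of_subset ModularGroup.fdo_subset_fd hq) hfdo
    hcont.continuousOn continuousOn_const
  have hslash : ⇑g ∣[k] q.out⁻¹ = 0 := by
    refine eq_zero_of_eqOn_fdo (mdifferentiable_slash g _) fun τ hτ ↦ ?_
    have h1 : ‖(⇑g ∣[k] q.out⁻¹) τ‖ ^ 2 * τ.im ^ k = 0 := hon hτ
    have h2 : τ.im ^ k ≠ 0 := zpow_ne_zero _ τ.im_ne_zero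
    simpa [h2] using h1
  have h3 : (⇑g ∣[k] q.out⁻¹) ∣[k] q.out = ⇑g := by
    rw [← SlashAction.slash_mul, inv_mul_cancel, SlashAction.slash_one]
  rw [← h3, hslash, SlashAction.zero_slash]

/-! ### Constant terms -/

lemma tendsto_slash_valueAtInfty [NeZero N] {k : ℤ} (f : ModularForm (principal N) k)
    (δ : SL(2, ℤ)) : Tendsto (⇑f ∣[k] δ) atImInfty (𝓝 (valueAtInfty (⇑f ∣[k] δ))) := by
  have hN : (0 : ℝ) < N := by exact_mod_cast NeZero.pos N
  have h1 := exp_decay_sub_atImInfty hN (periodic_slash f δ) (mdifferentiable_slash f δ)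
    (isBoundedAtImInfty_slash f δ)
  have h2 : Tendsto (fun τ : ℍ ↦ Real.exp (-2 * Real.pi * τ.im / N)) atImInfty (𝓝 0) := by
    have h3 : Tendsto (fun y : ℝ ↦ Real.exp (-2 * Real.pi * y / N)) atTop (𝓝 0) := by
      refine Real.tendsto_exp_atBot.comp ?_
      have h4 : (-2 * Real.pi / N : ℝ) < 0 := div_neg_of_neg_of_pos (by linarith [Real.pi_pos]) hN
      refine (tendsto_id.const_mul_atTop_of_neg h4).congr fun y ↦ ?_
      simp only [id]
      ring
    exact h3.comp tendsto_comap
  have h3 := h1.trans_tendsto h2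
  simpa using h3.add_const (valueAtInfty (⇑f ∣[k] δ))

/-- A modular form for `Γ(N)` which vanishes at all cusps, as a cusp form. -/
def cuspFormOfIsZero [NeZero N] {k : ℤ} (f : ModularForm (principal N) k)
    (h : ∀ δ : SL(2, ℤ), IsZeroAtImInfty (⇑f ∣[k] δ)) : CuspForm (principal N) k where
  toFun := f
  slash_action_eq' := f.slash_action_eq'
  holo' := f.holo'
  zero_at_cusps' {x} hx := by
    rw [Subgroup.IsArithmetic.isCusp_iff_isCusp_SL2Z] at hx
    rw [OnePoint.isZeroAt_iff_forall_SL2Z hx]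
    exact fun γ _ ↦ h γ

/-- A form in the Eisenstein subspace which vanishes at all cusps is zero. -/
lemma eq_zero_of_mem_eisensteinSubspace [NeZero N] {k : ℤ} {f : ModularForm (principal N) k}
    (hf : f ∈ eisensteinSubspace N k) (h : ∀ δ : SL(2, ℤ), IsZeroAtImInfty (⇑f ∣[k] δ)) :
    f = 0 :=
  DFunLike.coe_injective (cuspForm_eq_zero (cuspFormOfIsZero f h) (hf (cuspFormOfIsZero f h)))

end EisGamma

/-! ### Möbius inversion: series with constant terms at a single cusp. -/

namespace EisGamma

open Filter Topology
open scoped ComplexConjugate Manifold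
open scoped ArithmeticFunction.Moebius ArithmeticFunction.zeta

variable {N : ℕ}

/-! ### Eisenstein series with a single nonzero constant term -/

lemma summable_pnat_inv_pow {k : ℕ} (hk : 2 ≤ k) : Summable fun n : ℕ+ ↦ (((n : ℕ) : ℝ) ^ k)⁻¹ :=
  summable_pnat_iff_summable_nat (f := fun n : ℕ ↦ ((n : ℝ) ^ k)⁻¹) |>.mpr
    (Real.summable_nat_pow_inv.mpr hk)

lemma norm_moebius_le (n : ℕ) : ‖((μ n : ℤ) : ℂ)‖ ≤ 1 := by
  rw [Complex.norm_intCast]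
  exact_mod_cast ArithmeticFunction.abs_moebius_le_one

/-- Grouped by the product ng, the inner sums are ∑ μ(g) over the divisors g, which vanish unless
the product is 1. -/
lemma tsum_tsum_moebius {k : ℕ} (hk : 2 ≤ k) (Φ : ℕ → ℂ) (hΦ : ∀ n, ‖Φ n‖ ≤ ((n : ℝ) ^ k)⁻¹) :
    ∑' n : ℕ+, ∑' g : ℕ+, ((μ (g : ℕ) : ℤ) : ℂ) * Φ (n * g) = Φ 1 := by
  have hs : Summable fun p : ℕ+ × ℕ+ ↦ ((μ (p.2 : ℕ) : ℤ) : ℂ) * Φ (p.1 * p.2) := by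
    refine Summable.of_norm_bounded ((summable_pnat_inv_pow hk).mul_of_nonneg
      (summable_pnat_inv_pow hk) (fun n ↦ by positivity) (fun n ↦ by positivity)) fun p ↦ ?_
    rw [norm_mul, ← mul_inv, ← mul_pow]
    refine (mul_le_mul (norm_moebius_le _) (hΦ _) (norm_nonneg _) zero_le_one).trans_eq ?_
    push_cast
    ring
  have hs' : Summable fun x : Σ n : ℕ+, Nat.divisorsAntidiagonal n ↦
      ((μ ((sigmaAntidiagonalEquivProd x).2 : ℕ) : ℤ) : ℂ) *
        Φ ((sigmaAntidiagonalEquivProd x).1 * (sigmaAntidiagonalEquivProd x).2) :=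
    sigmaAntidiagonalEquivProd.summable_iff.mpr hs
  rw [← hs.tsum_prod, ← sigmaAntidiagonalEquivProd.tsum_eq, hs'.tsum_sigma]
  have h : ∀ n : ℕ+, ∑' x : Nat.divisorsAntidiagonal n,
      ((μ ((sigmaAntidiagonalEquivProd ⟨n, x⟩).2 : ℕ) : ℤ) : ℂ) *
        Φ ((sigmaAntidiagonalEquivProd ⟨n, x⟩).1 * (sigmaAntidiagonalEquivProd ⟨n, x⟩).2) =
      if n = 1 then Φ 1 else 0 := by
    intro n
    have h1 : ∀ x : Nat.divisorsAntidiagonal n,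
        ((μ ((sigmaAntidiagonalEquivProd ⟨n, x⟩).2 : ℕ) : ℤ) : ℂ) *
          Φ ((sigmaAntidiagonalEquivProd ⟨n, x⟩).1 * (sigmaAntidiagonalEquivProd ⟨n, x⟩).2) =
        ((μ x.1.2 : ℤ) : ℂ) * Φ n := by
      rintro ⟨x, hx⟩
      have := (Nat.mem_divisorsAntidiagonal.mp hx).1
      simp only [sigmaAntidiagonalEquivProd, divisorsAntidiagonalFactors, Equiv.coe_fn_mk,
        PNat.mk_coe]
      rw [this]
    rw [tsum_congr h1, tsum_fintype, ← Finset.sum_mul,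
      Finset.univ_eq_attach, Finset.sum_attach (Nat.divisorsAntidiagonal n)
        fun x ↦ ((μ x.2 : ℤ) : ℂ)]
    have h2 := congrArg (fun f ↦ ((f n : ℤ) : ℂ)) ArithmeticFunction.coe_zeta_mul_moebius
    simp only [ArithmeticFunction.mul_apply, ArithmeticFunction.one_apply] at h2
    have h3 : ∑ x ∈ Nat.divisorsAntidiagonal n, ((μ x.2 : ℤ) : ℂ) =
        if (n : ℕ) = 1 then 1 else 0 := by
      push_cast at h2
      rw [← h2]
      refine Finset.sum_congr rfl fun x hx ↦ ?_
      have h4 : x.1 ≠ 0 := fun h ↦ by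
        have := (Nat.mem_divisorsAntidiagonal.mp hx)
        simp [h] at this
        exact n.ne_zero this.symm
      simp [ArithmeticFunction.zeta_apply, h4]
    rw [h3]
    by_cases hn : n = 1
    · simp [hn]
    · simp [hn]
  exact (tsum_congr h).trans (by simp)

/-- Coefficients supported on the vectors proportional to `w`. -/
def moebiusCoeff (k : ℕ) (w v : Fin 2 → ZMod N) : ℂ :=
  ∑' g : ℕ+, if ((g : ℕ) : ZMod N) • v = w then ((μ (g : ℕ) : ℤ) : ℂ) / ((g : ℕ) : ℂ) ^ k else 0

/-- The right action of `SL(2, ℤ)` on row vectors modulo `N`. -/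
def actRow (w : Fin 2 → ZMod N) (γ : SL(2, ℤ)) : Fin 2 → ZMod N :=
  Matrix.vecMul w (Matrix.SpecialLinearGroup.map (Int.castRingHom (ZMod N)) γ).1

lemma actRow_mul (w : Fin 2 → ZMod N) (γ δ : SL(2, ℤ)) :
    actRow w (γ * δ) = actRow (actRow w γ) δ := by
  simp only [actRow]
  rw [map_mul, Matrix.vecMul_vecMul]
  rfl

lemma actRow_of_mem_Gamma (w : Fin 2 → ZMod N) {γ : SL(2, ℤ)} (hγ : γ ∈ Gamma N) :
    actRow w γ = w := by
  have : Matrix.SpecialLinearGroup.map (Int.castRingHom (ZMod N)) γ = 1 := Gamma_mem'.mp hγ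
  rw [actRow, this]
  simp

lemma actRow_inv_eq_iff (v w : Fin 2 → ZMod N) (γ : SL(2, ℤ)) :
    actRow v γ⁻¹ = w ↔ v = actRow w γ := by
  constructor
  · rintro rfl
    rw [← actRow_mul, inv_mul_cancel, actRow_of_mem_Gamma v (one_mem _)]
  · rintro rfl
    rw [← actRow_mul, mul_inv_cancel, actRow_of_mem_Gamma w (one_mem _)]

lemma actRow_smul (a : ZMod N) (w : Fin 2 → ZMod N) (γ : SL(2, ℤ)) :
    actRow (a • w) γ = a • actRow w γ := Matrix.smul_vecMul _ _ _

lemma twist_moebiusCoeff (k : ℕ) (w : Fin 2 → ZMod N) (γ : SL(2, ℤ)) :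
    twist (moebiusCoeff k w) γ = moebiusCoeff k (actRow w γ) := by
  ext v
  change moebiusCoeff k w (actRow v γ⁻¹) = _
  refine tsum_congr fun g ↦ ?_
  simp only [← actRow_smul, actRow_inv_eq_iff]

/-- Formally, `moebiusCoeff` restricts the lattice sum to the primitive vectors congruent to w.
Those with m = 0 are (0, 1) and (0, -1), which give the two terms. -/
lemma eisConst_moebiusCoeff [NeZero N] {k : ℕ} (hk : 2 ≤ k) (w : Fin 2 → ZMod N) :
    eisConst k (moebiusCoeff k w) =
      (if w = ![0, 1] then 1 else 0) + (-1) ^ k * (if w = ![0, -1] then 1 else 0) := by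
  obtain ⟨C, hC0, hC⟩ := exists_norm_le_of_finite (moebiusCoeff k w)
  have hs : Summable fun n : ℤ ↦ moebiusCoeff k w ![0, (n : ZMod N)] / (n : ℂ) ^ k := by
    refine Summable.of_norm_bounded ((Real.summable_one_div_int_pow.mpr hk).abs.mul_left C) fun n ↦ ?_
    rw [norm_div, norm_pow, Complex.norm_intCast, abs_div, abs_one, abs_pow, div_eq_mul_one_div]
    exact mul_le_mul_of_nonneg_right (hC _) (by positivity)
  -- Here s = ±1 is the sign of the summation index of the constant term.
  have hterm : ∀ s : ℤ, s ^ 2 = 1 → ∑' n : ℕ+,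
      moebiusCoeff k w ![0, ((s * (n : ℕ) : ℤ) : ZMod N)] / ((s * (n : ℕ) : ℤ) : ℂ) ^ k =
      if w = ![0, (s : ZMod N)] then (s : ℂ) ^ k else 0 := by
    intro s hs
    have hs0 : (s : ℂ) ^ 2 = 1 := by exact_mod_cast hs
    have hsk : ((s : ℂ) ^ k)⁻¹ = (s : ℂ) ^ k := by
      rw [← inv_pow, ← eq_inv_of_mul_eq_one_left (by rw [← sq, hs0] : (s : ℂ) * s = 1)]
    let Φ : ℕ → ℂ := fun m ↦
      if ![0, (s : ZMod N) * (m : ZMod N)] = w then (s : ℂ) ^ k / (m : ℂ) ^ k else 0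
    have hΦ : ∀ n, ‖Φ n‖ ≤ ((n : ℝ) ^ k)⁻¹ := fun n ↦ by
      have h1 : ‖(s : ℂ)‖ = 1 := by
        have := congrArg norm hs0
        rw [norm_pow, norm_one] at this
        exact (pow_eq_one_iff_of_nonneg (norm_nonneg _) two_ne_zero).mp this
      simp only [Φ]
      split_ifs
      · rw [norm_div, norm_pow, norm_pow, h1, Complex.norm_natCast, one_pow, one_div]
      · rw [norm_zero]
        positivity
    have h := tsum_tsum_moebius hk Φ hΦ
    rw [show Φ 1 = if w = ![0, (s : ZMod N)] then (s : ℂ) ^ k else 0 by simp [Φ, eq_comm]] at h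
    rw [← h]
    refine tsum_congr fun n ↦ ?_
    rw [moebiusCoeff, ← tsum_div_const]
    refine tsum_congr fun g ↦ ?_
    have e : ((g : ℕ) : ZMod N) • ![0, ((s * (n : ℕ) : ℤ) : ZMod N)] =
        ![0, (s : ZMod N) * (((n : ℕ) * (g : ℕ) : ℕ) : ZMod N)] := by
      ext i
      fin_cases i
      · simp
      · simp
        ring
    simp only [Φ, e]
    split_ifs with h0
    · push_cast
      rw [mul_pow, mul_pow]
      field_simp
      rw [div_eq_mul_inv, hsk]
    · simp
  unfold eisConst
  rw [tsum_int_eq_zero_add_tsum_pnat hs]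
  have h1 := hterm 1 (by norm_num)
  have h2 := hterm (-1) (by norm_num)
  simp only [one_mul, neg_one_mul] at h1 h2
  rw [h1, h2]
  simp [show k ≠ 0 by omega]

end EisGamma

/-! ### Constant terms at all cusps, and the relation among them in weight 2. -/

namespace EisGamma

open Filter Topology
open scoped ComplexConjugate Manifold

variable {N : ℕ}

/-! ### Constant terms of modular forms for `Γ(N)` -/

/-- The constant term of `f ∣ δ`. -/
def constTerm {k : ℤ} (f : ModularForm (principal N) k) (δ : SL(2, ℤ)) : ℂ :=
  valueAtInfty (⇑f ∣[k] δ)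

lemma constTerm_mul_Gamma {k : ℤ} (f : ModularForm (principal N) k) (δ : SL(2, ℤ)) {γ : SL(2, ℤ)}
    (hγ : γ ∈ Gamma N) : constTerm f (δ * γ) = constTerm f δ := by
  rw [constTerm, slash_mul_Gamma f hγ, constTerm]

lemma constTerm_mul_T_zpow [NeZero N] {k : ℤ} (f : ModularForm (principal N) k) (δ : SL(2, ℤ))
    (j : ℤ) : constTerm f (δ * ModularGroup.T ^ j) = constTerm f δ := by
  have h1 := tendsto_slash_valueAtInfty f (δ * ModularGroup.T ^ j)
  have hT : Tendsto (fun τ : ℍ ↦ ModularGroup.T ^ j • τ) atImInfty atImInfty := by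
    refine tendsto_comap_iff.mpr (tendsto_comap.congr fun τ ↦ ?_)
    exact (ModularGroup.im_T_zpow_smul τ j).symm
  have h2 := (tendsto_slash_valueAtInfty f δ).comp hT
  refine tendsto_nhds_unique h1 (h2.congr fun τ ↦ ?_)
  rw [SlashAction.slash_mul, slash_T_zpow_apply, Function.comp_apply]

lemma constTerm_neg [NeZero N] {k : ℤ} (f : ModularForm (principal N) k) (δ : SL(2, ℤ)) :
    constTerm f (-δ) = (-1) ^ k * constTerm f δ := by
  have h1 := tendsto_slash_valueAtInfty f (-δ)
  have h2 := (tendsto_slash_valueAtInfty f δ).const_mul ((-1) ^ k)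
  refine tendsto_nhds_unique h1 (h2.congr fun τ ↦ ?_)
  rw [ModularForm.SL_slash_apply, ModularForm.SL_slash_apply, ModularGroup.SL_neg_smul,
    ModularGroup.denom_apply, ModularGroup.denom_apply]
  simp only [coe_neg, Matrix.neg_apply, Int.cast_neg]
  rw [show -(((δ 1 0 : ℤ) : ℂ)) * τ + -(((δ 1 1 : ℤ) : ℂ)) =
    (-1) * (((δ 1 0 : ℤ) : ℂ) * τ + ((δ 1 1 : ℤ) : ℂ)) by ring, mul_zpow]
  have : ((-1 : ℂ) ^ (-k)) = (-1) ^ k := by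
    rw [zpow_neg, ← inv_zpow, inv_neg, inv_one]
  rw [this]
  ring

lemma actRow_zero_one (γ : SL(2, ℤ)) :
    actRow (![0, 1] : Fin 2 → ZMod N) γ = ![((γ 1 0 : ℤ) : ZMod N), ((γ 1 1 : ℤ) : ZMod N)] := by
  ext i
  fin_cases i <;> simp [actRow, Matrix.vecMul, dotProduct]

/-- Modulo N such a γ is upper unipotent, so a power of T reduces it to the identity. Constant terms
are insensitive to T, hence to right multiplication by these γ. -/
lemma exists_mul_T_zpow_mem_Gamma {γ : SL(2, ℤ)}
    (h : actRow (![0, 1] : Fin 2 → ZMod N) γ = ![0, 1]) :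
    ∃ j : ℤ, γ * ModularGroup.T ^ j ∈ Gamma N := by
  rw [actRow_zero_one] at h
  have hc : ((γ 1 0 : ℤ) : ZMod N) = 0 := congrFun h 0
  have hd : ((γ 1 1 : ℤ) : ZMod N) = 1 := congrFun h 1
  have hdet : ((γ 0 0 : ℤ) : ZMod N) * ((γ 1 1 : ℤ) : ZMod N) -
      ((γ 0 1 : ℤ) : ZMod N) * ((γ 1 0 : ℤ) : ZMod N) = 1 := by
    have := Matrix.det_fin_two γ.1
    rw [γ.2] at this
    have := congrArg (Int.cast : ℤ → ZMod N) this
    push_cast at this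
    exact this.symm
  rw [hc, hd, mul_one, mul_zero, sub_zero] at hdet
  refine ⟨-γ 0 1, ?_⟩
  rw [Gamma_mem, coe_mul, ModularGroup.coe_T_zpow]
  simp [Matrix.mul_apply, Fin.sum_univ_two, hc, hd, hdet]

lemma constTerm_mul_of_actRow_eq [NeZero N] {k : ℤ} (f : ModularForm (principal N) k)
    (δ : SL(2, ℤ)) {γ : SL(2, ℤ)} (h : actRow (![0, 1] : Fin 2 → ZMod N) γ = ![0, 1]) :
    constTerm f (δ * γ) = constTerm f δ := by
  obtain ⟨j, hj⟩ := exists_mul_T_zpow_mem_Gamma h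
  rw [← constTerm_mul_T_zpow f (δ * γ) j, mul_assoc, constTerm_mul_Gamma f δ hj]

lemma constTerm_mul_of_actRow_eq_neg [NeZero N] {k : ℤ} (f : ModularForm (principal N) k)
    (δ : SL(2, ℤ)) {γ : SL(2, ℤ)} (h : actRow (![0, 1] : Fin 2 → ZMod N) γ = ![0, -1]) :
    (-1) ^ k * constTerm f δ = constTerm f (δ * γ) := by
  have h1 : actRow (![0, 1] : Fin 2 → ZMod N) (-γ) = ![0, 1] := by
    rw [actRow_zero_one] at h ⊢
    have hc : ((γ 1 0 : ℤ) : ZMod N) = 0 := congrFun h 0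
    have hd : ((γ 1 1 : ℤ) : ZMod N) = -1 := congrFun h 1
    simp [hc, hd]
  rw [← constTerm_mul_of_actRow_eq f δ h1, ← constTerm_neg]
  congr 1
  simp

/-! ### The trace to level one -/

/-- Right multiplication acts on the left cosets because Γ(N) is normal. -/
lemma sum_coset_mul_right [NeZero N] {M : Type*} [AddCommMonoid M] (F : SL(2, ℤ) → M)
    (hF : ∀ γ ∈ Gamma N, ∀ δ, F (δ * γ) = F δ) (γ : SL(2, ℤ)) :
    ∑ q : SL(2, ℤ) ⧸ Gamma N, F (q.out * γ) = ∑ q : SL(2, ℤ) ⧸ Gamma N, F q.out := by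
  have := Gamma_normal N
  refine Eq.trans (Finset.sum_congr rfl fun q _ ↦ ?_)
    (Equiv.sum_comp (Equiv.mulRight (γ : SL(2, ℤ) ⧸ Gamma N)) fun q : SL(2, ℤ) ⧸ Gamma N ↦ F q.out)
  have h : ((q * γ : SL(2, ℤ) ⧸ Gamma N).out : SL(2, ℤ) ⧸ Gamma N) =
      ((q.out * γ : SL(2, ℤ)) : SL(2, ℤ) ⧸ Gamma N) := by
    rw [QuotientGroup.mk_mul, QuotientGroup.out_eq', QuotientGroup.out_eq']
  rw [QuotientGroup.eq] at h
  rw [Equiv.coe_mulRight, ← hF _ h (q * γ : SL(2, ℤ) ⧸ Gamma N).out]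
  congr 1
  group

/-- The sum of the translates of a modular form for `Γ(N)`, a modular form of level one. -/
def traceForm [NeZero N] {k : ℤ} (f : ModularForm (principal N) k) : ModularForm 𝒮ℒ k where
  toFun := ∑ q : SL(2, ℤ) ⧸ Gamma N, ⇑f ∣[k] q.out
  slash_action_eq' A hA := by
    obtain ⟨A, rfl⟩ := hA
    have h := sum_coset_mul_right (fun δ ↦ ⇑f ∣[k] δ) (fun γ hγ δ ↦ slash_mul_Gamma f hγ δ) A
    refine Eq.trans ?_ h
    change (∑ q : SL(2, ℤ) ⧸ Gamma N, ⇑f ∣[k] q.out) ∣[k] A = _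
    rw [SlashAction.sum_slash]
    simp only [SlashAction.slash_mul]
  holo' := MDifferentiable.sum fun q _ ↦ mdifferentiable_slash f q.out
  bdd_at_cusps' {x} hx := by
    rw [OnePoint.isBoundedAt_iff_forall_SL2Z hx]
    intro γ _
    rw [SlashAction.sum_slash, IsBoundedAtImInfty, BoundedAtFilter]
    refine Asymptotics.IsBigO.sum fun q _ ↦ ?_
    rw [← SlashAction.slash_mul]
    exact isBoundedAtImInfty_slash f _

/-- The sum is the constant term of the trace of f, a form of level one and weight 2, hence 0. It
supplies the condition ∑ c = 0 in weight 2. -/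
lemma sum_constTerm_eq_zero [NeZero N] {k : ℤ} (hk : k = 2) (f : ModularForm (principal N) k) :
    ∑ q : SL(2, ℤ) ⧸ Gamma N, constTerm f q.out = 0 := by
  subst hk
  have h0 : traceForm f = 0 :=
    rank_zero_iff_forall_zero.mp ModularForm.levelOne_weight_two_rank_zero (traceForm f)
  have h1 : Tendsto (fun τ ↦ ∑ q : SL(2, ℤ) ⧸ Gamma N, (⇑f ∣[(2 : ℤ)] q.out) τ) atImInfty
      (𝓝 (∑ q : SL(2, ℤ) ⧸ Gamma N, constTerm f q.out)) :=
    tendsto_finsetSum _ fun q _ ↦ tendsto_slash_valueAtInfty f q.out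
  refine tendsto_nhds_unique h1 (tendsto_const_nhds.congr fun τ ↦ ?_)
  have h2 := congrArg (fun F : ModularForm 𝒮ℒ 2 ↦ F τ) h0
  have h3 : traceForm f τ = ∑ q : SL(2, ℤ) ⧸ Gamma N, (⇑f ∣[(2 : ℤ)] q.out) τ :=
    Finset.sum_apply _ _ _
  rw [← h3]
  exact h2.symm

end EisGamma

/-! ### Matching constant terms, and the spanning theorem. -/

namespace EisGamma

open Filter Topology

variable {N : ℕ} [NeZero N] {k : ℕ}

/-! ### The Eisenstein subspace is spanned by Eisenstein series -/

lemma eisConst_sum (hk : 2 ≤ k) {ι : Type*} (s : Finset ι) (a : ι → ℂ)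
    (c : ι → (Fin 2 → ZMod N) → ℂ) :
    eisConst k (fun v ↦ ∑ i ∈ s, a i * c i v) = ∑ i ∈ s, a i * eisConst k (c i) := by
  refine tendsto_nhds_unique (tendsto_eisSeries_atImInfty hk _) ?_
  refine Tendsto.congr (fun τ ↦ (eisSeries_sum hk s a c τ).symm) ?_
  exact tendsto_finsetSum _ fun i _ ↦ (tendsto_eisSeries_atImInfty hk (c i)).const_mul _

/-- There is an Eisenstein series with the same constant terms as a given modular form. -/
lemma exists_eisConst_twist_eq (hk : 2 ≤ k) (f : ModularForm (principal N) k) :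
    ∃ c : (Fin 2 → ZMod N) → ℂ, (k = 2 → ∑ v, c v = 0) ∧
      ∀ γ, eisConst k (twist c γ) = constTerm f γ := by
  let e : Fin 2 → ZMod N := ![0, 1]
  let e' : Fin 2 → ZMod N := ![0, -1]
  -- `I` counts how often a coset contributes to a constant term, twice if e = e'; the total `K` is
  -- the same for all γ and is divided out.
  let I : SL(2, ℤ) → ℕ := fun γ ↦ (if actRow e γ = e then 1 else 0) + if actRow e γ = e' then 1 else 0
  let K : ℕ := ∑ q : SL(2, ℤ) ⧸ Gamma N, I q.out⁻¹
  have hK : ∀ γ, ∑ q : SL(2, ℤ) ⧸ Gamma N, I (q.out⁻¹ * γ) = K := fun γ ↦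
    sum_coset_mul I (fun h hh δ ↦ by simp only [I, actRow_mul, actRow_of_mem_Gamma e hh]) γ
  have hK0 : (K : ℂ) ≠ 0 := by
    refine Nat.cast_ne_zero.mpr (ne_of_gt (Finset.sum_pos' (fun q _ ↦ Nat.zero_le _)
      ⟨((1 : SL(2, ℤ)) : SL(2, ℤ) ⧸ Gamma N), Finset.mem_univ _, ?_⟩))
    have h : ((1 : SL(2, ℤ)) : SL(2, ℤ) ⧸ Gamma N) =
        (((1 : SL(2, ℤ)) : SL(2, ℤ) ⧸ Gamma N).out : SL(2, ℤ) ⧸ Gamma N) :=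
      (QuotientGroup.out_eq' _).symm
    rw [QuotientGroup.eq, inv_one, one_mul] at h
    simp [I, actRow_of_mem_Gamma e (inv_mem h)]
  -- Each coset contributes the series concentrated at its cusp, weighted by the constant term of f
  -- there.
  let c : (Fin 2 → ZMod N) → ℂ := fun v ↦ ∑ q : SL(2, ℤ) ⧸ Gamma N,
    (K : ℂ)⁻¹ * constTerm f q.out * moebiusCoeff k (actRow e q.out⁻¹) v
  have htw : ∀ γ, twist c γ = fun v ↦ ∑ q : SL(2, ℤ) ⧸ Gamma N,
      (K : ℂ)⁻¹ * constTerm f q.out * moebiusCoeff k (actRow e (q.out⁻¹ * γ)) v := by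
    intro γ
    ext v
    simp only [twist, c]
    refine Finset.sum_congr rfl fun q _ ↦ ?_
    rw [actRow_mul, ← twist_moebiusCoeff k _ γ, twist]
  refine ⟨c, fun h2 ↦ ?_, fun γ ↦ ?_⟩
  · simp only [c]
    rw [Finset.sum_comm]
    -- The Möbius coefficients of all cosets are twists of one another and have the same total, so ∑
    -- c is a multiple of the sum of the constant terms of f.
    have h3 : ∀ q : SL(2, ℤ) ⧸ Gamma N,
        ∑ v, (K : ℂ)⁻¹ * constTerm f q.out * moebiusCoeff k (actRow e q.out⁻¹) v =
        constTerm f q.out * ((K : ℂ)⁻¹ * ∑ v, moebiusCoeff k e v) := fun q ↦ by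
      rw [← Finset.mul_sum, ← twist_moebiusCoeff, sum_twist]
      ring
    rw [Finset.sum_congr rfl fun q _ ↦ h3 q, ← Finset.sum_mul,
      sum_constTerm_eq_zero (by exact_mod_cast h2), zero_mul]
  · rw [htw, eisConst_sum hk]
    -- Only those q matter for which `q.out⁻¹ * γ` sends e to ±e; there f has the same constant term
    -- at `q.out` and at γ, up to the sign (-1)^k, which is squared away.
    have h3 : ∀ q : SL(2, ℤ) ⧸ Gamma N, (K : ℂ)⁻¹ * constTerm f q.out *
        eisConst k (moebiusCoeff k (actRow e (q.out⁻¹ * γ))) =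
        (K : ℂ)⁻¹ * constTerm f γ * (I (q.out⁻¹ * γ) : ℂ) := by
      intro q
      have hq : q.out * (q.out⁻¹ * γ) = γ := mul_inv_cancel_left _ _
      rw [eisConst_moebiusCoeff hk, mul_assoc, mul_assoc]
      congr 1
      simp only [I, Nat.cast_add, Nat.cast_ite, Nat.cast_one, Nat.cast_zero, mul_add]
      congr 1
      · split_ifs with h
        · have := constTerm_mul_of_actRow_eq f q.out h
          rw [hq] at this
          rw [this]
        · rw [mul_zero, mul_zero]
      · split_ifs with h
        · have := constTerm_mul_of_actRow_eq_neg f q.out h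
          rw [hq, zpow_natCast] at this
          rw [← this]
          ring
        · rw [mul_zero, mul_zero, mul_zero]
    rw [Finset.sum_congr rfl fun q _ ↦ h3 q, ← Finset.mul_sum, ← Nat.cast_sum, hK]
    field_simp

/-- Every form in the Eisenstein subspace is an Eisenstein series. -/
theorem exists_eq_eisForm (hk : 2 ≤ k) {f : ModularForm (principal N) k}
    (hf : f ∈ eisensteinSubspace N k) :
    ∃ (c : (Fin 2 → ZMod N) → ℂ) (hc : k = 2 → ∑ v, c v = 0), f = eisForm hk c hc := by
  obtain ⟨c, hc, hconst⟩ := exists_eisConst_twist_eq hk f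
  refine ⟨c, hc, sub_eq_zero.mp (eq_zero_of_mem_eisensteinSubspace
    (Submodule.sub_mem _ hf (eisForm_mem_eisensteinSubspace hk c hc)) fun δ ↦ ?_)⟩
  have h1 : ⇑(f - eisForm hk c hc) ∣[(k : ℤ)] δ = ⇑f ∣[(k : ℤ)] δ - eisSeries k (twist c δ) := by
    rw [← eisSeries_slash hk c hc, FunLike.coe_sub, coe_eisForm, sub_eq_add_neg,
      SlashAction.add_slash, SlashAction.neg_slash, ← sub_eq_add_neg]
  rw [h1, IsZeroAtImInfty, ZeroAtFilter]
  have h2 := (tendsto_slash_valueAtInfty f δ).sub (tendsto_eisSeries_atImInfty hk (twist c δ))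
  rw [hconst, constTerm, sub_self] at h2
  exact h2

/-- The Eisenstein subspace is spanned by the series `H_k^v`. -/
theorem span_eisH_eq (hk : 2 ≤ k) :
    Submodule.span ℂ {f : ℍ → ℂ | ∃ v : Fin 2 → ZMod N, (k = 2 → v ≠ 0) ∧ f = eisH N k v} =
      (eisensteinSubspace N k).map (toFunₗ N k) := by
  have hk0 : k ≠ 0 := by omega
  refine le_antisymm (Submodule.span_le.mpr ?_) ?_
  · rintro _ ⟨v, hv, rfl⟩
    have hc : k = 2 → ∑ w, mu (pairing w v) = 0 := fun h ↦ by
      rw [sum_mu_pairing_left, if_neg (hv h)]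
    exact ⟨eisForm hk (fun w ↦ mu (pairing w v)) hc, eisForm_mem_eisensteinSubspace hk _ hc,
      (eisH_eq hk0 v).symm⟩
  · rintro _ ⟨f, hf, rfl⟩
    obtain ⟨c, hc, rfl⟩ := exists_eq_eisForm hk hf
    -- The finite Fourier transform of c. Its value at 0 is ∑ c / N², so for k = 2 the excluded
    -- series for u = 0 has coefficient 0.
    let a : (Fin 2 → ZMod N) → ℂ := fun u ↦ 1 / (N : ℂ) ^ 2 * ∑ v, c v * mu (-pairing v u)
    have h : toFunₗ N k (eisForm hk c hc) = ∑ u, a u • eisH N k u := by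
      ext τ
      change eisSeries k c τ = _
      rw [eisSeries_eq_sum_eisG hk, Finset.sum_apply]
      simp only [eisG_eq_sum_eisH hk, Pi.smul_apply, smul_eq_mul, a, Finset.mul_sum, Finset.sum_mul]
      rw [Finset.sum_comm]
      refine Finset.sum_congr rfl fun u _ ↦ Finset.sum_congr rfl fun v _ ↦ ?_
      ring
    rw [h]
    refine Submodule.sum_mem _ fun u _ ↦ ?_
    by_cases hu : k = 2 ∧ u = 0
    · have h0 : a u = 0 := by
        simp only [a, hu.2, pairing, Pi.zero_apply, mul_zero, sub_zero, neg_zero, mu_zero, mul_one,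
          hc hu.1]
      rw [h0, zero_smul]
      exact Submodule.zero_mem _
    · exact Submodule.smul_mem _ _ (Submodule.subset_span ⟨u, fun h h0 ↦ hu ⟨h, h0⟩, rfl⟩)

end EisGamma

end

theorem proposition2p1 (N : ℕ) [NeZero N] (k : ℤ) (hk : 2 ≤ k) :
    -- the `H_k^v` (with `v ≠ 0` if `k = 2`) span the Eisenstein subspace
    Submodule.span ℂ {f : UpperHalfPlane → ℂ |
        ∃ v : Fin 2 → ZMod N, (k = 2 → v ≠ 0) ∧ f = EisGamma.eisH N k v} =
      (EisGamma.eisensteinSubspace N k).map (EisGamma.toFunₗ N k) ∧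
    -- `H` in terms of `G`
    (∀ (v : Fin 2 → ZMod N) (τ : UpperHalfPlane),
      EisGamma.eisH N k v τ =
        ∑ u : Fin 2 → ZMod N, EisGamma.mu (EisGamma.pairing u v) * EisGamma.eisG N k u τ) ∧
    -- `G` in terms of `H`: the inverse transform
    (∀ (v : Fin 2 → ZMod N) (τ : UpperHalfPlane),
      EisGamma.eisG N k v τ =
        1 / (N : ℂ) ^ 2 *
          ∑ u : Fin 2 → ZMod N, EisGamma.mu (-EisGamma.pairing v u) * EisGamma.eisH N k u τ) ∧
    -- the same with `-(u|v)` in the exponent, which costs the sign `(-1)^k`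
    (∀ (v : Fin 2 → ZMod N) (τ : UpperHalfPlane),
      EisGamma.eisG N k v τ =
        (-1) ^ k * (1 / (N : ℂ) ^ 2 *
          ∑ u : Fin 2 → ZMod N, EisGamma.mu (-EisGamma.pairing u v) * EisGamma.eisH N k u τ)) ∧
    -- the formula for `g_2^v`
    (∀ (v₀ v : Fin 2 → ZMod N) (τ : UpperHalfPlane),
      EisGamma.eisg N v₀ v τ =
        1 / (N : ℂ) ^ 2 *
          ∑ u ∈ Finset.univ.erase (0 : Fin 2 → ZMod N),
            (EisGamma.mu (-EisGamma.pairing u v) - EisGamma.mu (-EisGamma.pairing u v₀)) *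
              EisGamma.eisH N 2 u τ) := by
  lift k to ℕ using by omega
  have hk' : 2 ≤ k := by exact_mod_cast hk
  refine ⟨?_, EisGamma.eisH_eq_sum_eisG hk', EisGamma.eisG_eq_sum_eisH hk', fun v τ ↦ ?_,
    EisGamma.eisg_eq_sum_eisH⟩
  · have h2 : (k : ℤ) = 2 ↔ k = 2 := by norm_cast
    simp only [h2]
    exact EisGamma.span_eisH_eq hk'
  · rw [zpow_natCast]
    exact EisGamma.eisG_eq_sum_eisH' hk' v τ
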